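/- Let $X_1,\dots,X_n$ be random vectors, $X_i$ with values in $\mathbb R^{d_i}$, on a common probability space (possibly dependent), and for each $i$ let $\rho_i$ be a symmetric, $\sigma$-finite Borel measure on $\mathbb R^{d_i}$ with full support and $\int 1\wedge|t|^2\,\rho_i(dt)<\infty$. Put $\psi_i(x)=\int_{\mathbb R^{d_i}}(1-\cos(x\cdot t))\,\rho_i(dt)$ and assume $\mathbb E\,\psi_i(X_i)<\infty$ for $1\le i\le n$. Let $S\subset\{1,\dots,n\}$ with $|S|\ge 2$ and $\rho_S=\bigotimes_{i\in S}\rho_i$. For points $x^{(1)},\dots,x^{(N)}\in\mathbb R^{d_1}\times\dots\times\mathbb R^{d_n}$ define the sample distance multivariance $${}^N\!M_{\rho_S}=\|{}^N\!Z_S\|_{L^2(\rho_S)},\qquad {}^N\!Z_S(t_S)=\frac1N\sum_{l=1}^N\prod_{i\in S}\Bigl(e^{\mathrm i x_i^{(l)}\cdot t_i}-\frac1N\sum_{k=1}^N e^{\mathrm i x_i^{(k)}\cdot t_i}\Bigr).$$ With $B_i=(\psi_i(x_i^{(l)}-x_i^{(k)}))_{l,k=1,\dots,N}$, with $\circ$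 the Hadamard (entrywise) product, powers being matrix powers, and $|A|=\sum_{l,k}|a_{l,k}|$, put $$\hat\mu_i^{(1)}=\frac{|B_i|}{N^2},\qquad \hat\mu_i^{(2)}=\frac{|B_i\circ B_i|}{N^2}-\frac{2|B_i^2|}{N^3}+\frac{|B_i|^2}{N^4},$$ $$\hat\mu_i^{(3)}=-\frac{|B_i^2\circ B_i|}{N^3}+\frac{3|B_i^3|}{N^4}-\frac{3|B_i^2|\,|B_i|}{N^5}+\frac{|B_i|^3}{N^6},$$ $$\hat\mu_i^{(4)}=\frac{|B_i^3\circ B_i|}{N^4}-\frac{4|B_i^4|}{N^5}+\frac{4|B_i^3|\,|B_i|}{N^6}+\frac{2|B_i^2|^2}{N^6}-\frac{4|B_i^2|\,|B_i|^2}{N^7}+\frac{|B_i|^4}{N^8},$$ and $\hat\mu_S^{(k)}=\prod_{i\in S}\hat\mu_i^{(k)}$. Then the statistic $N\cdot{}^N\!M_{\rho_S}^2$, evaluated at $N$ independent random vectors each having *independent* components with the same marginal laws as $X_1,\dots,X_n$, converges in distribution as $N\to\infty$. Denote its limit by $\|\mathbb G\|^2_{\rho_S}$; it has a finite fourth moment.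 If the estimators $\hat\mu_S^{(k)}$ are evaluated at the first $N$ members of a sequence of independent copies of $(X_1,\dots,X_n)$ (whose components may be dependent), then almost surely, as $N\to\infty$, $$\hat\mu_S^{(1)}\to\mathbb E\|\mathbb G\|^2_{\rho_S},\qquad 2\hat\mu_S^{(2)}\to\mathbb V(\|\mathbb G\|^2_{\rho_S}),\qquad 8\hat\mu_S^{(3)}\to\mathbb E\bigl[(\|\mathbb G\|^2_{\rho_S}-\mathbb E\|\mathbb G\|^2_{\rho_S})^3\bigr],$$ $$48\hat\mu_S^{(4)}+12\bigl(\hat\mu_S^{(2)}\bigr)^2\to\mathbb E\bigl[(\|\mathbb G\|^2_{\rho_S}-\mathbb E\|\mathbb G\|^2_{\rho_S})^4\bigr].$$ -/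

import Mathlib

open MeasureTheory ProbabilityTheory Filter Topology
open scoped Matrix BoundedContinuousFunction

noncomputable section

namespace DistMultivariance

/-- Euclidean space of dimension `k`. -/
abbrev Euc (k : ℕ) : Type := EuclideanSpace ℝ (Fin k)

/-- The real-valued continuous negative definite function of a symmetric measure:
`ψ(x) = ∫ (1 - cos (x · t)) ρ(dt)`. -/
def psi {k : ℕ} (ρ : Measure (Euc k)) (x : Euc k) : ℝ :=
  ∫ t, (1 - Real.cos (inner ℝ x t)) ∂ρ

/-- The distance matrix `B = (ψ(x⁽ˡ⁾ - x⁽ᵏ⁾))` of a sample of size `N`. -/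
def distMatrix {k N : ℕ} (ρ : Measure (Euc k)) (x : Fin N → Euc k) :
    Matrix (Fin N) (Fin N) ℝ :=
  Matrix.of fun l m => psi ρ (x l - x m)

/-- `|A|`, the sum of the absolute values of the entries of `A`. -/
def absSum {N : ℕ} (A : Matrix (Fin N) (Fin N) ℝ) : ℝ :=
  ∑ l, ∑ m, |A l m|

/-- First moment estimator, as a function of the distance matrix. -/
def est1 {N : ℕ} (B : Matrix (Fin N) (Fin N) ℝ) : ℝ :=
  1 / (N : ℝ) ^ 2 * absSum B

/-- Second moment estimator, as a function of the distance matrix. -/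
def est2 {N : ℕ} (B : Matrix (Fin N) (Fin N) ℝ) : ℝ :=
  1 / (N : ℝ) ^ 2 * absSum (B ⊙ B) - 2 / (N : ℝ) ^ 3 * absSum (B ^ 2)
    + 1 / (N : ℝ) ^ 4 * absSum B ^ 2

/-- Third moment estimator, as a function of the distance matrix. -/
def est3 {N : ℕ} (B : Matrix (Fin N) (Fin N) ℝ) : ℝ :=
  -(1 / (N : ℝ) ^ 3 * absSum ((B ^ 2) ⊙ B)) + 3 / (N : ℝ) ^ 4 * absSum (B ^ 3)
    - 3 / (N : ℝ) ^ 3 * absSum (B ^ 2) * (1 / (N : ℝ) ^ 2 * absSum B)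
    + 1 / (N : ℝ) ^ 6 * absSum B ^ 3

/-- Fourth moment estimator, as a function of the distance matrix. -/
def est4 {N : ℕ} (B : Matrix (Fin N) (Fin N) ℝ) : ℝ :=
  1 / (N : ℝ) ^ 4 * absSum ((B ^ 3) ⊙ B) - 4 / (N : ℝ) ^ 5 * absSum (B ^ 4)
    + 4 / (N : ℝ) ^ 4 * absSum (B ^ 3) * (1 / (N : ℝ) ^ 2 * absSum B)
    + 2 * (1 / (N : ℝ) ^ 3 * absSum (B ^ 2)) ^ 2
    - 4 / (N : ℝ) ^ 3 * absSum (B ^ 2) * (1 / (N : ℝ) ^ 4 * absSum B ^ 2)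
    + 1 / (N : ℝ) ^ 8 * absSum B ^ 4

/-- The estimator `∏_{i ∈ S} est(B_i)` of a sample `x⁽¹⁾, …, x⁽ᴺ⁾` of an `n`-tuple of vectors,
where `est` is one of `est1`, …, `est4`. -/
def estS {n N : ℕ} {d : Fin n → ℕ} (est : Matrix (Fin N) (Fin N) ℝ → ℝ)
    (ρ : ∀ i, Measure (Euc (d i))) (S : Finset (Fin n)) (x : Fin N → ∀ i, Euc (d i)) : ℝ :=
  ∏ i ∈ S, est (distMatrix (ρ i) fun l => x l i)

/-- The empirical field
`Z_S(t_S) = N⁻¹ ∑_l ∏_{i ∈ S} (exp (𝐢 x_i⁽ˡ⁾ · t_i) - N⁻¹ ∑_k exp (𝐢 x_i⁽ᵏ⁾ · t_i))`. -/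
def sampleZ {n N : ℕ} {d : Fin n → ℕ} (S : Finset (Fin n)) (x : Fin N → ∀ i, Euc (d i))
    (t : ∀ i : S, Euc (d i)) : ℂ :=
  1 / (N : ℂ) * ∑ l, ∏ i : S,
    (Complex.exp (Complex.I * (inner ℝ (x l i) (t i) : ℝ))
      - 1 / (N : ℂ) * ∑ m, Complex.exp (Complex.I * (inner ℝ (x m i) (t i) : ℝ)))

/-- Sample distance multivariance: the norm of `Z_S` in `L²(ρ_S)`, `ρ_S = ⨂_{i ∈ S} ρ_i`. -/
def sampleM {n N : ℕ} {d : Fin n → ℕ} (ρ : ∀ i, Measure (Euc (d i))) (S : Finset (Fin n))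
    (x : Fin N → ∀ i, Euc (d i)) : ℝ :=
  Real.sqrt (∫ t, ‖sampleZ S x t‖ ^ 2 ∂(Measure.pi fun i : S => ρ i))

/-- `ν` is the limit in distribution, as `N → ∞`, of the test statistic `N · M_{ρ_S}²` evaluated
at `N` independent vectors, each of which has independent components with marginal laws `μ i`. -/
def IsLimitLawUnderIndependence {n : ℕ} {d : Fin n → ℕ} (ρ : ∀ i, Measure (Euc (d i)))
    (S : Finset (Fin n)) (μ : ∀ i, Measure (Euc (d i))) (ν : Measure ℝ) : Prop :=
  ∀ f : ℝ →ᵇ ℝ,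
    Tendsto
      (fun N : ℕ => ∫ x : Fin N → ∀ i, Euc (d i), f (N * sampleM ρ S x ^ 2)
        ∂(Measure.pi fun _ : Fin N => Measure.pi μ))
      atTop (𝓝 (∫ y, f y ∂ν))

end DistMultivariance

end

open DistMultivariance

/-! ### Moments of weighted chi-square series. -/

section ChiSquareSeries

/-! Let `V_i(x)` be the centered character `t ↦ exp(𝐢 x·t) - 𝔼 exp(𝐢 X_i·t)`, a vector of `L²(ρ_i)`
regarded as a real Hilbert space, and let `T_i = 𝔼 V_i ⊗ V_i` be its covariance operator. Both sides
of the claim are expressed through the numbers `τ_i k = 𝔼⟨V_i, T_i^k V_i⟩`, the traces of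
`T_i^(k+1)`.

Limit side. Under independence, `N · M²` differs by `O(N^(-1/2))` in `L¹` from the squared norm of a
normalised sum of iid centered vectors, the products of the `V_i` over `i ∈ S`; here `|S| ≥ 2`
enters (`integral_abs_norm_sq_centeredSumField_sub_le`). The Hilbert space central limit theorem
(`tendstoInDistribution_norm_sq_normalized_sum`) gives the limit `∑ c_j g_j²`, with `g_j`
independent standard Gaussians and `c_j` the eigenvalues of the covariance operator of the product.
Its mean is `∑ c_j` and its centered moments are `2 ∑ c_j²`, `8 ∑ c_j³` and `48 ∑ c_j⁴ + 12 (∑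
c_j²)²`. These power sums are traces, and the covariance operator of the product acts as the tensor
product of the `T_i`, so the traces are the products of the `τ_i k` over `S`
(`inner_covOp_pow_prod`). Symmetry of `ρ_i` makes the complex inner products real, which allows this
factorisation for the real inner product.

Estimator side. As `ψ_i(x - y) = ½‖V_i(x) - V_i(y)‖²`, the doubly centered distance matrix is minus
the Gram matrix of the vectors centered at their sample mean. Expanding the power traces of that
Gram matrix yields exactly the four estimators (`est_eq_trace_gram`), and they are also the power
traces of the empirical covariance operator, which converge by strong laws in the Hilbert space and
in operator norm (`ae_tendsto_empirical_power_trace`). Each factor involves one coordinate of the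
sample only, so dependence between the components is harmless. -/

lemma integral_pow_gaussianReal (n : ℕ) :
    ∫ x, x ^ (2 * n) ∂(gaussianReal 0 1) = (Nat.doubleFactorial (2 * n - 1) : ℝ) := by
  -- The half-line integral is a Gamma integral, and evenness (`hA`) doubles it. For `n = 0` the
  -- truncated subtraction gives `0‼ = 1`, the correct value.
  have hI : ∫ x in Set.Ioi (0 : ℝ), x ^ (2 * n) * Real.exp (-x ^ 2 / 2)
      = (1 / 2 : ℝ) ^ (-((2 * n : ℝ) + 1) / 2) * (1 / 2) * Real.Gamma (n + 1 / 2) := by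
    have := integral_rpow_mul_exp_neg_mul_rpow (p := 2) (q := 2 * n) (b := 1 / 2) (by norm_num)
      (by have : (0 : ℝ) ≤ n := n.cast_nonneg
          linarith) (by norm_num)
    rw [show (n : ℝ) + 1 / 2 = (2 * n + 1) / 2 by ring, ← this]
    refine setIntegral_congr_fun measurableSet_Ioi fun x hx => ?_
    have h1 : x ^ (2 * (n : ℝ)) = x ^ (2 * n) := by
      rw [← Real.rpow_natCast]; push_cast; rfl
    have h2 : x ^ (2 : ℝ) = x ^ 2 := by rw [← Real.rpow_natCast]; norm_num
    simp only [h1, h2]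
    ring_nf
  have hA : ∫ x : ℝ, x ^ (2 * n) * Real.exp (-x ^ 2 / 2)
      = 2 * ∫ x in Set.Ioi (0 : ℝ), x ^ (2 * n) * Real.exp (-x ^ 2 / 2) := by
    rw [← integral_comp_abs (f := fun x => x ^ (2 * n) * Real.exp (-x ^ 2 / 2))]
    simp [pow_mul]
  rw [integral_gaussianReal_eq_integral_smul one_ne_zero]
  have : ∀ x : ℝ, gaussianPDFReal 0 1 x • x ^ (2 * n)
      = (√(2 * Real.pi))⁻¹ * (x ^ (2 * n) * Real.exp (-x ^ 2 / 2)) := by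
    intro x; simp [gaussianPDFReal]; ring
  simp_rw [this]
  rw [integral_const_mul, hA, hI, Real.Gamma_nat_add_half]
  have h3 : (1 / 2 : ℝ) ^ (-((2 * n : ℝ) + 1) / 2) = 2 ^ n * √2 := by
    rw [Real.sqrt_eq_rpow, ← Real.rpow_natCast, ← Real.rpow_add (by norm_num), one_div,
      Real.inv_rpow (by norm_num), ← Real.rpow_neg (by norm_num)]
    congr 1; ring
  rw [h3, Real.sqrt_mul (by norm_num)]
  have := Real.sqrt_pos.2 Real.pi_pos
  have h2 : 0 < √(2:ℝ) := by positivity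
  field_simp

/-- Mixed terms with a factor of degree one vanish by independence and centering; up to degree four
only `A² B²` survives, with coefficient 6. -/
lemma integral_add_sq_of_indepFun {Ω : Type*} [MeasurableSpace Ω] {P : Measure Ω}
    [IsProbabilityMeasure P] {A B : Ω → ℝ} (hA : MemLp A 4 P) (hB : MemLp B 4 P)
    (hAB : IndepFun A B P) (hA0 : ∫ ω, A ω ∂P = 0) (hB0 : ∫ ω, B ω ∂P = 0) :
    ∫ ω, (A ω + B ω) ^ 2 ∂P = ∫ ω, A ω ^ 2 ∂P + ∫ ω, B ω ^ 2 ∂P ∧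
    ∫ ω, (A ω + B ω) ^ 3 ∂P = ∫ ω, A ω ^ 3 ∂P + ∫ ω, B ω ^ 3 ∂P ∧
    ∫ ω, (A ω + B ω) ^ 4 ∂P = ∫ ω, A ω ^ 4 ∂P + ∫ ω, B ω ^ 4 ∂P
      + 6 * (∫ ω, A ω ^ 2 ∂P) * ∫ ω, B ω ^ 2 ∂P := by
  have hp : ∀ {C : Ω → ℝ}, MemLp C 4 P → ∀ k : ℕ, k ≤ 4 → Integrable (fun ω => C ω ^ k) P := by
    intro C hC k hk
    have : MemLp C k P := hC.mono_exponent (by exact_mod_cast hk)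
    have h2 := this.integrable_norm_pow'
    refine h2.mono (hC.1.pow k) (ae_of_all _ fun ω => by simp)
  have hind : ∀ i j : ℕ, IndepFun (fun ω => A ω ^ i) (fun ω => B ω ^ j) P := fun i j =>
    hAB.comp (φ := fun x => x ^ i) (ψ := fun x => x ^ j) (by fun_prop) (by fun_prop)
  have hmul : ∀ i j : ℕ, i ≤ 4 → j ≤ 4 → Integrable (fun ω => A ω ^ i * B ω ^ j) P ∧
      ∫ ω, A ω ^ i * B ω ^ j ∂P = (∫ ω, A ω ^ i ∂P) * ∫ ω, B ω ^ j ∂P := fun i j hi hj =>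
    ⟨(hind i j).integrable_mul (hp hA i hi) (hp hB j hj),
      (hind i j).integral_mul_eq_mul_integral (hp hA i hi).1 (hp hB j hj).1⟩
  have h1A : ∫ ω, A ω ^ 1 ∂P = 0 := by simpa using hA0
  have h1B : ∫ ω, B ω ^ 1 ∂P = 0 := by simpa using hB0
  refine ⟨?_, ?_, ?_⟩
  -- The exponents `1` are kept so that `hmul` covers every mixed term.
  · calc _ = ∫ ω, (A ω ^ 2 + B ω ^ 2 + 2 * (A ω ^ 1 * B ω ^ 1)) ∂P := by
          congr with ω; ring
      _ = _ := by
          rw [integral_add ((hp hA 2 (by norm_num)).fun_add (hp hB 2 (by norm_num)))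
            ((hmul 1 1 (by norm_num) (by norm_num)).1.const_mul _),
            integral_add (hp hA 2 (by norm_num)) (hp hB 2 (by norm_num)), integral_const_mul,
            (hmul 1 1 (by norm_num) (by norm_num)).2, h1A]
          ring
  · calc _ = ∫ ω, (A ω ^ 3 + B ω ^ 3 + (3 * (A ω ^ 2 * B ω ^ 1) + 3 * (A ω ^ 1 * B ω ^ 2))) ∂P := by
          congr with ω; ring
      _ = _ := by
          rw [integral_add ((hp hA 3 (by norm_num)).fun_add (hp hB 3 (by norm_num)))
            (((hmul 2 1 (by norm_num) (by norm_num)).1.const_mul _).fun_add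
              ((hmul 1 2 (by norm_num) (by norm_num)).1.const_mul _)),
            integral_add (hp hA 3 (by norm_num)) (hp hB 3 (by norm_num)),
            integral_add ((hmul 2 1 (by norm_num) (by norm_num)).1.const_mul _)
              ((hmul 1 2 (by norm_num) (by norm_num)).1.const_mul _),
            integral_const_mul, integral_const_mul,
            (hmul 1 2 (by norm_num) (by norm_num)).2, (hmul 2 1 (by norm_num) (by norm_num)).2,
            h1A, h1B]
          ring
  · calc _ = ∫ ω, (A ω ^ 4 + B ω ^ 4 + ((4 * (A ω ^ 3 * B ω ^ 1) + 4 * (A ω ^ 1 * B ω ^ 3))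
              + 6 * (A ω ^ 2 * B ω ^ 2))) ∂P := by
          congr with ω; ring
      _ = _ := by
          rw [integral_add ((hp hA 4 (by norm_num)).fun_add (hp hB 4 (by norm_num)))
            ((((hmul 3 1 (by norm_num) (by norm_num)).1.const_mul _).fun_add
              ((hmul 1 3 (by norm_num) (by norm_num)).1.const_mul _)).fun_add
              ((hmul 2 2 (by norm_num) (by norm_num)).1.const_mul _)),
            integral_add (hp hA 4 (by norm_num)) (hp hB 4 (by norm_num)),
            integral_add (((hmul 3 1 (by norm_num) (by norm_num)).1.const_mul _).fun_add
              ((hmul 1 3 (by norm_num) (by norm_num)).1.const_mul _))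
              ((hmul 2 2 (by norm_num) (by norm_num)).1.const_mul _),
            integral_add ((hmul 3 1 (by norm_num) (by norm_num)).1.const_mul _)
              ((hmul 1 3 (by norm_num) (by norm_num)).1.const_mul _),
            integral_const_mul, integral_const_mul, integral_const_mul,
            (hmul 1 3 (by norm_num) (by norm_num)).2, (hmul 3 1 (by norm_num) (by norm_num)).2,
            (hmul 2 2 (by norm_num) (by norm_num)).2, h1A, h1B]
          ring

variable {ι Ω : Type*} [MeasurableSpace Ω] {P : Measure Ω}

lemma memLp_sq_of_hasLaw_gaussianReal {g : Ω → ℝ} (hg : HasLaw g (gaussianReal 0 1) P) :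
    MemLp (fun ω => g ω ^ 2) 4 P := by
  have h : MemLp (fun x : ℝ => x ^ 2) 4 (gaussianReal 0 1) := by
    have h8 := memLp_id_gaussianReal' (μ := 0) (v := 1) 8 (by norm_num)
    have := h8.norm_rpow_div 2
    have he : (8 : ENNReal) / 2 = 4 := by
      rw [show (8 : ENNReal) = 4 * 2 by norm_num]
      exact ENNReal.mul_div_cancel_right (by norm_num) (by norm_num)
    rw [he] at this
    refine this.congr_norm (by fun_prop) (ae_of_all _ fun x => by simp)
  rw [← hg.map_eq] at h
  exact h.comp_of_map hg.aemeasurable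

/-- Binomial expansion with the even Gaussian moments 1, 3, 15, 105. The excess of 60 over `3 · 2²`
is the 48 of the fourth moment formula. -/
lemma integral_chiSq_centered {g : Ω → ℝ} (hg : HasLaw g (gaussianReal 0 1) P) :
    ∫ ω, (g ω ^ 2 - 1) ∂P = 0 ∧ ∫ ω, (g ω ^ 2 - 1) ^ 2 ∂P = 2 ∧
    ∫ ω, (g ω ^ 2 - 1) ^ 3 ∂P = 8 ∧ ∫ ω, (g ω ^ 2 - 1) ^ 4 ∂P = 60 := by
  have hi : ∀ n : ℕ, Integrable (fun x : ℝ => x ^ n) (gaussianReal 0 1) := fun n => by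
    have := (memLp_id_gaussianReal' (μ := 0) (v := 1) n (by simp)).integrable_norm_pow'
    exact this.mono (by fun_prop) (ae_of_all _ fun x => by simp)
  have e2 : ∫ x, x ^ 2 ∂(gaussianReal 0 1) = 1 := by
    simpa [Nat.doubleFactorial] using integral_pow_gaussianReal 1
  have e4 : ∫ x, x ^ 4 ∂(gaussianReal 0 1) = 3 := by
    simpa [Nat.doubleFactorial] using integral_pow_gaussianReal 2
  have e6 : ∫ x, x ^ 6 ∂(gaussianReal 0 1) = 15 := by
    have h := integral_pow_gaussianReal 3
    rw [show Nat.doubleFactorial (2 * 3 - 1) = 15 from rfl] at h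
    exact_mod_cast h
  have e8 : ∫ x, x ^ 8 ∂(gaussianReal 0 1) = 105 := by
    have h := integral_pow_gaussianReal 4
    rw [show Nat.doubleFactorial (2 * 4 - 1) = 105 from rfl] at h
    exact_mod_cast h
  have hc : ∀ f : ℝ → ℝ, Continuous f → ∫ ω, f (g ω) ∂P = ∫ x, f x ∂(gaussianReal 0 1) :=
    fun f hf => by
      rw [← hg.map_eq, integral_map hg.aemeasurable hf.aestronglyMeasurable]
  refine ⟨?_, ?_, ?_, ?_⟩
  · rw [hc (fun x => x ^ 2 - 1) (by fun_prop), integral_sub (hi 2) (by simp), e2]; simp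
  · rw [hc (fun x => (x ^ 2 - 1) ^ 2) (by fun_prop)]
    calc _ = ∫ x, (x ^ 4 + (-2) * x ^ 2 + 1) ∂(gaussianReal 0 1) := by congr with x; ring
      _ = _ := by
        rw [integral_add ((hi 4).fun_add ((hi 2).const_mul _)) (by simp),
          integral_add (hi 4) ((hi 2).const_mul _), integral_const_mul, e2, e4]
        simp; norm_num
  · rw [hc (fun x => (x ^ 2 - 1) ^ 3) (by fun_prop)]
    calc _ = ∫ x, (x ^ 6 + (-3) * x ^ 4 + 3 * x ^ 2 + (-1)) ∂(gaussianReal 0 1) := by congr with x; ring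
      _ = _ := by
        rw [integral_add (((hi 6).fun_add ((hi 4).const_mul _)).fun_add ((hi 2).const_mul _)) (by simp),
          integral_add ((hi 6).fun_add ((hi 4).const_mul _)) ((hi 2).const_mul _),
          integral_add (hi 6) ((hi 4).const_mul _), integral_const_mul, integral_const_mul,
          e2, e4, e6]
        simp; norm_num
  · rw [hc (fun x => (x ^ 2 - 1) ^ 4) (by fun_prop)]
    calc _ = ∫ x, (x ^ 8 + (-4) * x ^ 6 + 6 * x ^ 4 + (-4) * x ^ 2 + 1) ∂(gaussianReal 0 1) := by
          congr with x; ring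
      _ = _ := by
        rw [integral_add ((((hi 8).fun_add ((hi 6).const_mul _)).fun_add ((hi 4).const_mul _)).fun_add
            ((hi 2).const_mul _)) (by simp),
          integral_add (((hi 8).fun_add ((hi 6).const_mul _)).fun_add ((hi 4).const_mul _))
            ((hi 2).const_mul _),
          integral_add ((hi 8).fun_add ((hi 6).const_mul _)) ((hi 4).const_mul _),
          integral_add (hi 8) ((hi 6).const_mul _), integral_const_mul, integral_const_mul,
          integral_const_mul, e2, e4, e6, e8]
        simp; norm_num

variable [IsProbabilityMeasure P]

lemma memLp_finset_sum_chiSq {g : ι → Ω → ℝ} (hg : ∀ i, HasLaw (g i) (gaussianReal 0 1) P)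
    (c : ι → ℝ) (s : Finset ι) : MemLp (fun ω => ∑ i ∈ s, c i * (g i ω ^ 2 - 1)) 4 P :=
  memLp_finsetSum s fun i _ =>
    ((memLp_sq_of_hasLaw_gaussianReal (hg i)).sub (memLp_const 1)).const_mul (c i)

/-- Centered moments of a finite weighted sum of independent `χ²` variables. -/
lemma integral_finset_sum_chiSq_pow {g : ι → Ω → ℝ} (hind : iIndepFun g P)
    (hg : ∀ i, HasLaw (g i) (gaussianReal 0 1) P) (c : ι → ℝ) (s : Finset ι) :
    ∫ ω, (∑ i ∈ s, c i * (g i ω ^ 2 - 1)) ∂P = 0 ∧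
    ∫ ω, (∑ i ∈ s, c i * (g i ω ^ 2 - 1)) ^ 2 ∂P = 2 * ∑ i ∈ s, c i ^ 2 ∧
    ∫ ω, (∑ i ∈ s, c i * (g i ω ^ 2 - 1)) ^ 3 ∂P = 8 * ∑ i ∈ s, c i ^ 3 ∧
    ∫ ω, (∑ i ∈ s, c i * (g i ω ^ 2 - 1)) ^ 4 ∂P
      = 48 * ∑ i ∈ s, c i ^ 4 + 12 * (∑ i ∈ s, c i ^ 2) ^ 2 := by
  classical
  have hm : ∀ i, MemLp (fun ω => c i * (g i ω ^ 2 - 1)) 4 P := fun i =>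
    ((memLp_sq_of_hasLaw_gaussianReal (hg i)).sub (memLp_const 1)).const_mul (c i)
  have hind' : iIndepFun (fun i ω => c i * (g i ω ^ 2 - 1)) P :=
    hind.comp (fun i x => c i * (x ^ 2 - 1)) (fun i => by fun_prop)
  induction s using Finset.induction_on with
  | empty => simp
  | insert a s ha ih =>
    obtain ⟨i1, i2, i3, i4⟩ := ih
    obtain ⟨m1, m2, m3, m4⟩ := integral_chiSq_centered (hg a)
    have hI : IndepFun (fun ω => ∑ i ∈ s, c i * (g i ω ^ 2 - 1))
        (fun ω => c a * (g a ω ^ 2 - 1)) P := by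
      have := hind'.indepFun_finsetSum_of_notMem₀ (fun i => (hm i).1.aemeasurable) ha
      convert this using 1
      ext ω; simp
    have hz : ∫ ω, c a * (g a ω ^ 2 - 1) ∂P = 0 := by rw [integral_const_mul, m1, mul_zero]
    obtain ⟨r2, r3, r4⟩ := integral_add_sq_of_indepFun (memLp_finset_sum_chiSq hg c s) (hm a) hI
      i1 hz
    have hk : ∀ k : ℕ, ∫ ω, (c a * (g a ω ^ 2 - 1)) ^ k ∂P
        = c a ^ k * ∫ ω, (g a ω ^ 2 - 1) ^ k ∂P := fun k => by
      simp_rw [mul_pow]; rw [integral_const_mul]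
    simp only [Finset.sum_insert ha]
    simp only [add_comm (c a * _)]
    refine ⟨?_, ?_, ?_, ?_⟩
    · rw [integral_add ((memLp_finset_sum_chiSq hg c s).integrable (by norm_num))
        ((hm a).integrable (by norm_num)), i1, hz, add_zero]
    · rw [r2, i2, hk, m2]; ring
    · rw [r3, i3, hk, m3]; ring
    -- The term `60 c⁴` splits as `48 c⁴ + 12 (c²)²`; the cross term `6 · 2 · 2` is the 24 of the
    -- expanded square.
    · rw [r4, i4, i2, hk, hk, m2, m4]; ring

/-- The terms are nonnegative with total mean `∑ c i < ∞`, so by Tonelli the sum is almost surely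
finite. Independence plays no role. -/
lemma ae_summable_chiSq [Countable ι] {g : ι → Ω → ℝ}
    (hg : ∀ i, HasLaw (g i) (gaussianReal 0 1) P) {c : ι → ℝ} (hc : ∀ i, 0 ≤ c i)
    (hs : Summable c) : ∀ᵐ ω ∂P, Summable fun i => c i * g i ω ^ 2 := by
  have hint : ∀ i, Integrable (fun ω => c i * g i ω ^ 2) P := fun i =>
    ((memLp_sq_of_hasLaw_gaussianReal (hg i)).integrable (by norm_num)).const_mul _
  have hval : ∀ i, ∫ ω, c i * g i ω ^ 2 ∂P = c i := fun i => by
    have := (integral_chiSq_centered (hg i)).1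
    rw [integral_sub ((memLp_sq_of_hasLaw_gaussianReal (hg i)).integrable (by norm_num))
      (by simp)] at this
    rw [integral_const_mul]
    have h1 : ∫ ω, g i ω ^ 2 ∂P = 1 := by simpa [sub_eq_zero] using this
    rw [h1, mul_one]
  have hnn : ∀ i ω, 0 ≤ c i * g i ω ^ 2 := fun i ω => mul_nonneg (hc i) (sq_nonneg _)
  have h1 : ∫⁻ ω, ∑' i, ENNReal.ofReal (c i * g i ω ^ 2) ∂P ≠ ⊤ := by
    rw [lintegral_tsum fun i => (hint i).1.aemeasurable.ennreal_ofReal]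
    have : ∀ i, ∫⁻ ω, ENNReal.ofReal (c i * g i ω ^ 2) ∂P = ENNReal.ofReal (c i) := fun i => by
      rw [← ofReal_integral_eq_lintegral_ofReal (hint i) (ae_of_all _ (hnn i)), hval]
    simp_rw [this]
    rw [← ENNReal.ofReal_tsum_of_nonneg hc hs]
    exact ENNReal.ofReal_ne_top
  have h2 := ae_lt_top' (AEMeasurable.tsum fun i => (hint i).1.aemeasurable.ennreal_ofReal)
    h1
  filter_upwards [h2] with ω hω
  have := ENNReal.summable_toReal hω.ne
  exact this.congr fun i => by rw [ENNReal.toReal_ofReal (hnn i ω)]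

/-- By Minkowski every partial sum has `L⁴` norm at most `K ∑ c i`, where `K` is the `L⁴` norm of a
squared standard Gaussian; Fatou carries this to the limit. -/
lemma memLp_tsum_chiSq [Countable ι] {g : ι → Ω → ℝ}
    (hg : ∀ i, HasLaw (g i) (gaussianReal 0 1) P) {c : ι → ℝ} (hc : ∀ i, 0 ≤ c i)
    (hs : Summable c) : MemLp (fun ω => ∑' i, c i * g i ω ^ 2) 4 P := by
  obtain ⟨s, hsl⟩ := exists_seq_tendsto (atTop : Filter (Finset ι))
  have hm : ∀ i, MemLp (fun ω => c i * g i ω ^ 2) 4 P := fun i =>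
    (memLp_sq_of_hasLaw_gaussianReal (hg i)).const_mul _
  have hlim : ∀ᵐ ω ∂P, Tendsto (fun n => ∑ i ∈ s n, c i * g i ω ^ 2) atTop
      (𝓝 (∑' i, c i * g i ω ^ 2)) := by
    filter_upwards [ae_summable_chiSq hg hc hs] with ω hω
    exact hω.hasSum.comp hsl
  have hmeas : ∀ n, AEStronglyMeasurable (fun ω => ∑ i ∈ s n, c i * g i ω ^ 2) P := fun n =>
    (memLp_finsetSum (s n) fun i _ => hm i).1
  have hmeas' := aestronglyMeasurable_of_tendsto_ae atTop hmeas hlim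
  refine ⟨hmeas', ?_⟩
  set K := eLpNorm (fun x : ℝ => x ^ 2) 4 (gaussianReal 0 1) with hK
  have hKi : ∀ i, eLpNorm (fun ω => g i ω ^ 2) 4 P = K := fun i => by
    rw [hK, ← (hg i).map_eq, eLpNorm_map_measure (by fun_prop) (hg i).aemeasurable]; rfl
  have hKt : ∀ i : ι, K < ⊤ := fun i => hKi i ▸ (memLp_sq_of_hasLaw_gaussianReal (hg i)).2
  have hb : ∀ n, eLpNorm (fun ω => ∑ i ∈ s n, c i * g i ω ^ 2) 4 P
      ≤ ENNReal.ofReal (∑' i, c i) * K := fun n => by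
    calc _ = eLpNorm (∑ i ∈ s n, fun ω => c i * g i ω ^ 2) 4 P := by
          congr 1; ext ω; simp
      _ ≤ ∑ i ∈ s n, eLpNorm (fun ω => c i * g i ω ^ 2) 4 P :=
          eLpNorm_sum_le (fun i _ => (hm i).1) (by norm_num)
      _ = ∑ i ∈ s n, ENNReal.ofReal (c i) * K := by
          refine Finset.sum_congr rfl fun i _ => ?_
          rw [← hKi i]
          have := eLpNorm_const_smul (c i) (fun ω => g i ω ^ 2) 4 P
          rw [Real.enorm_eq_ofReal (hc i)] at this
          exact this
      _ = ENNReal.ofReal (∑ i ∈ s n, c i) * K := by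
          rw [← Finset.sum_mul, ENNReal.ofReal_sum_of_nonneg fun i _ => hc i]
      _ ≤ _ := by
          gcongr
          exact hs.sum_le_tsum _ fun i _ => hc i
  -- Finiteness of `K` was read off from some `g i`, so an index is needed.
  rcases isEmpty_or_nonempty ι with h | ⟨⟨i⟩⟩
  · simp
  calc _ ≤ liminf (fun n => eLpNorm (fun ω => ∑ i ∈ s n, c i * g i ω ^ 2) 4 P) atTop :=
        Lp.eLpNorm_lim_le_liminf_eLpNorm hmeas _ hlim
    _ ≤ liminf (fun _ : ℕ => ENNReal.ofReal (∑' i, c i) * K) atTop :=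
        liminf_le_liminf (Eventually.of_forall hb)
    _ = ENNReal.ofReal (∑' i, c i) * K := by simp
    _ < ⊤ := ENNReal.mul_lt_top ENNReal.ofReal_lt_top (hKt i)

/-- Moments of a weighted series of independent `χ²` variables. -/
lemma hasSum_moments_tsum_chiSq [Countable ι] {g : ι → Ω → ℝ} (hind : iIndepFun g P)
    (hg : ∀ i, HasLaw (g i) (gaussianReal 0 1) P) {c : ι → ℝ} (hc : ∀ i, 0 ≤ c i)
    (hs : Summable c) {Q : Ω → ℝ} (hQ : Q = fun ω => ∑' i, c i * g i ω ^ 2) :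
    HasSum c (∫ ω, Q ω ∂P) ∧
    HasSum (fun i => 2 * c i ^ 2) (∫ ω, (Q ω - ∫ ω', Q ω' ∂P) ^ 2 ∂P) ∧
    HasSum (fun i => 8 * c i ^ 3) (∫ ω, (Q ω - ∫ ω', Q ω' ∂P) ^ 3 ∂P) ∧
    HasSum (fun i => 48 * c i ^ 4) (∫ ω, (Q ω - ∫ ω', Q ω' ∂P) ^ 4 ∂P
      - 3 * (∫ ω, (Q ω - ∫ ω', Q ω' ∂P) ^ 2 ∂P) ^ 2) := by
  have hL := memLp_tsum_chiSq hg hc hs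
  rw [← hQ] at hL
  set q := ∑' i, c i with hq
  have hq0 : 0 ≤ q := tsum_nonneg hc
  have hconv : ∀ k : ℕ, k ≤ 4 →
      Tendsto (fun s : Finset ι => ∫ ω, (∑ i ∈ s, c i * (g i ω ^ 2 - 1)) ^ k ∂P) atTop
        (𝓝 (∫ ω, (Q ω - q) ^ k ∂P)) := by
    intro k hk
    -- A centered partial sum is a difference of two partial sums lying in `[0, Q]` and `[0, q]`,
    -- hence is at most `Q + q` in absolute value.
    refine tendsto_integral_filter_of_dominated_convergence (fun ω => (Q ω + q) ^ k) ?_ ?_ ?_ ?_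
    · exact Eventually.of_forall fun s => (memLp_finset_sum_chiSq hg c s).1.pow k
    · refine Eventually.of_forall fun s => ?_
      filter_upwards [ae_summable_chiSq hg hc hs] with ω hω
      rw [norm_pow]
      gcongr
      have h1 : ∑ i ∈ s, c i * (g i ω ^ 2 - 1) = ∑ i ∈ s, c i * g i ω ^ 2 - ∑ i ∈ s, c i := by
        rw [← Finset.sum_sub_distrib]; congr with i; ring
      have h2 : ∑ i ∈ s, c i * g i ω ^ 2 ≤ Q ω := by
        rw [hQ]; exact hω.sum_le_tsum _ fun i _ => mul_nonneg (hc i) (sq_nonneg _)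
      have h3 : ∑ i ∈ s, c i ≤ q := hs.sum_le_tsum _ fun i _ => hc i
      have h4 : 0 ≤ ∑ i ∈ s, c i * g i ω ^ 2 :=
        Finset.sum_nonneg fun i _ => mul_nonneg (hc i) (sq_nonneg _)
      have h5 : 0 ≤ ∑ i ∈ s, c i := Finset.sum_nonneg fun i _ => hc i
      rw [Real.norm_eq_abs, h1, abs_le]
      constructor <;> linarith
    · have h4 : MemLp (fun ω => Q ω + q) 4 P := hL.add (memLp_const q)
      have h5 : MemLp (fun ω => Q ω + q) k P := h4.mono_exponent (by exact_mod_cast hk)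
      exact h5.integrable_norm_pow'.mono (h4.1.pow k) (ae_of_all _ fun ω => by simp)
    · filter_upwards [ae_summable_chiSq hg hc hs] with ω hω
      refine Tendsto.pow ?_ k
      have := (hω.hasSum.sub hs.hasSum)
      rw [hQ]
      refine Tendsto.congr (fun s => ?_) this
      refine Finset.sum_congr rfl fun i _ => ?_
      ring
  have hmom := integral_finset_sum_chiSq_pow hind hg c
  have h1 := hconv 1 (by norm_num)
  simp only [pow_one, (hmom _).1] at h1
  have h1' : ∫ ω, Q ω ∂P = q := by
    have := tendsto_nhds_unique h1 tendsto_const_nhds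
    rw [integral_sub (hL.integrable (by norm_num)) (by simp)] at this
    simpa [sub_eq_zero] using this
  rw [h1']
  have h2 := hconv 2 (by norm_num)
  have h3 := hconv 3 (by norm_num)
  have h4 := hconv 4 (by norm_num)
  simp only [(hmom _).2.1] at h2
  simp only [(hmom _).2.2.1] at h3
  simp only [(hmom _).2.2.2] at h4
  refine ⟨hs.hasSum, ?_, ?_, ?_⟩
  · simpa [HasSum, Finset.mul_sum] using h2
  · simpa [HasSum, Finset.mul_sum] using h3
  -- Three times the squared variance is `12 (∑ c²)²`; what remains is additive in the index and is
  -- a genuine series.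
  · have := h4.sub ((h2.pow 2).const_mul 3)
    refine Tendsto.congr (fun s => ?_) this
    rw [← Finset.mul_sum]
    ring

end ChiSquareSeries

/-! ### Central limit theorem for squared norms in a Hilbert space. -/

section HilbertCLT

lemma tendsto_integral_of_tendstoInDistribution {Ω Ω' E : Type*} [MeasurableSpace Ω]
    [MeasurableSpace Ω'] {P : Measure Ω} {P' : Measure Ω'} [IsProbabilityMeasure P]
    [IsProbabilityMeasure P'] [TopologicalSpace E] [MeasurableSpace E] [OpensMeasurableSpace E]
    {X : ℕ → Ω → E} {Z : Ω' → E}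
    (h : TendstoInDistribution X atTop Z (fun _ => P) P') (f : E →ᵇ ℝ) :
    Tendsto (fun N => ∫ ω, f (X N ω) ∂P) atTop (𝓝 (∫ ω, f (Z ω) ∂P')) := by
  have h1 := ProbabilityMeasure.tendsto_iff_forall_integral_tendsto.1 h.tendsto f
  simp only [ProbabilityMeasure.coe_mk] at h1
  rw [integral_map h.aemeasurable_limit (by fun_prop)] at h1
  refine h1.congr fun N => ?_
  rw [integral_map (h.forall_aemeasurable N) (by fun_prop)]

lemma tendstoInDistribution_of_lipschitz {Ω Ω' : Type*} [MeasurableSpace Ω]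
    [MeasurableSpace Ω'] {P : Measure Ω} {P' : Measure Ω'} [IsProbabilityMeasure P]
    [IsProbabilityMeasure P'] {X : ℕ → Ω → ℝ} {Z : Ω' → ℝ} (hX : ∀ N, AEMeasurable (X N) P)
    (hZ : AEMeasurable Z P')
    (h : ∀ (f : ℝ →ᵇ ℝ) (L : NNReal), LipschitzWith L f →
      Tendsto (fun N => ∫ ω, f (X N ω) ∂P) atTop (𝓝 (∫ ω, f (Z ω) ∂P'))) :
    TendstoInDistribution X atTop Z (fun _ => P) P' where
  forall_aemeasurable := hX
  aemeasurable_limit := hZ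
  tendsto := by
    refine tendsto_iff_forall_lipschitz_integral_tendsto.2 ?_
    rintro f ⟨C, hC⟩ ⟨L, hL⟩
    simp only [ProbabilityMeasure.coe_mk]
    rw [integral_map hZ hL.continuous.aestronglyMeasurable]
    refine (h ⟨⟨f, hL.continuous⟩, C, hC⟩ L hL).congr fun N => ?_
    rw [integral_map (hX N) hL.continuous.aestronglyMeasurable]
    rfl

lemma abs_integral_comp_sub_le_of_lipschitz {Ω : Type*} [MeasurableSpace Ω] {P : Measure Ω}
    [IsProbabilityMeasure P] (f : ℝ →ᵇ ℝ) {L : NNReal} (hL : LipschitzWith L f) {Y W : Ω → ℝ}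
    (hY : AEMeasurable Y P) (hW : AEMeasurable W P) (hYW : Integrable (fun ω => Y ω - W ω) P) :
    |∫ ω, f (Y ω) ∂P - ∫ ω, f (W ω) ∂P| ≤ L * ∫ ω, |Y ω - W ω| ∂P := by
  have hfi : ∀ {U : Ω → ℝ}, AEMeasurable U P → Integrable (fun ω => f (U ω)) P := fun {U} hU =>
    Integrable.of_bound (f.continuous.measurable.comp_aemeasurable hU).aestronglyMeasurable ‖f‖
      (ae_of_all _ fun ω => f.norm_coe_le_norm _)
  rw [← integral_sub (hfi hY) (hfi hW), ← integral_const_mul]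
  refine (abs_integral_le_integral_abs).trans (integral_mono ((hfi hY).sub (hfi hW)).abs
    (hYW.abs.const_mul _) fun ω => ?_)
  simpa [Real.dist_eq] using hL.dist_le_mul (Y ω) (W ω)

/-- Convergence in distribution follows from that of `L¹` approximations. -/
lemma tendstoInDistribution_of_approx {Ω Ω' κ : Type*} [MeasurableSpace Ω] [MeasurableSpace Ω']
    {P : Measure Ω} {P' : Measure Ω'} [IsProbabilityMeasure P] [IsProbabilityMeasure P']
    {Z : ℕ → Ω → ℝ} {Q : Ω' → ℝ} {R : κ → ℕ → Ω → ℝ} {R' : κ → Ω' → ℝ} {l : Filter κ} [l.NeBot]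
    {ε : κ → ℝ} (hε : Tendsto ε l (𝓝 0))
    (hR : ∀ s, TendstoInDistribution (R s) atTop (R' s) (fun _ => P) P')
    (hZ : ∀ N, AEMeasurable (Z N) P) (hQ : AEMeasurable Q P')
    (hZR : ∀ s N, Integrable (fun ω => Z N ω - R s N ω) P)
    (hZRε : ∀ s N, ∫ ω, |Z N ω - R s N ω| ∂P ≤ ε s)
    (hQR : ∀ s, Integrable (fun ω => Q ω - R' s ω) P')
    (hQRε : ∀ s, ∫ ω, |Q ω - R' s ω| ∂P' ≤ ε s) :
    TendstoInDistribution Z atTop Q (fun _ => P) P' := by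
  refine tendstoInDistribution_of_lipschitz hZ hQ fun f L hL => ?_
  rw [Metric.tendsto_atTop]
  intro δ hδ
  have hlim : Tendsto (fun s => (L : ℝ) * ε s) l (𝓝 0) := by simpa using hε.const_mul (L : ℝ)
  obtain ⟨s, hs⟩ := (hlim.eventually (gt_mem_nhds (show (0 : ℝ) < δ / 3 by positivity))).exists
  have hRs := tendsto_integral_of_tendstoInDistribution (hR s) f
  rw [Metric.tendsto_atTop] at hRs
  obtain ⟨N₀, hN₀⟩ := hRs (δ / 3) (by positivity)
  refine ⟨N₀, fun N hN => ?_⟩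
  have h1 := hN₀ N hN
  have h2 := abs_integral_comp_sub_le_of_lipschitz f hL (hZ N) ((hR s).forall_aemeasurable N)
    (hZR s N)
  have h3 := abs_integral_comp_sub_le_of_lipschitz f hL hQ (hR s).aemeasurable_limit (hQR s)
  have h4 : (L : ℝ) * ∫ ω, |Z N ω - R s N ω| ∂P ≤ L * ε s :=
    mul_le_mul_of_nonneg_left (hZRε s N) L.2
  have h5 : (L : ℝ) * ∫ ω, |Q ω - R' s ω| ∂P' ≤ L * ε s :=
    mul_le_mul_of_nonneg_left (hQRε s) L.2
  rw [Real.dist_eq] at h1 ⊢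
  rw [abs_lt] at h1 ⊢
  rw [abs_le] at h2 h3
  constructor <;> linarith

variable {ι Ω Ω' H : Type*} [MeasurableSpace Ω] [MeasurableSpace Ω']
  {P : Measure Ω} {P' : Measure Ω'} [NormedAddCommGroup H] [InnerProductSpace ℝ H]

lemma HilbertBasis.hasSum_inner_sq (b : HilbertBasis ι ℝ H) (x : H) :
    HasSum (fun i => inner ℝ x (b i) ^ 2) (‖x‖ ^ 2) := by
  have := b.hasSum_inner_mul_inner x x
  rw [real_inner_self_eq_norm_sq] at this
  refine this.congr_fun fun i => ?_
  rw [sq, real_inner_comm x (b i)]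

/-- Parseval under the integral, dominated by `‖W‖²`. The tail of this series is the truncation
error in the central limit theorem. -/
lemma HilbertBasis.hasSum_integral_inner_sq [Countable ι] (b : HilbertBasis ι ℝ H) {W : Ω → H}
    (hW : MemLp W 2 P) :
    HasSum (fun i => ∫ ω, inner ℝ (W ω) (b i) ^ 2 ∂P) (∫ ω, ‖W ω‖ ^ 2 ∂P) := by
  have hi : ∀ i, MemLp (fun ω => inner ℝ (W ω) (b i)) 2 P := fun i => hW.inner_const (b i)
  have hsq : Integrable (fun ω => ‖W ω‖ ^ 2) P := hW.integrable_norm_pow (by norm_num)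
  have : Tendsto (fun s : Finset ι => ∫ ω, ∑ i ∈ s, inner ℝ (W ω) (b i) ^ 2 ∂P) atTop
      (𝓝 (∫ ω, ‖W ω‖ ^ 2 ∂P)) := by
    refine tendsto_integral_filter_of_dominated_convergence (fun ω => ‖W ω‖ ^ 2) ?_ ?_ hsq ?_
    · exact Eventually.of_forall fun s => (integrable_finsetSum s fun i _ => (hi i).integrable_sq).1
    · refine Eventually.of_forall fun s => ae_of_all _ fun ω => ?_
      rw [Real.norm_of_nonneg (Finset.sum_nonneg fun i _ => sq_nonneg _)]
      exact sum_le_hasSum s (fun i _ => sq_nonneg _) (b.hasSum_inner_sq (W ω))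
    · exact ae_of_all _ fun ω => b.hasSum_inner_sq (W ω)
  refine Tendsto.congr (fun s => ?_) this
  exact integral_finsetSum s fun i _ => (hi i).integrable_sq

variable [IsProbabilityMeasure P] [IsProbabilityMeasure P'] [MeasurableSpace H] [BorelSpace H]

/-- Second moments of normalised sums of independent centered vectors in a fixed direction. -/
lemma integral_inner_normalized_sum_sq {V : ℕ → Ω → H} (hind : iIndepFun V P)
    (hident : ∀ l, IdentDistrib (V l) (V 0) P P) (hL2 : MemLp (V 0) 2 P)
    (hmean : ∀ h : H, ∫ ω, inner ℝ (V 0 ω) h ∂P = 0) (h : H) {N : ℕ} (hN : N ≠ 0) :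
    ∫ ω, inner ℝ ((√N)⁻¹ • ∑ l ∈ Finset.range N, V l ω) h ^ 2 ∂P
      = ∫ ω, inner ℝ (V 0 ω) h ^ 2 ∂P := by
  have hi : ∀ l, IdentDistrib (fun ω => inner ℝ (V l ω) h) (fun ω => inner ℝ (V 0 ω) h) P P :=
    fun l => (hident l).comp (u := fun x => inner ℝ x h) (by fun_prop)
  have hm : ∀ l, MemLp (fun ω => inner ℝ (V l ω) h) 2 P := fun l =>
    (hi l).symm.memLp_iff.1 (hL2.inner_const h)
  have hm0 : ∀ l, ∫ ω, inner ℝ (V l ω) h ∂P = 0 := fun l => (hi l).integral_eq.trans (hmean h)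
  have hindh : iIndepFun (fun l ω => inner ℝ (V l ω) h) P :=
    hind.comp (fun _ x => inner ℝ x h) fun _ => by fun_prop
  have hvar := IndepFun.variance_sum (s := Finset.range N) (fun l _ => hm l)
    (fun i _ j _ hij => hindh.indepFun hij)
  have hv0 : ∀ l, variance (fun ω => inner ℝ (V l ω) h) P = ∫ ω, inner ℝ (V 0 ω) h ^ 2 ∂P :=
    fun l => by
      rw [variance_of_integral_eq_zero (hm l).1.aemeasurable (hm0 l)]
      exact ((hi l).comp (u := fun x : ℝ => x ^ 2) (by fun_prop)).integral_eq
  simp_rw [hv0] at hvar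
  rw [Finset.sum_const, Finset.card_range, variance_of_integral_eq_zero
    (memLp_finsetSum' _ fun l _ => hm l).1.aemeasurable ?_] at hvar
  · simp only [Finset.sum_apply] at hvar
    simp_rw [real_inner_smul_left, sum_inner, mul_pow]
    rw [integral_const_mul, hvar, inv_pow, Real.sq_sqrt (by positivity), nsmul_eq_mul]
    field_simp
  · simp only [Finset.sum_apply]
    rw [integral_finsetSum _ fun l _ => (hm l).integrable (by norm_num)]
    simp [hm0]

/-- Finite-dimensional central limit theorem along an orthogonal system. -/
lemma tendstoInDistribution_sum_inner_sq {V : ℕ → Ω → H} (hind : iIndepFun V P)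
    (hident : ∀ l, IdentDistrib (V l) (V 0) P P) (hL2 : MemLp (V 0) 2 P)
    (hmean : ∀ h : H, ∫ ω, inner ℝ (V 0 ω) h ∂P = 0) {g : ι → Ω' → ℝ} (hg : iIndepFun g P')
    (hlaw : ∀ i, HasLaw (g i) (gaussianReal 0 1) P') {b : ι → H} {c : ι → ℝ} (hc : ∀ i, 0 ≤ c i)
    (hcov : ∀ i j, i ≠ j → ∫ ω, inner ℝ (V 0 ω) (b i) * inner ℝ (V 0 ω) (b j) ∂P = 0)
    (hcov' : ∀ i, ∫ ω, inner ℝ (V 0 ω) (b i) ^ 2 ∂P = c i) (s : Finset ι) :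
    TendstoInDistribution
      (fun (N : ℕ) ω => ∑ i ∈ s, inner ℝ ((√N)⁻¹ • ∑ l ∈ Finset.range N, V l ω) (b i) ^ 2) atTop
      (fun ω => ∑ i ∈ s, c i * g i ω ^ 2) (fun _ => P) P' := by
  classical
  have hVm : ∀ l, AEMeasurable (V l) P := fun l => (hident l).aemeasurable_fst
  have hWi : ∀ (N : ℕ) (h : H), AEMeasurable
      (fun ω => inner ℝ ((√N)⁻¹ • ∑ l ∈ Finset.range N, V l ω) h) P := fun N h => by
    simp_rw [real_inner_smul_left, sum_inner]
    exact (Finset.aemeasurable_fun_sum _ fun l _ =>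
      (by fun_prop : Measurable fun x : H => inner ℝ x h).comp_aemeasurable (hVm l)).const_mul _
  let W : ℕ → Ω → EuclideanSpace ℝ s := fun N ω =>
    WithLp.toLp 2 fun i : s => inner ℝ ((√N)⁻¹ • ∑ l ∈ Finset.range N, V l ω) (b i)
  let G : Ω' → EuclideanSpace ℝ s := fun ω => WithLp.toLp 2 fun i : s => √(c i) * g i ω
  have hWm : ∀ N, AEMeasurable (W N) P := fun N =>
    (WithLp.measurable_toLp 2 _).comp_aemeasurable (aemeasurable_pi_lambda _ fun i => hWi N _)
  have hGm : AEMeasurable G P' :=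
    (WithLp.measurable_toLp 2 _).comp_aemeasurable
      (aemeasurable_pi_lambda _ fun i => (hlaw i).aemeasurable.const_mul _)
  have hWG : TendstoInDistribution W atTop G (fun _ => P) P' := by
    refine ⟨hWm, hGm, ProbabilityMeasure.tendsto_iff_tendsto_charFun.2 fun t => ?_⟩
    simp only [ProbabilityMeasure.coe_mk]
    -- Cramér–Wold: the characteristic function of the coordinate vector at `t` is that of the
    -- scalar normalised sum in the direction `h` at 1.
    set h : H := ∑ i : s, t i • b i with hh
    have hi : ∀ l, IdentDistrib (fun ω => inner ℝ (V l ω) h) (fun ω => inner ℝ (V 0 ω) h) P P :=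
      fun l => (hident l).comp (u := fun x => inner ℝ x h) (by fun_prop)
    have hindh : iIndepFun (fun l ω => inner ℝ (V l ω) h) P :=
      hind.comp (fun _ x => inner ℝ x h) fun _ => by fun_prop
    have hvar : Var[fun ω => inner ℝ (V 0 ω) h; P] = ∑ i : s, c i * t i ^ 2 := by
      rw [variance_of_integral_eq_zero (hi 0).aemeasurable_fst (hmean h)]
      have hbi : ∀ i j : s, Integrable
          (fun ω => inner ℝ (V 0 ω) (b i) * inner ℝ (V 0 ω) (b j)) P := fun i j =>
        (hL2.inner_const (b i)).integrable_mul (hL2.inner_const (b j))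
      calc _ = ∫ ω, ∑ i : s, ∑ j : s, t i * t j *
            (inner ℝ (V 0 ω) (b i) * inner ℝ (V 0 ω) (b j)) ∂P := by
            congr with ω
            rw [hh, inner_sum, sq, Finset.sum_mul_sum]
            refine Finset.sum_congr rfl fun i _ => Finset.sum_congr rfl fun j _ => ?_
            rw [inner_smul_right, inner_smul_right]; ring
        _ = ∑ i : s, ∑ j : s, t i * t j *
            ∫ ω, inner ℝ (V 0 ω) (b i) * inner ℝ (V 0 ω) (b j) ∂P := by
            rw [integral_finsetSum _ fun i _ => integrable_finsetSum _ fun j _ =>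
              (hbi i j).const_mul _]
            refine Finset.sum_congr rfl fun i _ => ?_
            rw [integral_finsetSum _ fun j _ => (hbi i j).const_mul _]
            exact Finset.sum_congr rfl fun j _ => integral_const_mul _ _
        -- The coordinates along `b` are uncorrelated, so only the diagonal terms remain.
        _ = _ := by
            refine Finset.sum_congr rfl fun i _ => ?_
            rw [Finset.sum_eq_single i]
            · simp_rw [← sq, hcov' i]; ring
            · intro j _ hj
              rw [hcov i j (fun h => hj (Subtype.ext h.symm)), mul_zero]
            · simp
    have hv0 : 0 ≤ ∑ i : s, c i * t i ^ 2 :=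
      Finset.sum_nonneg fun i _ => mul_nonneg (hc i) (sq_nonneg _)
    have hclt := tendstoInDistribution_inv_sqrt_mul_sum_sub
      (X := fun l ω => inner ℝ (V l ω) h) (Y := id)
      (P' := gaussianReal 0 (Var[fun ω => inner ℝ (V 0 ω) h; P]).toNNReal)
      ⟨aemeasurable_id, Measure.map_id⟩ (hL2.inner_const h) hindh hi
    have hclt := ProbabilityMeasure.tendsto_iff_tendsto_charFun.1 hclt.tendsto 1
    simp only [ProbabilityMeasure.coe_mk, Measure.map_id, hmean h, mul_zero, sub_zero] at hclt
    have hlim : charFun (P'.map G) t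
        = charFun (gaussianReal 0 (Var[fun ω => inner ℝ (V 0 ω) h; P]).toNNReal) 1 := by
      have hgm : ∀ i : s, AEMeasurable (fun ω => (t i * √(c i)) * g i ω) P' := fun i =>
        (hlaw i).aemeasurable.const_mul _
      have e1 : charFun (P'.map G) t
          = charFun (P'.map fun ω => ∑ i : s, (t i * √(c i)) * g i ω) 1 := by
        rw [charFun_apply, charFun_apply, integral_map hGm (by fun_prop),
          integral_map (Finset.aemeasurable_fun_sum _ fun i _ => hgm i)
            (by fun_prop)]
        congr with ω
        congr 3
        simp only [G, PiLp.inner_apply]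
        simp
        exact Finset.sum_congr rfl fun i _ => by ring
      have hind' : iIndepFun (fun (i : s) ω => (t i * √(c i)) * g i ω) P' :=
        (hg.precomp (g := fun i : s => (i : ι)) Subtype.val_injective).comp
          (fun i x => (t i * √(c i)) * x) fun i => by fun_prop
      rw [e1, (hind'.restrict _).charFun_map_fun_finsetSum_eq_prod
        (fun i _ => hgm i), Finset.prod_apply]
      have e2 : ∀ i : s, charFun (P'.map fun ω => (t i * √(c i)) * g i ω) 1
          = Complex.exp (-((c i * t i ^ 2 : ℝ) : ℂ) / 2) := fun i => by
        rw [charFun_map_mul_comp (hf := (hlaw i).aemeasurable), (hlaw i).map_eq, charFun_gaussianReal]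
        congr 1
        have : ((√(c i) : ℝ) : ℂ) ^ 2 = (c i : ℂ) := by
          rw [← Complex.ofReal_pow, Real.sq_sqrt (hc i)]
        push_cast
        rw [← this]
        simp
        ring
      rw [Finset.prod_congr rfl fun i _ => e2 i, ← Complex.exp_sum, charFun_gaussianReal, hvar]
      congr 1
      rw [Real.coe_toNNReal _ hv0, ← Finset.sum_div, Finset.sum_neg_distrib]
      push_cast
      ring
    rw [hlim]
    refine hclt.congr fun N => ?_
    have hm1 : AEMeasurable (fun ω => (√N)⁻¹ * ∑ k ∈ Finset.range N, inner ℝ (V k ω) h) P := by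
      have := hWi N h
      simp_rw [real_inner_smul_left, sum_inner] at this
      exact this
    rw [charFun_apply, charFun_apply, integral_map (hWm N) (by fun_prop),
      integral_map hm1 (by fun_prop)]
    congr with ω
    congr 3
    rw [← sum_inner, ← real_inner_smul_left, hh, inner_sum]
    simp only [W, PiLp.inner_apply, inner_smul_right]
    simp
  have hcomp := hWG.continuous_comp (g := fun x : EuclideanSpace ℝ s => ∑ i : s, x i ^ 2)
    (by fun_prop)
  refine hcomp.congr (fun N => ae_of_all _ fun ω => ?_) (ae_of_all _ fun ω => ?_)
  · simp only [Function.comp, W]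
    exact Finset.sum_coe_sort s fun i =>
      inner ℝ ((√N)⁻¹ • ∑ l ∈ Finset.range N, V l ω) (b i) ^ 2
  · simp only [Function.comp, G, mul_pow, Real.sq_sqrt (hc _)]
    exact Finset.sum_coe_sort s fun i => c i * g i ω ^ 2

/-- The central limit theorem in a Hilbert space, for the squared norm. -/
theorem tendstoInDistribution_norm_sq_normalized_sum [Countable ι] [SecondCountableTopology H]
    {V : ℕ → Ω → H}
    (hind : iIndepFun V P) (hident : ∀ l, IdentDistrib (V l) (V 0) P P) (hL2 : MemLp (V 0) 2 P)
    (hmean : ∀ h : H, ∫ ω, inner ℝ (V 0 ω) h ∂P = 0) {g : ι → Ω' → ℝ} (hg : iIndepFun g P')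
    (hlaw : ∀ i, HasLaw (g i) (gaussianReal 0 1) P') (b : HilbertBasis ι ℝ H) {c : ι → ℝ}
    (hcov : ∀ i j, i ≠ j → ∫ ω, inner ℝ (V 0 ω) (b i) * inner ℝ (V 0 ω) (b j) ∂P = 0)
    (hcov' : ∀ i, ∫ ω, inner ℝ (V 0 ω) (b i) ^ 2 ∂P = c i) :
    TendstoInDistribution
      (fun (N : ℕ) ω => ‖(√N)⁻¹ • ∑ l ∈ Finset.range N, V l ω‖ ^ 2) atTop
      (fun ω => ∑' i, c i * g i ω ^ 2) (fun _ => P) P' := by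
  have hc : ∀ i, 0 ≤ c i := fun i => hcov' i ▸ integral_nonneg fun ω => sq_nonneg _
  have hsum : HasSum c (∫ ω, ‖V 0 ω‖ ^ 2 ∂P) := by
    have := b.hasSum_integral_inner_sq hL2
    simpa only [hcov'] using this
  have hVL2 : ∀ l, MemLp (V l) 2 P := fun l => (hident l).symm.memLp_iff.1 hL2
  have hSL2 : ∀ N : ℕ, MemLp (fun ω => (√N)⁻¹ • ∑ l ∈ Finset.range N, V l ω) 2 P := fun N =>
    (memLp_finsetSum _ fun l _ => hVL2 l).const_smul _
  have hSsum : ∀ N : ℕ, N ≠ 0 →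
      HasSum c (∫ ω, ‖(√N)⁻¹ • ∑ l ∈ Finset.range N, V l ω‖ ^ 2 ∂P) := fun N hN => by
    have := b.hasSum_integral_inner_sq (hSL2 N)
    simpa only [integral_inner_normalized_sum_sq hind hident hL2 hmean _ hN, hcov'] using this
  have hSE : ∀ N : ℕ, N ≠ 0 → ∫ ω, ‖(√N)⁻¹ • ∑ l ∈ Finset.range N, V l ω‖ ^ 2 ∂P
      = ∫ ω, ‖V 0 ω‖ ^ 2 ∂P := fun N hN => (hSsum N hN).unique hsum
  have hSi : ∀ (N : ℕ) (s : Finset ι), Integrable (fun ω =>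
      ∑ i ∈ s, inner ℝ ((√N)⁻¹ • ∑ l ∈ Finset.range N, V l ω) (b i) ^ 2) P := fun N s =>
    integrable_finsetSum _ fun i _ => ((hSL2 N).inner_const (b i)).integrable_sq
  have hSn : ∀ N : ℕ, Integrable (fun ω => ‖(√N)⁻¹ • ∑ l ∈ Finset.range N, V l ω‖ ^ 2) P :=
    fun N => (hSL2 N).integrable_norm_pow (by norm_num)
  have hg2 : ∀ i, Integrable (fun ω => c i * g i ω ^ 2) P' := fun i =>
    ((memLp_sq_of_hasLaw_gaussianReal (hlaw i)).integrable (by norm_num)).const_mul _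
  have hQL := memLp_tsum_chiSq hlaw hc hsum.summable
  have hQi : Integrable (fun ω => ∑' i, c i * g i ω ^ 2) P' := hQL.integrable (by norm_num)
  have hQE := (hasSum_moments_tsum_chiSq hg hlaw hc hsum.summable rfl).1.unique hsum
  have hgE : ∀ i, ∫ ω, c i * g i ω ^ 2 ∂P' = c i := fun i => by
    have := (integral_chiSq_centered (hlaw i)).1
    rw [integral_sub ((memLp_sq_of_hasLaw_gaussianReal (hlaw i)).integrable (by norm_num))
      (by simp)] at this
    have h1 : ∫ ω, g i ω ^ 2 ∂P' = 1 := by simpa [sub_eq_zero] using this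
    rw [integral_const_mul, h1, mul_one]
  -- Truncating to the coordinates in `s` costs in `L¹` the tail `𝔼‖V 0‖² - ∑_{i ∈ s} c i`,
  -- uniformly in `N`, because normalisation preserves the second moments.
  refine tendstoInDistribution_of_approx (l := (atTop : Filter (Finset ι)))
    (ε := fun s => ∫ ω, ‖V 0 ω‖ ^ 2 ∂P - ∑ i ∈ s, c i) ?_
    (fun s => tendstoInDistribution_sum_inner_sq hind hident hL2 hmean hg hlaw hc hcov hcov' s)
    (fun N => (hSn N).1.aemeasurable) hQL.1.aemeasurable (fun s N => (hSn N).sub (hSi N s)) ?_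
    (fun s => hQi.sub (integrable_finsetSum _ fun i _ => hg2 i)) ?_
  · have := (tendsto_const_nhds (x := ∫ ω, ‖V 0 ω‖ ^ 2 ∂P)).sub hsum
    rwa [sub_self] at this
  · intro s N
    -- For `N = 0` the sum is empty and normalisation fails, but the error is 0 and the tail is
    -- nonnegative.
    rcases eq_or_ne N 0 with rfl | hN
    · simp only [Finset.range_zero, Finset.sum_empty, smul_zero, norm_zero, inner_zero_left]
      simpa using sum_le_hasSum s (fun i _ => hc i) hsum
    rw [integral_congr_ae (ae_of_all _ fun ω => abs_of_nonneg (sub_nonneg.2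
      (sum_le_hasSum s (fun i _ => sq_nonneg _) (b.hasSum_inner_sq _)))),
      integral_sub (hSn N) (hSi N s), hSE N hN,
      integral_finsetSum _ fun i _ => ((hSL2 N).inner_const (b i)).integrable_sq]
    simp only [integral_inner_normalized_sum_sq hind hident hL2 hmean _ hN, hcov', le_refl]
  · intro s
    have : ∀ᵐ ω ∂P', |∑' i, c i * g i ω ^ 2 - ∑ i ∈ s, c i * g i ω ^ 2|
        = ∑' i, c i * g i ω ^ 2 - ∑ i ∈ s, c i * g i ω ^ 2 := by
      filter_upwards [ae_summable_chiSq hlaw hc hsum.summable] with ω hω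
      exact abs_of_nonneg (sub_nonneg.2
        (hω.sum_le_tsum _ fun i _ => mul_nonneg (hc i) (sq_nonneg _)))
    rw [integral_congr_ae this, integral_sub hQi (integrable_finsetSum _ fun i _ => hg2 i),
      integral_finsetSum _ fun i _ => hg2 i, hQE]
    simp only [hgE, le_refl]

end HilbertCLT

/-! ### The covariance operator and its spectrum. -/

section CovarianceOperator

open InnerProductSpace

variable {Ω H : Type*} [MeasurableSpace Ω] {P : Measure Ω} [NormedAddCommGroup H]
  [InnerProductSpace ℝ H]

/-- The uncentered covariance operator `𝔼 (V ⊗ V)`. -/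
noncomputable def covOp (P : Measure Ω) (V : Ω → H) : H →L[ℝ] H :=
  ∫ ω, rankOne ℝ (V ω) (V ω) ∂P

lemma continuous_rankOne_self : Continuous fun x : H => rankOne ℝ x x := by
  have h : Continuous fun x : H => (rankOne ℝ x : H →L[ℝ] H →L[ℝ] H) :=
    (rankOne ℝ : H →L[ℝ] H →L[ℝ] H →L[ℝ] H).continuous
  exact h.clm_apply continuous_id

lemma integrable_rankOne_self {V : Ω → H} (hV : MemLp V 2 P) :
    Integrable (fun ω => rankOne ℝ (V ω) (V ω)) P := by
  have hsq : Integrable (fun ω => ‖V ω‖ ^ 2) P := hV.integrable_norm_pow (by norm_num)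
  refine hsq.mono (continuous_rankOne_self.comp_aestronglyMeasurable hV.1) (ae_of_all _ fun ω => ?_)
  rw [norm_rankOne, Real.norm_of_nonneg (sq_nonneg _), sq]

lemma isCompactOperator_rankOne (x y : H) : IsCompactOperator (rankOne ℝ x y : H →L[ℝ] H) := by
  have h1 : IsCompactOperator (id : ℝ → ℝ) :=
    (isCompactOperator_id_iff_finiteDimensional (𝕜 := ℝ)).2 inferInstance
  have h2 := (h1.comp_clm (innerSL ℝ y)).clm_comp (ContinuousLinearMap.toSpanSingleton ℝ x)
  refine (congrArg IsCompactOperator ?_).mp h2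
  ext z
  simp [rankOne_apply]

variable [CompleteSpace H]

lemma inner_covOp {V : Ω → H} (hV : MemLp V 2 P) (x y : H) :
    inner ℝ x (covOp P V y) = ∫ ω, inner ℝ x (V ω) * inner ℝ (V ω) y ∂P := by
  rw [covOp, ContinuousLinearMap.integral_apply (integrable_rankOne_self hV), ← integral_inner]
  · simp only [rankOne_apply, inner_smul_right, mul_comm]
  · exact (ContinuousLinearMap.apply ℝ H y).integrable_comp (integrable_rankOne_self hV)

lemma isSymmetric_covOp {V : Ω → H} (hV : MemLp V 2 P) :
    (covOp P V : H →ₗ[ℝ] H).IsSymmetric := fun x y => by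
  rw [ContinuousLinearMap.coe_coe, real_inner_comm, inner_covOp hV, inner_covOp hV]
  congr with ω
  rw [real_inner_comm (V ω) y, real_inner_comm x (V ω), mul_comm]

/-- Compact operators form a closed convex set, and the covariance operator is an average of rank
one operators. -/
lemma isCompactOperator_covOp [IsProbabilityMeasure P] {V : Ω → H} (hV : MemLp V 2 P) :
    IsCompactOperator (covOp P V) := by
  have hmem : covOp P V ∈ {f : H →L[ℝ] H | IsCompactOperator ⇑f} := by
    refine Convex.integral_mem ?_ isClosed_setOfPred_isCompactOperator
      (ae_of_all _ fun ω => isCompactOperator_rankOne _ _) (integrable_rankOne_self hV)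
    exact (compactOperator (RingHom.id ℝ) H H).convex
  exact hmem

/-- A compact symmetric operator on a separable Hilbert space is diagonalised by a countable
Hilbert basis. -/
lemma exists_hilbertBasis_eigenvectors.{u} {H : Type u} [NormedAddCommGroup H]
    [InnerProductSpace ℝ H] [CompleteSpace H] [SecondCountableTopology H] {T : H →L[ℝ] H}
    (hT : IsCompactOperator T) (hT' : (T : H →ₗ[ℝ] H).IsSymmetric) :
    ∃ (ι : Type u) (_ : Countable ι) (b : HilbertBasis ι ℝ H) (c : ι → ℝ),
      ∀ i, T (b i) = c i • b i := by
  have hclosed : ∀ μ : ℝ, IsClosed (Module.End.eigenspace (T : H →ₗ[ℝ] H) μ : Set H) := fun μ => by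
    have : (Module.End.eigenspace (T : H →ₗ[ℝ] H) μ : Set H) = {x | T x = μ • x} := by
      ext x; simp
    rw [this]
    exact isClosed_eq T.continuous (continuous_const_smul μ)
  have hcomplete : ∀ μ : ℝ, CompleteSpace (Module.End.eigenspace (T : H →ₗ[ℝ] H) μ) := fun μ =>
    (hclosed μ).completeSpace_coe
  -- Hilbert bases of all eigenspaces are assembled. The kernel, which may be infinite dimensional,
  -- is included as the eigenspace of 0.
  choose w e he using fun μ : ℝ =>
    exists_hilbertBasis ℝ (Module.End.eigenspace (T : H →ₗ[ℝ] H) μ)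
  have hon := hT'.orthogonalFamily_eigenspaces.orthonormal_sigma_orthonormal
    (v_family := fun μ => e μ) fun μ => (e μ).orthonormal
  have hsp : (Submodule.span ℝ (Set.range fun a : Σ μ : ℝ, w μ =>
      (Module.End.eigenspace (T : H →ₗ[ℝ] H) a.1).subtypeₗᵢ (e a.1 a.2)))ᗮ = ⊥ := by
    rw [eq_bot_iff, ← ContinuousLinearMap.orthogonalComplement_iSup_eigenspaces_eq_bot hT hT']
    refine (Submodule.le_orthogonal_orthogonal _).trans (Submodule.orthogonal_le (iSup_le fun μ => ?_))
    intro x hx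
    rw [Submodule.mem_orthogonal]
    intro y hy
    have hz : ∀ i, inner ℝ ((e μ i : H)) y = 0 := fun i =>
      (Submodule.mem_orthogonal _ _).1 hy _ (Submodule.subset_span ⟨⟨μ, i⟩, rfl⟩)
    have hsum : HasSum (fun i => inner ℝ ((e μ).repr ⟨x, hx⟩ i • (e μ i : H)) y) (inner ℝ x y) := by
      have h1 := (e μ).hasSum_repr ⟨x, hx⟩
      have h2 := h1.mapL (Module.End.eigenspace (T : H →ₗ[ℝ] H) μ).subtypeL
      have h3 := h2.mapL (innerSL ℝ y)
      simp only [innerSL_apply_apply] at h3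
      simp only [real_inner_comm y]
      exact h3
    simp only [inner_smul_left, hz, mul_zero] at hsum
    rw [real_inner_comm]
    exact hsum.unique hasSum_zero
  let b := HilbertBasis.mkOfOrthogonalEqBot hon hsp
  have hb : ∀ a, b a = (e a.1 a.2 : H) := fun a => by
    rw [HilbertBasis.coe_mkOfOrthogonalEqBot]; rfl
  refine ⟨_, ?_, b, Sigma.fst, fun a => ?_⟩
  -- Orthonormal vectors are at distance `√2 > 1`, so these balls are disjoint, and a separable
  -- space has only countably many disjoint nonempty open sets.
  · refine Pairwise.countable_of_isOpen_disjoint (s := fun a => Metric.ball (b a) (1 / 2)) ?_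
      (fun _ => Metric.isOpen_ball) fun a => ⟨b a, Metric.mem_ball_self (by norm_num)⟩
    intro i j hij
    refine Metric.ball_disjoint_ball ?_
    have h2 : ‖b i - b j‖ ^ 2 = 2 := by
      rw [norm_sub_sq_real, b.orthonormal.1 i, b.orthonormal.1 j, b.orthonormal.2 hij]
      norm_num
    rw [dist_eq_norm]
    nlinarith [norm_nonneg (b i - b j)]
  · rw [hb]
    exact Module.End.mem_eigenspace_iff.1 (e a.1 a.2).2

/-- Power traces of the covariance operator in terms of its eigenvalues. -/
lemma hasSum_pow_eigenvalues_covOp {ι : Type*} [Countable ι] {V : Ω → H} (hV : MemLp V 2 P)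
    (b : HilbertBasis ι ℝ H) {c : ι → ℝ} (hb : ∀ i, covOp P V (b i) = c i • b i) (k : ℕ) :
    HasSum (fun i => c i ^ (k + 1)) (∫ ω, inner ℝ (V ω) ((covOp P V ^ k) (V ω)) ∂P) := by
  have hbk : ∀ (j : ℕ) i, (covOp P V ^ j) (b i) = c i ^ j • b i := fun j i => by
    induction j with
    | zero => simp
    | succ j ih => rw [pow_succ, mul_apply_eq_comp, hb, map_smul, ih, smul_smul, pow_succ,
        mul_comm]
  have hsymk : ∀ (j : ℕ) x y, inner ℝ ((covOp P V ^ j) x) y = inner ℝ x ((covOp P V ^ j) y) := by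
    intro j
    induction j with
    | zero => simp
    | succ j ih =>
      intro x y
      rw [pow_succ, mul_apply_eq_comp, ih, ← pow_succ, pow_succ',
        mul_apply_eq_comp]
      exact isSymmetric_covOp hV _ _
  have hc1 : ∀ i, ∫ ω, inner ℝ (V ω) (b i) ^ 2 ∂P = c i := fun i => by
    have h1 := inner_covOp hV (b i) (b i)
    rw [hb, inner_smul_right, real_inner_self_eq_norm_sq, b.orthonormal.1 i] at h1
    simp only [one_pow, mul_one] at h1
    rw [h1]
    congr with ω
    rw [real_inner_comm, sq]
  have hcn : ∀ i, |c i| ≤ ‖covOp P V‖ := fun i => by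
    have := (covOp P V).le_opNorm (b i)
    rwa [hb, norm_smul, b.orthonormal.1 i, mul_one, mul_one] at this
  -- The quadratic form of the `k`-th power in the eigenbasis. Integration contributes one further
  -- factor `c i = 𝔼⟨V, b i⟩²`, whence the exponent `k + 1`.
  have hpt : ∀ x : H, HasSum (fun i => c i ^ k * inner ℝ x (b i) ^ 2)
      (inner ℝ x ((covOp P V ^ k) x)) := fun x => by
    refine (b.hasSum_inner_mul_inner x ((covOp P V ^ k) x)).congr_fun fun i => ?_
    rw [← hsymk, hbk, real_inner_smul_left, real_inner_comm x (b i)]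
    ring
  have hi : ∀ i, Integrable (fun ω => c i ^ k * inner ℝ (V ω) (b i) ^ 2) P := fun i =>
    (hV.inner_const (b i)).integrable_sq.const_mul _
  have hsq : Integrable (fun ω => ‖V ω‖ ^ 2) P := hV.integrable_norm_pow (by norm_num)
  have hlim : Tendsto (fun s : Finset ι => ∫ ω, ∑ i ∈ s, c i ^ k * inner ℝ (V ω) (b i) ^ 2 ∂P) atTop
      (𝓝 (∫ ω, inner ℝ (V ω) ((covOp P V ^ k) (V ω)) ∂P)) := by
    refine tendsto_integral_filter_of_dominated_convergence
      (fun ω => ‖covOp P V‖ ^ k * ‖V ω‖ ^ 2) ?_ ?_ (hsq.const_mul _)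
      (ae_of_all _ fun ω => hpt (V ω))
    · exact Eventually.of_forall fun s => (integrable_finsetSum s fun i _ => hi i).1
    · refine Eventually.of_forall fun s => ae_of_all _ fun ω => ?_
      calc _ ≤ ∑ i ∈ s, ‖c i ^ k * inner ℝ (V ω) (b i) ^ 2‖ := norm_sum_le _ _
        _ ≤ ∑ i ∈ s, ‖covOp P V‖ ^ k * inner ℝ (V ω) (b i) ^ 2 := by
            refine Finset.sum_le_sum fun i _ => ?_
            rw [norm_mul, norm_pow, Real.norm_eq_abs, Real.norm_of_nonneg (sq_nonneg _)]
            gcongr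
            exact hcn i
        _ ≤ _ := by
            rw [← Finset.mul_sum]
            gcongr
            exact sum_le_hasSum s (fun i _ => sq_nonneg _) (b.hasSum_inner_sq (V ω))
  refine Tendsto.congr (fun s => ?_) hlim
  rw [integral_finsetSum s fun i _ => hi i]
  refine Finset.sum_congr rfl fun i _ => ?_
  simp only [integral_const_mul, hc1]
  exact (pow_succ _ _).symm

end CovarianceOperator

/-! ### The limit law and its moments as power traces. -/

section LimitLaw

/-- Existence and moments of the limit law of the squared norm of normalised sums of independent
centered Hilbert space valued random variables. -/
theorem exists_limit_law_norm_sq {Ω H : Type*} [MeasurableSpace Ω] {P : Measure Ω}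
    [IsProbabilityMeasure P] [NormedAddCommGroup H] [InnerProductSpace ℝ H] [CompleteSpace H]
    [SecondCountableTopology H] [MeasurableSpace H] [BorelSpace H] {V : ℕ → Ω → H}
    (hind : iIndepFun V P) (hident : ∀ l, IdentDistrib (V l) (V 0) P P) (hL2 : MemLp (V 0) 2 P)
    (hmean : ∀ h : H, ∫ ω, inner ℝ (V 0 ω) h ∂P = 0) {τ : ℕ → ℝ}
    (hτ : ∀ k, τ k = ∫ ω, inner ℝ (V 0 ω) ((covOp P (V 0) ^ k) (V 0 ω)) ∂P) :
    ∃ ν : Measure ℝ, IsProbabilityMeasure ν ∧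
      (∀ f : ℝ →ᵇ ℝ, Tendsto
        (fun N : ℕ => ∫ ω, f (‖(√N)⁻¹ • ∑ l ∈ Finset.range N, V l ω‖ ^ 2) ∂P) atTop
        (𝓝 (∫ y, f y ∂ν))) ∧
      MemLp (fun y : ℝ => y) 4 ν ∧
      ∫ y, y ∂ν = τ 0 ∧ variance (fun y : ℝ => y) ν = 2 * τ 1 ∧
      ∫ y, (y - ∫ z, z ∂ν) ^ 3 ∂ν = 8 * τ 2 ∧
      ∫ y, (y - ∫ z, z ∂ν) ^ 4 ∂ν = 48 * τ 3 + 12 * τ 1 ^ 2 := by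
  obtain ⟨ι, _, b, c, hb⟩ := exists_hilbertBasis_eigenvectors (isCompactOperator_covOp hL2)
    (isSymmetric_covOp hL2)
  have hcovb : ∀ i j, ∫ ω, inner ℝ (V 0 ω) (b i) * inner ℝ (V 0 ω) (b j) ∂P
      = c j * inner ℝ (b i) (b j) := fun i j => by
    have := inner_covOp hL2 (b i) (b j)
    rw [hb, inner_smul_right] at this
    rw [this]
    simp only [real_inner_comm]
  have hcov : ∀ i j, i ≠ j → ∫ ω, inner ℝ (V 0 ω) (b i) * inner ℝ (V 0 ω) (b j) ∂P = 0 :=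
    fun i j hij => by rw [hcovb, b.orthonormal.2 hij, mul_zero]
  have hcov' : ∀ i, ∫ ω, inner ℝ (V 0 ω) (b i) ^ 2 ∂P = c i := fun i => by
    simp_rw [sq]
    rw [hcovb, real_inner_self_eq_norm_sq, b.orthonormal.1 i]; ring
  have hc : ∀ i, 0 ≤ c i := fun i => hcov' i ▸ integral_nonneg fun ω => sq_nonneg _
  have htr : ∀ k, HasSum (fun i => c i ^ (k + 1)) (τ k) := fun k => by
    rw [hτ]; exact hasSum_pow_eigenvalues_covOp hL2 b hb k
  have hs : Summable c := by simpa using (htr 0).summable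
  -- The limit is realised on a product of standard Gaussians, one for each eigenvector.
  set P' := Measure.infinitePi (fun _ : ι => gaussianReal 0 1) with hP'
  set g : ι → (ι → ℝ) → ℝ := fun i ω => ω i with hg
  have hgi : iIndepFun g P' := iIndepFun_infinitePi (X := fun _ x => x) fun _ => measurable_id
  have hlaw : ∀ i, HasLaw (g i) (gaussianReal 0 1) P' := fun i =>
    ⟨(measurable_pi_apply i).aemeasurable, Measure.infinitePi_map_eval _ i⟩
  have hclt := tendstoInDistribution_norm_sq_normalized_sum hind hident hL2 hmean hgi hlaw b hcov
    hcov'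
  set Q : (ι → ℝ) → ℝ := fun ω => ∑' i, c i * g i ω ^ 2 with hQ
  have hQL : MemLp Q 4 P' := memLp_tsum_chiSq hlaw hc hs
  obtain ⟨m1, m2, m3, m4⟩ := hasSum_moments_tsum_chiSq hgi hlaw hc hs hQ
  have e1 : ∫ ω, Q ω ∂P' = τ 0 := m1.unique (by simpa using htr 0)
  have e2 := m2.unique ((htr 1).mul_left 2)
  have e3 := m3.unique ((htr 2).mul_left 8)
  have e4 := m4.unique ((htr 3).mul_left 48)
  have hmap : ∀ f : ℝ → ℝ, Continuous f → ∫ y, f y ∂(P'.map Q) = ∫ ω, f (Q ω) ∂P' :=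
    fun f hf => integral_map hQL.1.aemeasurable hf.aestronglyMeasurable
  have hν : IsProbabilityMeasure (P'.map Q) := Measure.isProbabilityMeasure_map hQL.1.aemeasurable
  have hν4 : MemLp (fun y : ℝ => y) 4 (P'.map Q) :=
    (memLp_map_measure_iff (by fun_prop) hQL.1.aemeasurable).2 hQL
  have e1' : ∫ y, y ∂(P'.map Q) = τ 0 := (hmap _ continuous_id).trans e1
  rw [e1] at e2 e3 e4
  refine ⟨P'.map Q, hν, fun f => ?_, hν4, e1', ?_, ?_, ?_⟩
  · rw [hmap f f.continuous]
    exact tendsto_integral_of_tendstoInDistribution hclt f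
  · rw [variance_eq_integral (by fun_prop), e1', hmap (fun y => (y - τ 0) ^ 2) (by fun_prop), e2]
  · rw [e1', hmap (fun y => (y - τ 0) ^ 3) (by fun_prop), e3]
  · rw [e1', hmap (fun y => (y - τ 0) ^ 4) (by fun_prop)]
    -- The variance is `2 τ 1`, and `3 (2 τ 1)² = 12 τ 1²`.
    rw [e2] at e4
    linarith

end LimitLaw

/-! ### Convergence of empirical covariance operators and their power traces. -/

section EmpiricalCovariance

open InnerProductSpace

variable {H : Type*} [NormedAddCommGroup H] [InnerProductSpace ℝ H]

/-- The identity "mean of squares minus square of the mean" for a bilinear form that need not be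
symmetric: both cross terms equal `N ⟨m, A m⟩`. -/
lemma sum_inner_centered {N : ℕ} (hN : N ≠ 0) (u : ℕ → H) (A : H →L[ℝ] H) :
    let m := (N : ℝ)⁻¹ • ∑ l ∈ Finset.range N, u l
    (N : ℝ)⁻¹ * ∑ l ∈ Finset.range N, inner ℝ (u l - m) (A (u l - m))
      = (N : ℝ)⁻¹ * ∑ l ∈ Finset.range N, inner ℝ (u l) (A (u l)) - inner ℝ m (A m) := by
  intro m
  have hm : ∑ l ∈ Finset.range N, u l = (N : ℝ) • m := by
    simp only [m, smul_smul]; rw [mul_inv_cancel₀ (by positivity), one_smul]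
  have : ∑ l ∈ Finset.range N, inner ℝ (u l - m) (A (u l - m))
      = ∑ l ∈ Finset.range N, inner ℝ (u l) (A (u l)) - N * inner ℝ m (A m) := by
    simp only [map_sub, inner_sub_left, inner_sub_right, Finset.sum_sub_distrib]
    rw [← sum_inner, ← inner_sum, ← map_sum, hm]
    simp only [Finset.sum_const, Finset.card_range, map_smul, inner_smul_left, inner_smul_right,
      nsmul_eq_mul]
    simp
  rw [this]
  field_simp

lemma sum_rankOne_centered {N : ℕ} (hN : N ≠ 0) (u : ℕ → H) :
    let m := (N : ℝ)⁻¹ • ∑ l ∈ Finset.range N, u l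
    (N : ℝ)⁻¹ • ∑ l ∈ Finset.range N, rankOne ℝ (u l - m) (u l - m)
      = (N : ℝ)⁻¹ • ∑ l ∈ Finset.range N, rankOne ℝ (u l) (u l) - rankOne ℝ m m := by
  intro m
  have hN' : (N : ℝ) ≠ 0 := by positivity
  have hm : ∑ l ∈ Finset.range N, u l = (N : ℝ) • m := by
    simp only [m, smul_smul]; rw [mul_inv_cancel₀ hN', one_smul]
  ext z
  simp only [smul_apply, sum_apply, sub_apply, rankOne_apply,
    inner_sub_left, sub_smul, smul_sub, Finset.sum_sub_distrib, Finset.sum_const,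
    Finset.card_range, ← Finset.smul_sum, ← Finset.sum_smul, ← sum_inner, hm, inner_smul_left]
  simp only [conj_trivial, smul_smul, ← Nat.cast_smul_eq_nsmul ℝ]
  have : (N : ℝ)⁻¹ * (N * inner ℝ m z) = inner ℝ m z := by field_simp
  simp only [this, mul_comm (inner ℝ m z), sub_self, sub_zero]

/-- Deterministic convergence of empirical power traces. -/
lemma tendsto_empirical_power_trace {u : ℕ → H} {T : H →L[ℝ] H} {q t : ℝ} (k : ℕ)
    (hmean : Tendsto (fun N : ℕ => (N : ℝ)⁻¹ • ∑ l ∈ Finset.range N, u l) atTop (𝓝 0))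
    (hT : Tendsto (fun N : ℕ => (N : ℝ)⁻¹ • ∑ l ∈ Finset.range N, rankOne ℝ (u l) (u l)) atTop
      (𝓝 T))
    (hq : Tendsto (fun N : ℕ => (N : ℝ)⁻¹ * ∑ l ∈ Finset.range N, ‖u l‖ ^ 2) atTop (𝓝 q))
    (ht : Tendsto (fun N : ℕ => (N : ℝ)⁻¹ * ∑ l ∈ Finset.range N, inner ℝ (u l) ((T ^ k) (u l)))
      atTop (𝓝 t)) :
    Tendsto (fun N : ℕ =>
      let m := (N : ℝ)⁻¹ • ∑ l ∈ Finset.range N, u l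
      (N : ℝ)⁻¹ * ∑ l ∈ Finset.range N, inner ℝ (u l - m)
        ((((N : ℝ)⁻¹ • ∑ j ∈ Finset.range N, rankOne ℝ (u j - m) (u j - m)) ^ k) (u l - m)))
      atTop (𝓝 t) := by
  set m : ℕ → H := fun N => (N : ℝ)⁻¹ • ∑ l ∈ Finset.range N, u l with hm
  set A : ℕ → H →L[ℝ] H := fun N =>
    (N : ℝ)⁻¹ • ∑ j ∈ Finset.range N, rankOne ℝ (u j) (u j) - rankOne ℝ (m N) (m N) with hA
  have hAT : Tendsto A atTop (𝓝 T) := by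
    have h0 := (continuous_rankOne_self (H := H)).tendsto 0 |>.comp hmean
    have := hT.sub h0
    simpa using this
  have hAk : Tendsto (fun N => A N ^ k) atTop (𝓝 (T ^ k)) := hAT.pow k
  have h1 : Tendsto (fun N => inner ℝ (m N) ((A N ^ k) (m N))) atTop (𝓝 0) := by
    have h0 : Tendsto (fun N => (A N ^ k) (m N)) atTop (𝓝 ((T ^ k) 0)) :=
      (((isBoundedBilinearMap_apply (𝕜 := ℝ) (E := H) (F := H)).continuous.tendsto (T ^ k, 0)).comp
        (hAk.prodMk_nhds hmean) :)
    have := hmean.inner (𝕜 := ℝ) h0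
    simpa using this
  -- Replacing the empirical power by `T ^ k` costs at most the operator norm of the difference
  -- times the mean of `‖u l‖²`, which stays bounded.
  have h2 : Tendsto (fun N : ℕ => (N : ℝ)⁻¹ * ∑ l ∈ Finset.range N,
      inner ℝ (u l) ((A N ^ k - T ^ k) (u l))) atTop (𝓝 0) := by
    have hb : Tendsto (fun N : ℕ => ‖A N ^ k - T ^ k‖ *
        ((N : ℝ)⁻¹ * ∑ l ∈ Finset.range N, ‖u l‖ ^ 2)) atTop (𝓝 0) := by
      have := ((tendsto_iff_norm_sub_tendsto_zero.1 hAk).mul hq)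
      simpa using this
    refine squeeze_zero_norm (fun N => ?_) hb
    rw [norm_mul, norm_inv, Real.norm_natCast, mul_left_comm]
    gcongr
    rw [Finset.mul_sum]
    refine (norm_sum_le _ _).trans (Finset.sum_le_sum fun l _ => ?_)
    calc _ ≤ ‖u l‖ * ‖(A N ^ k - T ^ k) (u l)‖ := norm_inner_le_norm _ _
      _ ≤ ‖u l‖ * (‖A N ^ k - T ^ k‖ * ‖u l‖) := by gcongr; exact ContinuousLinearMap.le_opNorm _ _
      _ = _ := by ring
  have h3 := (ht.add h2).sub h1
  simp only [add_zero, sub_zero] at h3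
  refine h3.congr' ?_
  filter_upwards [eventually_ne_atTop 0] with N hN
  have e1 := sum_rankOne_centered hN u
  have e2 := sum_inner_centered hN u (A N ^ k)
  simp only at e1 e2 ⊢
  rw [e1, e2, ← mul_add, ← Finset.sum_add_distrib]
  congr 3
  ext l
  rw [← inner_add_right, sub_apply, add_sub_cancel]

/-- Almost sure convergence of empirical power traces. -/
theorem ae_tendsto_empirical_power_trace {Ω : Type*} [MeasurableSpace Ω] {P : Measure Ω}
    [IsProbabilityMeasure P] [CompleteSpace H] [MeasurableSpace H] [BorelSpace H]
    [SecondCountableTopology H] {U : ℕ → Ω → H} (hind : iIndepFun U P)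
    (hident : ∀ l, IdentDistrib (U l) (U 0) P P) (hL2 : MemLp (U 0) 2 P)
    (hmean : ∫ ω, U 0 ω ∂P = 0) (k : ℕ) :
    ∀ᵐ ω ∂P, Tendsto (fun N : ℕ =>
      let m := (N : ℝ)⁻¹ • ∑ l ∈ Finset.range N, U l ω
      (N : ℝ)⁻¹ * ∑ l ∈ Finset.range N, inner ℝ (U l ω - m)
        ((((N : ℝ)⁻¹ • ∑ j ∈ Finset.range N, rankOne ℝ (U j ω - m) (U j ω - m)) ^ k) (U l ω - m)))
      atTop (𝓝 (∫ ω, inner ℝ (U 0 ω) ((covOp P (U 0) ^ k) (U 0 ω)) ∂P)) := by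
  have hpair : Pairwise fun i j => IndepFun (U i) (U j) P := fun i j hij => hind.indepFun hij
  have s1 := strong_law_ae U (hL2.integrable (by norm_num)) hpair hident
  rw [hmean] at s1
  -- This strong law is in the Banach space of bounded operators, so the convergence is in operator
  -- norm and passes to powers.
  borelize (H →L[ℝ] H)
  have s2 := strong_law_ae (fun l ω => rankOne ℝ (U l ω) (U l ω)) (integrable_rankOne_self hL2)
    (fun i j hij => (hpair hij).comp (φ := fun x => rankOne ℝ x x) (ψ := fun x => rankOne ℝ x x)
      continuous_rankOne_self.measurable continuous_rankOne_self.measurable)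
    (fun l => (hident l).comp (u := fun x => rankOne ℝ x x) continuous_rankOne_self.measurable)
  have scal : ∀ f : H → ℝ, Continuous f → Integrable (fun ω => f (U 0 ω)) P →
      ∀ᵐ ω ∂P, Tendsto (fun N : ℕ => (N : ℝ)⁻¹ * ∑ l ∈ Finset.range N, f (U l ω)) atTop
        (𝓝 (∫ ω, f (U 0 ω) ∂P)) := fun f hf hi =>
    strong_law_ae (fun l ω => f (U l ω)) hi
      (fun i j hij => (hpair hij).comp (φ := f) (ψ := f) hf.measurable hf.measurable)
      (fun l => (hident l).comp (u := f) hf.measurable)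
  have hsq : Integrable (fun ω => ‖U 0 ω‖ ^ 2) P := hL2.integrable_norm_pow (by norm_num)
  have s3 := scal (fun x => ‖x‖ ^ 2) (by fun_prop) hsq
  have hcont : Continuous fun x : H => inner ℝ x ((covOp P (U 0) ^ k) x) :=
    continuous_id.inner (covOp P (U 0) ^ k).continuous
  have s4 := scal (fun x => inner ℝ x ((covOp P (U 0) ^ k) x)) hcont
    ((hsq.const_mul ‖covOp P (U 0) ^ k‖).mono (hcont.comp_aestronglyMeasurable hL2.1)
      (ae_of_all _ fun ω => by
        calc _ ≤ ‖U 0 ω‖ * ‖(covOp P (U 0) ^ k) (U 0 ω)‖ := norm_inner_le_norm _ _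
          _ ≤ ‖U 0 ω‖ * (‖covOp P (U 0) ^ k‖ * ‖U 0 ω‖) := by
            gcongr; exact ContinuousLinearMap.le_opNorm _ _
          _ = ‖covOp P (U 0) ^ k‖ * ‖U 0 ω‖ ^ 2 := by ring
          _ ≤ _ := Real.le_norm_self _))
  filter_upwards [s1, s2, s3, s4] with ω h1 h2 h3 h4
  exact tendsto_empirical_power_trace k h1 h2 h3 h4

end EmpiricalCovariance

/-! ### The estimators as power traces of a centered Gram matrix. -/

section EstimatorAlgebra

open InnerProductSpace

lemma absSum_of_nonneg {N : ℕ} {A : Matrix (Fin N) (Fin N) ℝ} (hA : ∀ l m, 0 ≤ A l m) :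
    absSum A = ∑ l, ∑ m, A l m := by
  simp only [absSum, abs_of_nonneg (hA _ _)]

lemma matrix_pow_nonneg {N : ℕ} {A : Matrix (Fin N) (Fin N) ℝ} (hA : ∀ l m, 0 ≤ A l m) (k : ℕ) :
    ∀ l m, 0 ≤ (A ^ k) l m := by
  induction k with
  | zero => intro l m; rw [pow_zero, Matrix.one_apply]; positivity
  | succ k ih =>
    intro l m
    rw [pow_succ, Matrix.mul_apply]
    exact Finset.sum_nonneg fun j _ => mul_nonneg (ih l j) (hA j m)

/-- The averaging matrix, all of whose entries are `1 / N`. -/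
noncomputable def avgMatrix (N : ℕ) : Matrix (Fin N) (Fin N) ℝ := Matrix.of fun _ _ => (N : ℝ)⁻¹

lemma trace_avgMatrix_mul {N : ℕ} (A : Matrix (Fin N) (Fin N) ℝ) :
    (avgMatrix N * A).trace = (N : ℝ)⁻¹ * ∑ l, ∑ m, A l m := by
  simp only [Matrix.trace, Matrix.diag, Matrix.mul_apply, avgMatrix, Matrix.of_apply]
  rw [Finset.sum_comm]
  simp only [← Finset.mul_sum]

/-- The averaging matrix `E` has rank one, so compressing any matrix by it gives a multiple of `E`.
This reduces words in `E` and `B` to scalars. -/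
lemma avgMatrix_mul_mul_avgMatrix {N : ℕ} (A : Matrix (Fin N) (Fin N) ℝ) :
    avgMatrix N * A * avgMatrix N = (avgMatrix N * A).trace • avgMatrix N := by
  rw [trace_avgMatrix_mul]
  ext i j
  simp only [Matrix.mul_apply, avgMatrix, Matrix.of_apply, Matrix.smul_apply, smul_eq_mul]
  rw [← Finset.sum_mul, Finset.sum_comm]
  simp only [← Finset.mul_sum]

/-- Expansion of the power traces of a doubly centered matrix. -/
lemma trace_centered_pow {N : ℕ} (B : Matrix (Fin N) (Fin N) ℝ) :
    let s := fun k : ℕ => (avgMatrix N * B ^ k).trace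
    (B - avgMatrix N * B).trace = B.trace - s 1 ∧
    ((B - avgMatrix N * B) ^ 2).trace = (B ^ 2).trace - 2 * s 2 + s 1 ^ 2 ∧
    ((B - avgMatrix N * B) ^ 3).trace
      = (B ^ 3).trace - 3 * s 3 + 3 * s 1 * s 2 - s 1 ^ 3 ∧
    ((B - avgMatrix N * B) ^ 4).trace
      = (B ^ 4).trace - 4 * s 4 + 4 * s 1 * s 3 + 2 * s 2 ^ 2 - 4 * s 1 ^ 2 * s 2 + s 1 ^ 4 := by
  intro s
  set E := avgMatrix N with hE
  set X := E * B with hX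
  -- A product with several factors `X` collapses to a scalar times a product with one `X`; by
  -- cyclicity the trace of the latter is some `s k`.
  have hEE : ∀ A, E * (A * X) = (E * A).trace • X := fun A => by
    rw [hX, ← mul_assoc, ← mul_assoc, avgMatrix_mul_mul_avgMatrix, smul_mul_assoc]
  have h0 : X * X = s 1 • X := by
    rw [show X * X = E * (B * X) by rw [hX]; simp only [mul_assoc], hEE, ← pow_one B]
  have h1 : X * (B * X) = s 2 • X := by
    rw [show X * (B * X) = E * (B ^ 2 * X) by rw [hX, sq]; simp only [mul_assoc], hEE]
  have h2 : X * (B * (B * X)) = s 3 • X := by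
    rw [show X * (B * (B * X)) = E * (B ^ 3 * X) by rw [hX, pow_succ, sq]; simp only [mul_assoc],
      hEE]
  have t1 : X.trace = s 1 := by simp [s, hX, hE]
  have t2 : (X * B).trace = s 2 := by simp [s, hX, hE, sq, mul_assoc]
  have t3 : (X * (B * B)).trace = s 3 := by simp [s, hX, hE, pow_succ, mul_assoc]
  have t4 : (X * (B * (B * B))).trace = s 4 := by simp [s, hX, hE, pow_succ, mul_assoc]
  have t2' : (B * X).trace = s 2 := by rw [Matrix.trace_mul_comm, t2]
  have t3' : (B * (X * B)).trace = s 3 := by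
    rw [Matrix.trace_mul_comm, mul_assoc, t3]
  have t3'' : (B * (B * X)).trace = s 3 := by
    rw [Matrix.trace_mul_comm, mul_assoc, Matrix.trace_mul_comm, mul_assoc, t3]
  have t4' : (B * (X * (B * B))).trace = s 4 := by
    rw [Matrix.trace_mul_comm]; simp only [mul_assoc]; exact t4
  have t4'' : (B * (B * (X * B))).trace = s 4 := by
    rw [Matrix.trace_mul_comm]; simp only [mul_assoc]; exact t4'
  have t4''' : (B * (B * (B * X))).trace = s 4 := by
    rw [Matrix.trace_mul_comm]; simp only [mul_assoc]; exact t4''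
  refine ⟨?_, ?_, ?_, ?_⟩
  · rw [Matrix.trace_sub, t1]
  · simp only [pow_succ, pow_zero, one_mul, sub_mul, mul_sub, Matrix.trace_sub, h0,
      Matrix.trace_smul, t1, t2, t2', smul_eq_mul]
    ring
  · simp only [pow_succ, pow_zero, one_mul, sub_mul, mul_sub, mul_assoc, Matrix.trace_sub, h0, h1,
      Matrix.trace_smul, mul_smul_comm, smul_mul_assoc, t1, t2, t2', t3, t3', t3'', smul_eq_mul]
    ring
  · simp only [pow_succ, pow_zero, one_mul, sub_mul, mul_sub, mul_assoc, Matrix.trace_sub, h0, h1,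
      h2, Matrix.trace_smul, mul_smul_comm, smul_mul_assoc, t1, t2, t2', t3, t3', t3'',
      t4, t4', t4'', t4''', smul_eq_mul]
    ring

variable {H : Type*} [NormedAddCommGroup H] [InnerProductSpace ℝ H]

/-- The Gram matrix of the centered vectors is minus the doubly centered distance matrix. -/
lemma gram_centered_eq {N : ℕ} (hN : N ≠ 0) (u : Fin N → H) :
    (Matrix.of fun l m => inner ℝ (u l - (N : ℝ)⁻¹ • ∑ j, u j) (u m - (N : ℝ)⁻¹ • ∑ j, u j))
      = -((1 - avgMatrix N) * (Matrix.of fun l m => 1 / 2 * ‖u l - u m‖ ^ 2) * (1 - avgMatrix N)) := by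
  have hN' : (N : ℝ) ≠ 0 := by positivity
  set a : H := (N : ℝ)⁻¹ • ∑ j, u j with ha
  set w : Fin N → H := fun l => u l - a with hw
  have hw0 : ∑ l, w l = 0 := by
    simp only [hw, Finset.sum_sub_distrib, Finset.sum_const, Finset.card_univ, Fintype.card_fin, ha]
    rw [← Nat.cast_smul_eq_nsmul ℝ, smul_smul, mul_inv_cancel₀ hN', one_smul, sub_self]
  -- Half the squared distance is a function of the row, plus a function of the column, minus the
  -- Gram entry. Double centering kills the first two and fixes the Gram matrix, whose rows and
  -- columns sum to 0.
  have hB : ∀ l m, 1 / 2 * ‖u l - u m‖ ^ 2 = 1 / 2 * ‖w l‖ ^ 2 + 1 / 2 * ‖w m‖ ^ 2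
      - inner ℝ (w l) (w m) := fun l m => by
    rw [show u l - u m = w l - w m by simp [hw], norm_sub_sq_real]; ring
  have hrow : ∀ l, ∑ m, inner ℝ (w l) (w m) = 0 := fun l => by
    rw [← inner_sum, hw0, inner_zero_right]
  have hcol : ∀ m, ∑ l, inner ℝ (w l) (w m) = 0 := fun m => by
    rw [← sum_inner, hw0, inner_zero_left]
  set R : Matrix (Fin N) (Fin N) ℝ := Matrix.of fun _ m => 1 / 2 * ‖w m‖ ^ 2 with hR
  set C : Matrix (Fin N) (Fin N) ℝ := Matrix.of fun l _ => 1 / 2 * ‖w l‖ ^ 2 with hC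
  set G : Matrix (Fin N) (Fin N) ℝ := Matrix.of fun l m => inner ℝ (w l) (w m) with hG
  have e0 : (Matrix.of fun l m => 1 / 2 * ‖u l - u m‖ ^ 2) = C + R - G := by
    ext l m
    simp only [hR, hC, hG, hB, Matrix.add_apply, Matrix.sub_apply, Matrix.of_apply]
  have eR : avgMatrix N * R = R := by
    ext l m
    simp [Matrix.mul_apply, avgMatrix, hR, hN']
  have eC : C * avgMatrix N = C := by
    ext l m
    simp only [Matrix.mul_apply, avgMatrix, hC, Matrix.of_apply, Finset.sum_const,
      Finset.card_univ, Fintype.card_fin, nsmul_eq_mul]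
    field_simp
  have eG : avgMatrix N * G = 0 := by
    ext l m
    simp only [Matrix.mul_apply, avgMatrix, hG, Matrix.of_apply, Matrix.zero_apply]
    rw [← Finset.mul_sum, hcol, mul_zero]
  have eG' : G * avgMatrix N = 0 := by
    ext l m
    simp only [Matrix.mul_apply, avgMatrix, hG, Matrix.of_apply, Matrix.zero_apply]
    rw [← Finset.sum_mul, hrow, zero_mul]
  have e1 : (1 - avgMatrix N) * R = 0 := by rw [sub_mul, one_mul, eR, sub_self]
  have e2 : C * (1 - avgMatrix N) = 0 := by rw [mul_sub, mul_one, eC, sub_self]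
  have e3 : (1 - avgMatrix N) * G = G := by rw [sub_mul, one_mul, eG, sub_zero]
  have e4 : G * (1 - avgMatrix N) = G := by rw [mul_sub, mul_one, eG', sub_zero]
  rw [e0, mul_sub (1 - avgMatrix N) (C + R) G, mul_add, e1, add_zero, e3,
    sub_mul _ _ (1 - avgMatrix N), e4, mul_assoc, e2, mul_zero, zero_sub,
    neg_neg]

lemma avgMatrix_mul_self {N : ℕ} (hN : N ≠ 0) : avgMatrix N * avgMatrix N = avgMatrix N := by
  have hN' : (N : ℝ) ≠ 0 := by positivity
  ext l m
  simp [Matrix.mul_apply, avgMatrix, hN']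

/-- The centering matrix `F` is idempotent, so inside a trace one of the two outer factors can be
absorbed by cyclicity. The exponent must be at least 1. -/
lemma trace_gram_centered_pow {N : ℕ} (hN : N ≠ 0) (B : Matrix (Fin N) (Fin N) ℝ) (k : ℕ) :
    ((-((1 - avgMatrix N) * B * (1 - avgMatrix N))) ^ (k + 1)).trace
      = (-1) ^ (k + 1) * ((B - avgMatrix N * B) ^ (k + 1)).trace := by
  set F := (1 : Matrix (Fin N) (Fin N) ℝ) - avgMatrix N with hF
  have hFF : F * F = F := by
    rw [hF, sub_mul, mul_sub, mul_sub, avgMatrix_mul_self hN]; simp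
  have hFB : B - avgMatrix N * B = F * B := by rw [hF, sub_mul, one_mul]
  have hpow : ∀ j : ℕ, (F * B * F) ^ (j + 1) = (F * B) ^ (j + 1) * F := fun j => by
    induction j with
    | zero => simp
    | succ j ih =>
      rw [pow_succ, ih, pow_succ (F * B) (j + 1)]
      calc _ = (F * B) ^ (j + 1) * ((F * F) * (B * F)) := by simp only [mul_assoc]
        _ = _ := by rw [hFF]; simp only [mul_assoc]
  have hF' : F * (F * B) ^ (k + 1) = (F * B) ^ (k + 1) := by
    rw [pow_succ', ← mul_assoc, ← mul_assoc, hFF]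
  rw [hFB, ← neg_one_smul ℝ (F * B * F), smul_pow, Matrix.trace_smul, hpow, Matrix.trace_mul_comm, hF',
    smul_eq_mul]

/-- The moment estimators as power traces of the centered Gram matrix. -/
lemma est_eq_trace_gram {N : ℕ} (hN : N ≠ 0) (u : Fin N → H) :
    let B : Matrix (Fin N) (Fin N) ℝ := Matrix.of fun l m => 1 / 2 * ‖u l - u m‖ ^ 2
    let G : Matrix (Fin N) (Fin N) ℝ :=
      Matrix.of fun l m => inner ℝ (u l - (N : ℝ)⁻¹ • ∑ j, u j) (u m - (N : ℝ)⁻¹ • ∑ j, u j)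
    est1 B = (N : ℝ)⁻¹ * G.trace ∧ est2 B = (N : ℝ)⁻¹ ^ 2 * (G ^ 2).trace ∧
    est3 B = (N : ℝ)⁻¹ ^ 3 * (G ^ 3).trace ∧ est4 B = (N : ℝ)⁻¹ ^ 4 * (G ^ 4).trace := by
  intro B G
  have hN' : (N : ℝ) ≠ 0 := by positivity
  have hG : G = -((1 - avgMatrix N) * B * (1 - avgMatrix N)) := gram_centered_eq hN u
  have hB0 : ∀ l m, 0 ≤ B l m := fun l m => by simp only [B, Matrix.of_apply]; positivity
  have hBs : ∀ l m, B l m = B m l := fun l m => by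
    simp only [B, Matrix.of_apply, norm_sub_rev (u l)]
  have hBd : B.trace = 0 := by simp [B, Matrix.trace]
  -- Entries of powers of `B` are nonnegative, so `|B ^ k|` is `N` times the quantity `s k` of
  -- `trace_centered_pow`; with the symmetry of `B`, `|B ^ k ⊙ B|` is a trace (`htr`).
  have hpow : ∀ k, absSum (B ^ k) = N * (avgMatrix N * B ^ k).trace := fun k => by
    rw [trace_avgMatrix_mul, absSum_of_nonneg (matrix_pow_nonneg hB0 k), mul_inv_cancel_left₀ hN']
  have hpow1 : absSum B = N * (avgMatrix N * B ^ 1).trace := by simpa using hpow 1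
  have htr : ∀ k, absSum ((B ^ k) ⊙ B) = (B ^ (k + 1)).trace := fun k => by
    rw [absSum_of_nonneg (A := (B ^ k) ⊙ B) fun l m =>
      mul_nonneg (matrix_pow_nonneg hB0 k l m) (hB0 l m), pow_succ]
    simp only [Matrix.trace, Matrix.diag, Matrix.mul_apply, Matrix.hadamard_apply]
    exact Finset.sum_congr rfl fun l _ => Finset.sum_congr rfl fun m _ => by rw [hBs]
  have htr1 : absSum (B ⊙ B) = (B ^ 2).trace := by simpa using htr 1
  obtain ⟨c1, c2, c3, c4⟩ := trace_centered_pow B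
  have g1 := trace_gram_centered_pow hN B 0
  have g2 := trace_gram_centered_pow hN B 1
  have g3 := trace_gram_centered_pow hN B 2
  have g4 := trace_gram_centered_pow hN B 3
  simp only [zero_add, pow_one, Nat.reduceAdd, ← hG] at g1 g2 g3 g4
  rw [c1, hBd] at g1
  rw [c2] at g2
  rw [c3] at g3
  rw [c4] at g4
  rw [g1, g2, g3, g4, est1, est2, est3, est4, htr1, htr, htr, hpow, hpow, hpow, hpow1]
  refine ⟨?_, ?_, ?_, ?_⟩ <;> field_simp <;> ring

/-- Power traces of a Gram matrix in terms of the empirical covariance operator. -/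
lemma inner_empirical_pow {N : ℕ} (w : Fin N → H) (k : ℕ) :
    (N : ℝ)⁻¹ * ∑ l, inner ℝ (w l) ((((N : ℝ)⁻¹ • ∑ j, rankOne ℝ (w j) (w j)) ^ k) (w l))
      = (N : ℝ)⁻¹ ^ (k + 1) *
        ((Matrix.of fun l m => inner ℝ (w l) (w m) : Matrix (Fin N) (Fin N) ℝ) ^ (k + 1)).trace := by
  set G : Matrix (Fin N) (Fin N) ℝ := Matrix.of fun l m => inner ℝ (w l) (w m) with hG
  set T : H →L[ℝ] H := (N : ℝ)⁻¹ • ∑ j, rankOne ℝ (w j) (w j) with hT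
  have hTw : ∀ l, T (w l) = (N : ℝ)⁻¹ • ∑ m, G m l • w m := fun l => by
    simp [hT, hG, smul_apply, sum_apply, rankOne_apply]
  -- The empirical operator maps the span of the `w l` to itself and acts there through the matrix
  -- `G / N`.
  have hTk : ∀ (j : ℕ) l, (T ^ j) (w l) = (N : ℝ)⁻¹ ^ j • ∑ m, (G ^ j) m l • w m := fun j => by
    induction j with
    | zero => intro l; simp [Matrix.one_apply]
    | succ j ih =>
      intro l
      rw [pow_succ, mul_apply_eq_comp, hTw, map_smul, map_sum]
      simp only [map_smul, ih, pow_succ, Matrix.mul_apply, Finset.smul_sum, smul_smul,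
        Finset.sum_smul]
      rw [Finset.sum_comm]
      refine Finset.sum_congr rfl fun m _ => Finset.sum_congr rfl fun i _ => ?_
      congr 1; ring
  simp only [hTk, inner_smul_right, inner_sum]
  rw [← Finset.mul_sum, ← mul_assoc, ← pow_succ']
  congr 1
  simp only [Matrix.trace, Matrix.diag, pow_succ' G, Matrix.mul_apply]
  refine Finset.sum_congr rfl fun l _ => Finset.sum_congr rfl fun m _ => ?_
  rw [hG, Matrix.of_apply, mul_comm]

end EstimatorAlgebra

/-! ### Random fields as `L²`-valued random elements. -/

section SecondOrderFields

variable {α β : Type*} [MeasurableSpace α] [MeasurableSpace β]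

lemma secondCountableTopology_Lp_two (ρ : Measure β) [IsSeparable ρ] :
    SecondCountableTopology (Lp ℂ 2 ρ) :=
  haveI : Fact ((2 : ENNReal) ≠ ⊤) := ⟨by norm_num⟩
  inferInstance

/-- A jointly measurable field with square integrable sections is strongly measurable as an
`L²`-valued map. -/
lemma stronglyMeasurable_toLp {ρ : Measure β} [SigmaFinite ρ] [SecondCountableTopology (Lp ℂ 2 ρ)]
    {F : α → β → ℂ} (hF : Measurable (Function.uncurry F)) (hL : ∀ x, MemLp (F x) 2 ρ) :
    StronglyMeasurable fun x => (hL x).toLp (F x) := by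
  obtain ⟨w, b, hb⟩ := exists_hilbertBasis ℝ (Lp ℂ 2 ρ)
  have hw : Countable w := by
    refine Pairwise.countable_of_isOpen_disjoint (s := fun a => Metric.ball (b a) (1 / 2)) ?_
      (fun _ => Metric.isOpen_ball) fun a => ⟨b a, Metric.mem_ball_self (by norm_num)⟩
    intro i j hij
    refine Metric.ball_disjoint_ball ?_
    have h2 : ‖b i - b j‖ ^ 2 = 2 := by
      rw [norm_sub_sq_real, b.orthonormal.1 i, b.orthonormal.1 j, b.orthonormal.2 hij]
      norm_num
    rw [dist_eq_norm]
    nlinarith [norm_nonneg (b i - b j)]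
  -- Coordinates in a Hilbert basis are parameter integrals, measurable by joint measurability; the
  -- map is the pointwise limit of its finite expansions.
  have hcoord : ∀ i, StronglyMeasurable fun x => inner ℝ (b i) ((hL x).toLp (F x)) := fun i => by
    have h1 : ∀ x, inner ℝ (b i) ((hL x).toLp (F x)) = ∫ t, inner ℝ (b i t) (F x t) ∂ρ := fun x => by
      rw [L2.inner_def]
      refine integral_congr_ae ?_
      filter_upwards [(hL x).coeFn_toLp] with t ht
      rw [ht]
    simp_rw [h1]
    refine StronglyMeasurable.integral_prod_right ?_
    have h2 : StronglyMeasurable (b i : β → ℂ) := Lp.stronglyMeasurable _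
    exact ((h2.comp_measurable measurable_snd).inner hF.stronglyMeasurable)
  refine stronglyMeasurable_of_tendsto (atTop : Filter (Finset w))
    (f := fun s x => ∑ i ∈ s, inner ℝ (b i) ((hL x).toLp (F x)) • b i) (fun s => ?_) ?_
  · exact Finset.stronglyMeasurable_fun_sum s fun i _ => (hcoord i).smul_const _
  · refine tendsto_pi_nhds.2 fun x => ?_
    have := b.hasSum_repr ((hL x).toLp (F x))
    simp only [b.repr_apply_apply] at this
    exact this

/-- The complex space `Lp ℂ 2 ρ` is used throughout as a real Hilbert space. -/
lemma real_inner_toLp {ρ : Measure β} {f g : β → ℂ} (hf : MemLp f 2 ρ) (hg : MemLp g 2 ρ) :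
    inner ℝ (hf.toLp f) (hg.toLp g) = (∫ t, (starRingEnd ℂ) (f t) * g t ∂ρ).re := by
  have hi : Integrable (fun t => (starRingEnd ℂ) (f t) * g t) ρ := hf.star.integrable_mul hg
  rw [L2.inner_def, ← RCLike.re_eq_complex_re, ← integral_re hi]
  refine integral_congr_ae ?_
  filter_upwards [hf.coeFn_toLp, hg.coeFn_toLp] with t h1 h2
  rw [h1, h2, Complex.inner, mul_comm]
  rfl

lemma norm_sq_toLp {ρ : Measure β} {f : β → ℂ} (hf : MemLp f 2 ρ) :
    ‖hf.toLp f‖ ^ 2 = ∫ t, ‖f t‖ ^ 2 ∂ρ := by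
  rw [← real_inner_self_eq_norm_sq, L2.inner_def]
  refine integral_congr_ae ?_
  filter_upwards [hf.coeFn_toLp] with t h1
  rw [real_inner_self_eq_norm_sq, h1]

end SecondOrderFields

/-! ### Integrals of products over subsets of the coordinates. -/

section ProductIntegrals

variable {n : ℕ} {E : Fin n → Type*} [∀ i, MeasurableSpace (E i)]

/-- Integral of a product over a subset of the coordinates. -/
lemma integral_pi_prod_finset {𝕜 : Type*} [RCLike 𝕜] {μ : ∀ i, Measure (E i)}
    [∀ i, IsProbabilityMeasure (μ i)] (S : Finset (Fin n)) (f : ∀ i : S, E i → 𝕜) :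
    ∫ x, ∏ i : S, f i (x i) ∂(Measure.pi μ) = ∏ i : S, ∫ x, f i x ∂(μ i) := by
  classical
  -- Coordinates outside `S` get the factor 1, which integrates to 1 under a probability measure.
  let F : ∀ i, E i → 𝕜 := fun i x => if h : i ∈ S then f ⟨i, h⟩ x else 1
  have h1 : ∀ x : ∀ i, E i, ∏ i : S, f i (x i) = ∏ i, F i (x i) := fun x => by
    rw [← Finset.prod_subset (Finset.subset_univ S) (f := fun i => F i (x i))
      (fun i _ hi => by simp [F, hi]), ← Finset.prod_coe_sort S]
    exact Finset.prod_congr rfl fun i _ => by simp [F, i.2]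
  simp_rw [h1]
  rw [integral_fintype_prod_eq_prod,
    ← Finset.prod_subset (Finset.subset_univ S) (f := fun i => ∫ x, F i x ∂(μ i))
      (fun i _ hi => by simp [F, hi]), ← Finset.prod_coe_sort S]
  exact Finset.prod_congr rfl fun i _ => by simp [F, i.2]

lemma integrable_pi_prod_finset {𝕜 : Type*} [RCLike 𝕜] {μ : ∀ i, Measure (E i)}
    [∀ i, IsProbabilityMeasure (μ i)] (S : Finset (Fin n)) {f : ∀ i : S, E i → 𝕜}
    (hf : ∀ i, Integrable (f i) (μ i)) :
    Integrable (fun x => ∏ i : S, f i (x i)) (Measure.pi μ) := by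
  classical
  let F : ∀ i, E i → 𝕜 := fun i x => if h : i ∈ S then f ⟨i, h⟩ x else 1
  have h1 : ∀ x : ∀ i, E i, ∏ i : S, f i (x i) = ∏ i, F i (x i) := fun x => by
    rw [← Finset.prod_subset (Finset.subset_univ S) (f := fun i => F i (x i))
      (fun i _ hi => by simp [F, hi]), ← Finset.prod_coe_sort S]
    exact Finset.prod_congr rfl fun i _ => by simp [F, i.2]
  simp_rw [h1]
  refine Integrable.fintype_prod_dep fun i => ?_
  by_cases h : i ∈ S
  · simpa [F, h] using hf ⟨i, h⟩
  · simp [F, h]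

/-- Exchange of the two indices in a product of product measures. -/
lemma map_swap_pi_pi {N : ℕ} (μ : ∀ i, Measure (E i)) [∀ i, IsProbabilityMeasure (μ i)] :
    (Measure.pi fun _ : Fin N => Measure.pi μ).map (fun x i l => x l i)
      = Measure.pi fun i => Measure.pi fun _ : Fin N => μ i := by
  symm
  refine Measure.pi_eq_generateFrom
    (C := fun i => Set.univ.pi '' Set.univ.pi fun _ : Fin N => {s : Set (E i) | MeasurableSet s})
    (fun i => generateFrom_pi) (fun i => isPiSystem_pi)
    (fun i => ⟨fun _ => Set.univ, fun _ => ⟨fun _ => Set.univ, by simp, by simp⟩,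
      fun _ => measure_lt_top _ _, by simp [Set.iUnion_const]⟩) ?_
  intro s hs
  choose r hr hrs using hs
  have hrm : ∀ i l, MeasurableSet (r i l) := fun i l => hr i l (Set.mem_univ _)
  have hm : Measurable fun (x : Fin N → ∀ i, E i) i l => x l i := by fun_prop
  have hset : MeasurableSet (Set.univ.pi s) := MeasurableSet.univ_pi fun i => by
    rw [← hrs i]; exact MeasurableSet.univ_pi fun l => hrm i l
  rw [Measure.map_apply hm hset]
  have hpre : (fun (x : Fin N → ∀ i, E i) i l => x l i) ⁻¹' (Set.univ.pi s)
      = Set.univ.pi fun l => Set.univ.pi fun i => r i l := by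
    ext x
    simp only [Set.mem_preimage, Set.mem_univ_pi, ← hrs]
    exact forall_comm
  rw [hpre, Measure.pi_pi]
  simp_rw [Measure.pi_pi, ← hrs, Measure.pi_pi]
  exact Finset.prod_comm

/-- After the exchange of indices, the samples of the different coordinates are independent blocks.
This uses independence of the components. -/
lemma integral_pi_pi_prod_finset {𝕜 : Type*} [RCLike 𝕜] {N : ℕ} (μ : ∀ i, Measure (E i))
    [∀ i, IsProbabilityMeasure (μ i)] (S : Finset (Fin n)) {f : ∀ i : S, (Fin N → E i) → 𝕜}
    (hf : ∀ i, Measurable (f i)) :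
    ∫ x, ∏ i : S, f i (fun l => x l i) ∂(Measure.pi fun _ : Fin N => Measure.pi μ)
      = ∏ i : S, ∫ x, f i x ∂(Measure.pi fun _ : Fin N => μ i) := by
  rw [← integral_pi_prod_finset (μ := fun i => Measure.pi fun _ : Fin N => μ i) S f,
    ← map_swap_pi_pi μ, integral_map]
  · exact Measurable.aemeasurable (by fun_prop)
  · refine Measurable.aestronglyMeasurable ?_
    exact Finset.measurable_fun_prod _ fun i _ => (hf i).comp (measurable_pi_apply _)

end ProductIntegrals

/-! ### Centered kernels and their `L²` embedding. -/

section CenteredKernels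

variable {α β : Type*} [MeasurableSpace α] [MeasurableSpace β]

/-- A bounded jointly measurable kernel which is square integrable, centered in its first variable,
and whose Gram kernel in the second variable is real. -/
structure IsCenteredKernel (μ : Measure α) (ρ : Measure β) (F : α → β → ℂ) : Prop where
  measurable : Measurable (Function.uncurry F)
  bounded : ∃ C, ∀ x t, ‖F x t‖ ≤ C
  memLp : ∀ x, MemLp (F x) 2 ρ
  integrable_norm_sq : Integrable (fun p : α × β => ‖F p.1 p.2‖ ^ 2) (μ.prod ρ)
  integral_eq_zero : ∀ t, ∫ x, F x t ∂μ = 0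
  gram_im : ∀ x y, (∫ t, (starRingEnd ℂ) (F x t) * F y t ∂ρ).im = 0

namespace IsCenteredKernel

variable {μ : Measure α} {ρ : Measure β} {F : α → β → ℂ}

/-- The `L²`-valued random element defined by a centered kernel. -/
noncomputable def toL2 (h : IsCenteredKernel μ ρ F) (x : α) : Lp ℂ 2 ρ := (h.memLp x).toLp (F x)

/-- Real parts are not multiplicative; realness of the Gram kernel is what will let real inner
products factorise over coordinates. -/
lemma gram_eq_inner (h : IsCenteredKernel μ ρ F) (x y : α) :
    ∫ t, (starRingEnd ℂ) (F x t) * F y t ∂ρ = ((inner ℝ (h.toL2 x) (h.toL2 y) : ℝ) : ℂ) := by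
  rw [toL2, toL2, real_inner_toLp]
  exact Complex.ext rfl (by simp [h.gram_im x y])

lemma norm_sq_toL2 (h : IsCenteredKernel μ ρ F) (x : α) :
    ‖h.toL2 x‖ ^ 2 = ∫ t, ‖F x t‖ ^ 2 ∂ρ := norm_sq_toLp _

lemma measurable_comp {γ : Type*} [MeasurableSpace γ] (h : IsCenteredKernel μ ρ F) {f : γ → α}
    {g : γ → β} (hf : Measurable f) (hg : Measurable g) : Measurable fun c => F (f c) (g c) :=
  h.measurable.comp (hf.prodMk hg)

lemma measurable_section (h : IsCenteredKernel μ ρ F) (t : β) : Measurable fun x => F x t :=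
  h.measurable_comp measurable_id measurable_const

lemma memLp_section [IsProbabilityMeasure μ] (h : IsCenteredKernel μ ρ F) (t : β) (p : ENNReal) :
    MemLp (fun x => F x t) p μ := by
  obtain ⟨C, hC⟩ := h.bounded
  exact MemLp.of_bound (h.measurable_section t).aestronglyMeasurable C (ae_of_all _ fun x => hC x t)

variable [SigmaFinite ρ]

/-- Fubini and centering in the first variable. The integrand is dominated by `‖F‖² + ‖v‖²`. -/
lemma integral_inner_toL2 [IsProbabilityMeasure μ] (h : IsCenteredKernel μ ρ F) (v : Lp ℂ 2 ρ) :
    ∫ x, inner ℝ (h.toL2 x) v ∂μ = 0 := by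
  have hv : Integrable (fun t => ‖v t‖ ^ 2) ρ :=
    (memLp_two_iff_integrable_sq_norm (Lp.aestronglyMeasurable v)).1 (Lp.memLp v)
  have hint : Integrable (fun p : α × β => inner ℝ (F p.1 p.2) (v p.2)) (μ.prod ρ) := by
    refine Integrable.mono' (h.integrable_norm_sq.add (hv.comp_snd μ)) ?_ (ae_of_all _ fun p => ?_)
    · exact ((h.measurable.stronglyMeasurable).inner
        ((Lp.stronglyMeasurable v).comp_measurable measurable_snd)).aestronglyMeasurable
    · refine (norm_inner_le_norm _ _).trans ?_
      simp only [Pi.add_apply]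
      nlinarith [sq_nonneg (‖F p.1 p.2‖ - ‖v p.2‖), sq_nonneg ‖F p.1 p.2‖, sq_nonneg ‖v p.2‖]
  have h1 : ∀ x, inner ℝ (h.toL2 x) v = ∫ t, inner ℝ (F x t) (v t) ∂ρ := fun x => by
    rw [L2.inner_def]
    refine integral_congr_ae ?_
    filter_upwards [(h.memLp x).coeFn_toLp] with t ht
    rw [toL2, ht]
  simp_rw [h1]
  rw [integral_integral_swap hint]
  have h2 : ∀ t, ∫ x, inner ℝ (F x t) (v t) ∂μ = 0 := fun t => by
    simp_rw [real_inner_comm (v t)]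
    rw [integral_inner ((h.memLp_section t 1).integrable le_rfl), h.integral_eq_zero, inner_zero_right]
  rw [integral_congr_ae (ae_of_all _ h2), integral_zero]

variable [SecondCountableTopology (Lp ℂ 2 ρ)]

lemma stronglyMeasurable_toL2 (h : IsCenteredKernel μ ρ F) : StronglyMeasurable h.toL2 :=
  stronglyMeasurable_toLp h.measurable h.memLp

lemma memLp_toL2 [IsProbabilityMeasure μ] (h : IsCenteredKernel μ ρ F) : MemLp h.toL2 2 μ := by
  rw [memLp_two_iff_integrable_sq_norm h.stronglyMeasurable_toL2.aestronglyMeasurable]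
  simp_rw [h.norm_sq_toL2]
  exact h.integrable_norm_sq.integral_prod_left

lemma integral_toL2 [IsProbabilityMeasure μ] (h : IsCenteredKernel μ ρ F) :
    ∫ x, h.toL2 x ∂μ = 0 := by
  refine ext_inner_left ℝ fun v => ?_
  rw [← integral_inner (h.memLp_toL2.integrable (by norm_num)), inner_zero_right,
    ← h.integral_inner_toL2 v]
  simp_rw [real_inner_comm v]

end IsCenteredKernel

end CenteredKernels

/-! ### Products of kernels: traces factorise over coordinates. -/

section ProductKernels

variable {n : ℕ} {α β : Fin n → Type*} [∀ i, MeasurableSpace (α i)] [∀ i, MeasurableSpace (β i)]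
  {μ : ∀ i, Measure (α i)} {ρ : ∀ i, Measure (β i)} {F : ∀ i, α i → β i → ℂ}
  [∀ i, IsProbabilityMeasure (μ i)] [∀ i, SigmaFinite (ρ i)]

/-- Every condition factorises over the coordinates. Nonemptiness of `S` serves the centering, since
an empty product is 1. -/
lemma IsCenteredKernel.prod (hF : ∀ i, IsCenteredKernel (μ i) (ρ i) (F i)) {S : Finset (Fin n)}
    (hS : S.Nonempty) :
    IsCenteredKernel (Measure.pi μ) (Measure.pi fun i : S => ρ i)
      (fun x t => ∏ i : S, F i (x i) (t i)) where
  measurable := Finset.measurable_fun_prod _ fun i _ => (hF i).measurable_comp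
    ((measurable_pi_apply _).comp measurable_fst) ((measurable_pi_apply _).comp measurable_snd)
  bounded := by
    choose C hC using fun i => (hF i).bounded
    refine ⟨∏ i : S, C i, fun x t => ?_⟩
    rw [norm_prod]
    exact Finset.prod_le_prod (fun _ _ => norm_nonneg _) fun i _ => hC i _ _
  memLp := fun x => by
    have hm : Measurable fun t : ∀ i : S, β i => ∏ i : S, F i (x i) (t i) :=
      Finset.measurable_fun_prod _ fun i _ => (hF i).measurable_comp
        measurable_const (measurable_pi_apply _)
    rw [memLp_two_iff_integrable_sq_norm hm.aestronglyMeasurable]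
    simp_rw [norm_prod, ← Finset.prod_pow]
    exact Integrable.fintype_prod_dep (f := fun (i : S) t => ‖F i (x i) t‖ ^ 2) fun i =>
      (memLp_two_iff_integrable_sq_norm ((hF i).memLp (x i)).1).1 ((hF i).memLp (x i))
  integrable_norm_sq := by
    have hm : Measurable fun p : (∀ i, α i) × (∀ i : S, β i) =>
        ∏ i : S, F i (p.1 i) (p.2 i) :=
      Finset.measurable_fun_prod _ fun i _ => (hF i).measurable_comp
        ((measurable_pi_apply _).comp measurable_fst) ((measurable_pi_apply _).comp measurable_snd)
    rw [integrable_prod_iff' (hm.norm.pow_const 2).aestronglyMeasurable]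
    simp_rw [norm_prod, ← Finset.prod_pow, norm_prod, norm_pow, norm_norm]
    have hi : ∀ (i : S) t, Integrable (fun x => ‖F i x t‖ ^ 2) (μ i) := fun i t =>
      (memLp_two_iff_integrable_sq_norm ((hF i).memLp_section t 2).1).1 ((hF i).memLp_section t 2)
    refine ⟨ae_of_all _ fun t => integrable_pi_prod_finset S (f := fun i x => ‖F i x (t i)‖ ^ 2)
      fun i => hi i (t i), ?_⟩
    have h1 : ∀ t : ∀ i : S, β i, ∫ x, ∏ i : S, ‖F i (x i) (t i)‖ ^ 2 ∂(Measure.pi μ)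
        = ∏ i : S, ∫ x, ‖F i x (t i)‖ ^ 2 ∂(μ i) := fun t =>
      integral_pi_prod_finset S fun i x => ‖F i x (t i)‖ ^ 2
    simp_rw [h1]
    exact Integrable.fintype_prod_dep (f := fun (i : S) t => ∫ x, ‖F i x t‖ ^ 2 ∂(μ i)) fun i =>
      (hF i).integrable_norm_sq.integral_prod_right
  integral_eq_zero := fun t => by
    rw [integral_pi_prod_finset S fun i x => F i x (t i)]
    obtain ⟨i, hi⟩ := hS
    exact Finset.prod_eq_zero (Finset.mem_univ ⟨i, hi⟩) ((hF i).integral_eq_zero _)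
  gram_im := fun x y => by
    simp_rw [map_prod, ← Finset.prod_mul_distrib]
    rw [integral_fintype_prod_eq_prod (fun (i : S) t => (starRingEnd ℂ) (F i (x i) t) * F i (y i) t)]
    simp_rw [(hF _).gram_eq_inner, ← Complex.ofReal_prod]
    exact Complex.ofReal_im _

lemma IsCenteredKernel.inner_prod (hF : ∀ i, IsCenteredKernel (μ i) (ρ i) (F i))
    {S : Finset (Fin n)} (hS : S.Nonempty) (x y : ∀ i, α i) :
    inner ℝ ((prod hF hS).toL2 x) ((prod hF hS).toL2 y)
      = ∏ i : S, inner ℝ ((hF i).toL2 (x i)) ((hF i).toL2 (y i)) := by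
  rw [← Complex.ofReal_inj, ← gram_eq_inner]
  simp_rw [map_prod, ← Finset.prod_mul_distrib]
  rw [integral_fintype_prod_eq_prod (fun (i : S) t => (starRingEnd ℂ) (F i (x i) t) * F i (y i) t)]
  simp_rw [(hF _).gram_eq_inner, ← Complex.ofReal_prod]

/-- On product vectors the covariance operator acts as a tensor product. Induction on `k` avoids
tensor products of spaces: `inner_covOp` turns one operator factor into an integral over an
intermediate point, and that integral factorises. -/
lemma IsCenteredKernel.inner_covOp_pow_prod
    [∀ i, SecondCountableTopology (Lp ℂ 2 (ρ i))]
    (hF : ∀ i, IsCenteredKernel (μ i) (ρ i) (F i)) {S : Finset (Fin n)} (hS : S.Nonempty)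
    [SecondCountableTopology (Lp ℂ 2 (Measure.pi fun i : S => ρ i))] (k : ℕ) (x y : ∀ i, α i) :
    inner ℝ ((prod hF hS).toL2 x)
        ((covOp (Measure.pi μ) (prod hF hS).toL2 ^ k) ((prod hF hS).toL2 y))
      = ∏ i : S, inner ℝ ((hF i).toL2 (x i)) ((covOp (μ i) (hF i).toL2 ^ k) ((hF i).toL2 (y i))) := by
  induction k generalizing x with
  | zero => simpa using inner_prod hF hS x y
  | succ k ih =>
    simp_rw [pow_succ', mul_apply_eq_comp]
    rw [inner_covOp (prod hF hS).memLp_toL2]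
    simp_rw [inner_covOp (hF _).memLp_toL2, inner_prod hF hS x, ih, ← Finset.prod_mul_distrib]
    exact integral_pi_prod_finset S fun i ω => inner ℝ ((hF i).toL2 (x i)) ((hF i).toL2 ω)
      * inner ℝ ((hF i).toL2 ω) ((covOp (μ i) (hF i).toL2 ^ k) ((hF i).toL2 (y i)))

lemma IsCenteredKernel.integral_inner_covOp_pow_prod
    [∀ i, SecondCountableTopology (Lp ℂ 2 (ρ i))]
    (hF : ∀ i, IsCenteredKernel (μ i) (ρ i) (F i)) {S : Finset (Fin n)} (hS : S.Nonempty)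
    [SecondCountableTopology (Lp ℂ 2 (Measure.pi fun i : S => ρ i))] (k : ℕ) :
    ∫ x, inner ℝ ((prod hF hS).toL2 x)
        ((covOp (Measure.pi μ) (prod hF hS).toL2 ^ k) ((prod hF hS).toL2 x)) ∂(Measure.pi μ)
      = ∏ i : S, ∫ x, inner ℝ ((hF i).toL2 x)
          ((covOp (μ i) (hF i).toL2 ^ k) ((hF i).toL2 x)) ∂(μ i) := by
  simp_rw [inner_covOp_pow_prod hF hS]
  exact integral_pi_prod_finset S fun i x => inner ℝ ((hF i).toL2 x)
    ((covOp (μ i) (hF i).toL2 ^ k) ((hF i).toL2 x))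

end ProductKernels

/-! ### Second moments of linear forms in independent copies. -/

section LinearForms

variable {α : Type*} [MeasurableSpace α] {μ : Measure α} [IsProbabilityMeasure μ] {f : α → ℂ}

lemma integral_mul_conj_eval {N : ℕ} (hf : MemLp f 2 μ) (h0 : ∫ y, f y ∂μ = 0) (j k : Fin N) :
    ∫ x : Fin N → α, f (x j) * (starRingEnd ℂ) (f (x k)) ∂(Measure.pi fun _ => μ)
      = if j = k then ((∫ y, ‖f y‖ ^ 2 ∂μ : ℝ) : ℂ) else 0 := by
  have hmap : ∀ j : Fin N, (Measure.pi fun _ : Fin N => μ).map (fun x => x j) = μ :=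
    fun j => (measurePreserving_eval (fun _ : Fin N => μ) j).map_eq
  have heval : ∀ (j : Fin N) {g : α → ℂ}, AEStronglyMeasurable g μ →
      ∫ x : Fin N → α, g (x j) ∂(Measure.pi fun _ => μ) = ∫ y, g y ∂μ := fun j g hg => by
    rw [← integral_map (φ := fun x : Fin N → α => x j) (measurable_pi_apply j).aemeasurable
      (by rwa [hmap j]), hmap j]
  have hc : AEStronglyMeasurable (fun y => (starRingEnd ℂ) (f y)) μ := hf.1.star
  split_ifs with h
  · subst h
    rw [heval j (g := fun y => f y * (starRingEnd ℂ) (f y)) (hf.1.mul hc), ← integral_complex_ofReal]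
    simp_rw [Complex.mul_conj', Complex.ofReal_pow]
  · have hind := ((iIndepFun_pi (μ := fun _ : Fin N => μ) (X := fun _ => f)
      fun _ => hf.1.aemeasurable).indepFun h).comp measurable_id
      (Complex.continuous_conj.measurable)
    have hae : ∀ (j : Fin N) {g : α → ℂ}, AEStronglyMeasurable g μ →
        AEStronglyMeasurable (fun x : Fin N → α => g (x j)) (Measure.pi fun _ => μ) :=
      fun j g hg => hg.comp_measurePreserving (measurePreserving_eval (fun _ : Fin N => μ) j)
    have := hind.integral_fun_mul_eq_mul_integral (hae j hf.1) (hae k hc)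
    simp only [Function.comp_def, id] at this
    rw [this, heval j hf.1, h0, zero_mul]

lemma integral_linearForm_mul_conj {N : ℕ} (hf : MemLp f 2 μ) (h0 : ∫ y, f y ∂μ = 0)
    (c e : Fin N → ℝ) :
    ∫ x : Fin N → α, (∑ j, (c j : ℂ) * f (x j)) * (starRingEnd ℂ) (∑ j, (e j : ℂ) * f (x j))
        ∂(Measure.pi fun _ => μ)
      = ((∑ j, c j * e j : ℝ) : ℂ) * ((∫ y, ‖f y‖ ^ 2 ∂μ : ℝ) : ℂ) := by
  have hL : ∀ j : Fin N, MemLp (fun x : Fin N → α => f (x j)) 2 (Measure.pi fun _ => μ) :=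
    fun j => hf.comp_measurePreserving (measurePreserving_eval (fun _ : Fin N => μ) j)
  have hint : ∀ j k : Fin N, Integrable
      (fun x : Fin N → α => f (x j) * (starRingEnd ℂ) (f (x k))) (Measure.pi fun _ => μ) :=
    fun j k => (hL j).integrable_mul (hL k).star
  have h1 : ∀ x : Fin N → α,
      (∑ j, (c j : ℂ) * f (x j)) * (starRingEnd ℂ) (∑ j, (e j : ℂ) * f (x j))
        = ∑ j, ∑ k, ((c j * e k : ℝ) : ℂ) * (f (x j) * (starRingEnd ℂ) (f (x k))) := fun x => by
    rw [map_sum, Finset.sum_mul_sum]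
    refine Finset.sum_congr rfl fun j _ => Finset.sum_congr rfl fun k _ => ?_
    rw [map_mul, Complex.conj_ofReal]
    push_cast
    ring
  simp_rw [h1]
  rw [integral_finsetSum _ fun j _ => integrable_finsetSum _ fun k _ => (hint j k).const_mul _]
  simp_rw [integral_finsetSum _ fun k _ => (hint _ k).const_mul _, integral_const_mul,
    integral_mul_conj_eval hf h0]
  simp [Finset.sum_mul]

end LinearForms

/-! ### Second moments of sums of products of linear forms. -/

section ProductFields

variable {n N : ℕ} {α β : Fin n → Type*} {ι : Type*} [Fintype ι]

/-- The field `∑_a ε_a ∏_{i ∈ S} ∑_j w_{a,j} F_i(x_{j,i}, t_i)`. -/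
def productField (F : ∀ i, α i → β i → ℂ) (S : Finset (Fin n)) (ε : ι → ℝ) (w : ι → Fin N → ℝ)
    (x : Fin N → ∀ i, α i) (t : ∀ i : S, β i) : ℂ :=
  ∑ a, (ε a : ℂ) * ∏ i : S, ∑ j, (w a j : ℂ) * F i (x j i) (t i)

variable [∀ i, MeasurableSpace (α i)] [∀ i, MeasurableSpace (β i)]
  {μ : ∀ i, Measure (α i)} {ρ : ∀ i, Measure (β i)} {F : ∀ i, α i → β i → ℂ}

lemma measurable_productField (hF : ∀ i, IsCenteredKernel (μ i) (ρ i) (F i)) (S : Finset (Fin n))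
    (ε : ι → ℝ) (w : ι → Fin N → ℝ) :
    Measurable fun p : (Fin N → ∀ i, α i) × (∀ i : S, β i) => productField F S ε w p.1 p.2 := by
  refine Finset.measurable_fun_sum _ fun a _ => Measurable.const_mul ?_ _
  refine Finset.measurable_fun_prod _ fun i _ => ?_
  refine Finset.measurable_fun_sum _ fun j _ => Measurable.const_mul ?_ _
  exact (hF i).measurable_comp (by fun_prop) (by fun_prop)

lemma memLp_productField [∀ i, SigmaFinite (ρ i)]
    (hF : ∀ i, IsCenteredKernel (μ i) (ρ i) (F i)) (S : Finset (Fin n))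
    (ε : ι → ℝ) (w : ι → Fin N → ℝ) (x : Fin N → ∀ i, α i) :
    MemLp (productField F S ε w x) 2 (Measure.pi fun i : S => ρ i) := by
  refine memLp_finsetSum _ fun a _ => MemLp.const_mul ?_ _
  have h1 : ∀ i : S, MemLp (fun t => ∑ j, (w a j : ℂ) * F i (x j i) t) 2 (ρ i) := fun i =>
    memLp_finsetSum _ fun j _ => ((hF i).memLp _).const_mul _
  have hm : AEStronglyMeasurable
      (fun t : ∀ i : S, β i => ∏ i : S, ∑ j, (w a j : ℂ) * F i (x j i) (t i))
      (Measure.pi fun i : S => ρ i) := by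
    refine Measurable.aestronglyMeasurable (Finset.measurable_fun_prod _ fun i _ => ?_)
    refine Finset.measurable_fun_sum _ fun j _ => Measurable.const_mul ?_ _
    exact (hF i).measurable_comp measurable_const (measurable_pi_apply i)
  rw [memLp_two_iff_integrable_sq_norm hm]
  simp_rw [norm_prod, ← Finset.prod_pow]
  exact Integrable.fintype_prod_dep
    (f := fun (i : S) t => ‖∑ j, (w a j : ℂ) * F i (x j i) t‖ ^ 2)
    fun i => (memLp_two_iff_integrable_sq_norm (h1 i).1).1 (h1 i)

variable [∀ i, IsProbabilityMeasure (μ i)]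

lemma memLp_productField_section (hF : ∀ i, IsCenteredKernel (μ i) (ρ i) (F i))
    (S : Finset (Fin n)) (ε : ι → ℝ) (w : ι → Fin N → ℝ) (t : ∀ i : S, β i) (p : ENNReal) :
    MemLp (fun x => productField F S ε w x t) p
      (Measure.pi fun _ : Fin N => Measure.pi μ) := by
  choose C hC using fun i => (hF i).bounded
  refine MemLp.of_bound ((measurable_productField hF S ε w).comp
    (measurable_id.prodMk measurable_const)).aestronglyMeasurable
    (∑ a, ‖(ε a : ℂ)‖ * ∏ i : S, ∑ j, ‖(w a j : ℂ)‖ * C i) (ae_of_all _ fun x => ?_)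
  refine (norm_sum_le _ _).trans (Finset.sum_le_sum fun a _ => ?_)
  rw [norm_mul, norm_prod]
  refine mul_le_mul_of_nonneg_left (Finset.prod_le_prod (fun _ _ => norm_nonneg _) fun i _ => ?_)
    (norm_nonneg _)
  refine (norm_sum_le _ _).trans (Finset.sum_le_sum fun j _ => ?_)
  rw [norm_mul]
  exact mul_le_mul_of_nonneg_left (hC _ _ _) (norm_nonneg _)

/-- In the expanded square, coordinate `i` contributes the covariance of two linear forms, `∑ w_a
w_b` times the second moment of `F i`. The weights do not depend on `i`, whence the power `S.card`.
-/
lemma integral_norm_sq_productField_section (hF : ∀ i, IsCenteredKernel (μ i) (ρ i) (F i))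
    (S : Finset (Fin n)) (ε : ι → ℝ) (w : ι → Fin N → ℝ) (t : ∀ i : S, β i) :
    ∫ x, ‖productField F S ε w x t‖ ^ 2 ∂(Measure.pi fun _ : Fin N => Measure.pi μ)
      = (∑ a, ∑ b, ε a * ε b * (∑ j, w a j * w b j) ^ S.card)
        * ∏ i : S, ∫ y, ‖F i y (t i)‖ ^ 2 ∂(μ i) := by
  let Q : ι → (Fin N → ∀ i, α i) → ℂ := fun a x => ∏ i : S, ∑ j, (w a j : ℂ) * F i (x j i) (t i)
  have hQL : ∀ a, MemLp (Q a) 2 (Measure.pi fun _ : Fin N => Measure.pi μ) := fun a => by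
    have := memLp_productField_section hF S (fun _ : Unit => (1 : ℝ)) (fun _ => w a) t 2
    simpa [productField, Q] using this
  have hint : ∀ a b, Integrable (fun x => Q a x * (starRingEnd ℂ) (Q b x))
      (Measure.pi fun _ : Fin N => Measure.pi μ) := fun a b => (hQL a).integrable_mul (hQL b).star
  have hQ : ∀ a b, ∫ x, Q a x * (starRingEnd ℂ) (Q b x)
      ∂(Measure.pi fun _ : Fin N => Measure.pi μ)
        = (((∑ j, w a j * w b j) ^ S.card * ∏ i : S, ∫ y, ‖F i y (t i)‖ ^ 2 ∂(μ i) : ℝ) : ℂ) := by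
    intro a b
    simp_rw [Q, map_prod, ← Finset.prod_mul_distrib]
    rw [integral_pi_pi_prod_finset μ S (f := fun i x => (∑ j, (w a j : ℂ) * F i (x j) (t i)) *
      (starRingEnd ℂ) (∑ j, (w b j : ℂ) * F i (x j) (t i)))]
    · simp_rw [integral_linearForm_mul_conj ((hF _).memLp_section _ 2) ((hF _).integral_eq_zero _)]
      rw [Finset.prod_mul_distrib, Finset.prod_const, Finset.card_univ, Fintype.card_coe]
      push_cast
      rfl
    · intro i
      have h1 : ∀ a, Measurable fun x : Fin N → α i => ∑ j, (w a j : ℂ) * F i (x j) (t i) :=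
        fun a => Finset.measurable_fun_sum _ fun j _ =>
          ((hF i).measurable_comp (measurable_pi_apply j) measurable_const).const_mul _
      exact (h1 a).mul (Complex.continuous_conj.measurable.comp (h1 b))
  rw [← Complex.ofReal_inj, ← integral_complex_ofReal]
  have h2 : ∀ x, ((‖productField F S ε w x t‖ ^ 2 : ℝ) : ℂ)
      = ∑ a, ∑ b, ((ε a * ε b : ℝ) : ℂ) * (Q a x * (starRingEnd ℂ) (Q b x)) := fun x => by
    rw [Complex.ofReal_pow, ← Complex.mul_conj', productField, map_sum, Finset.sum_mul_sum]
    refine Finset.sum_congr rfl fun a _ => Finset.sum_congr rfl fun b _ => ?_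
    rw [map_mul, Complex.conj_ofReal]
    push_cast
    ring
  simp_rw [h2]
  rw [integral_finsetSum _ fun j _ => integrable_finsetSum _ fun k _ => (hint j k).const_mul _]
  simp_rw [integral_finsetSum _ fun k _ => (hint _ k).const_mul _, integral_const_mul, hQ]
  rw [Finset.sum_mul]
  push_cast
  refine Finset.sum_congr rfl fun a _ => ?_
  rw [Finset.sum_mul]
  exact Finset.sum_congr rfl fun b _ => by ring

variable [∀ i, SigmaFinite (ρ i)]

lemma integrable_norm_sq_productField (hF : ∀ i, IsCenteredKernel (μ i) (ρ i) (F i))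
    (S : Finset (Fin n)) (ε : ι → ℝ) (w : ι → Fin N → ℝ) :
    Integrable (fun p : (Fin N → ∀ i, α i) × (∀ i : S, β i) => ‖productField F S ε w p.1 p.2‖ ^ 2)
      ((Measure.pi fun _ : Fin N => Measure.pi μ).prod (Measure.pi fun i : S => ρ i)) := by
  rw [integrable_prod_iff'
    ((measurable_productField hF S ε w).norm.pow_const 2).aestronglyMeasurable]
  refine ⟨ae_of_all _ fun t =>
    (memLp_two_iff_integrable_sq_norm (memLp_productField_section hF S ε w t 2).1).1
      (memLp_productField_section hF S ε w t 2), ?_⟩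
  simp_rw [norm_pow, norm_norm, integral_norm_sq_productField_section hF]
  exact (Integrable.fintype_prod_dep (f := fun (i : S) t => ∫ x, ‖F i x t‖ ^ 2 ∂(μ i)) fun i =>
    (hF i).integrable_norm_sq.integral_prod_right).const_mul _

lemma integral_integral_norm_sq_productField (hF : ∀ i, IsCenteredKernel (μ i) (ρ i) (F i))
    (S : Finset (Fin n)) (ε : ι → ℝ) (w : ι → Fin N → ℝ) :
    ∫ x, ∫ t, ‖productField F S ε w x t‖ ^ 2 ∂(Measure.pi fun i : S => ρ i)
        ∂(Measure.pi fun _ : Fin N => Measure.pi μ)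
      = (∑ a, ∑ b, ε a * ε b * (∑ j, w a j * w b j) ^ S.card)
        * ∫ t : ∀ i : S, β i, ∏ i : S, ∫ y, ‖F i y (t i)‖ ^ 2 ∂(μ i)
          ∂(Measure.pi fun i : S => ρ i) := by
  rw [integral_integral_swap (integrable_norm_sq_productField hF S ε w)]
  simp_rw [integral_norm_sq_productField_section hF]
  rw [integral_const_mul]

end ProductFields

/-! ### Negligibility of sample centering. -/

section SampleCentering

variable {n : ℕ} {α β : Fin n → Type*} {F : ∀ i, α i → β i → ℂ}

/-- The sum over the sample of the products of the kernels. -/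
def sumField {N : ℕ} (F : ∀ i, α i → β i → ℂ) (S : Finset (Fin n)) (x : Fin N → ∀ i, α i)
    (t : ∀ i : S, β i) : ℂ :=
  ∑ l, ∏ i : S, F i (x l i) (t i)

/-- The sum over the sample of the products of the kernels, centered at their sample means. -/
noncomputable def centeredSumField {N : ℕ} (F : ∀ i, α i → β i → ℂ) (S : Finset (Fin n))
    (x : Fin N → ∀ i, α i) (t : ∀ i : S, β i) : ℂ :=
  ∑ l, ∏ i : S, (F i (x l i) (t i) - 1 / (N : ℂ) * ∑ m, F i (x m i) (t i))

lemma sumField_eq_productField {N : ℕ} (S : Finset (Fin n)) :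
    sumField (N := N) F S = productField F S (fun _ : Fin N => 1)
      (fun l j => if l = j then 1 else 0) := by
  ext x t
  simp [sumField, productField, apply_ite Complex.ofReal]

lemma centeredSumField_eq_productField {N : ℕ} (S : Finset (Fin n)) :
    centeredSumField (N := N) F S = productField F S (fun _ : Fin N => 1)
      (fun l j => (if l = j then 1 else 0) - 1 / N) := by
  ext x t
  simp [centeredSumField, productField, apply_ite Complex.ofReal, sub_mul, Finset.sum_sub_distrib, Finset.mul_sum]

/-- Two copies of the index set with signs `±1` make the difference a single product field, so that
the second moment formula applies to it. -/
lemma centeredSumField_sub_sumField {N : ℕ} (S : Finset (Fin n)) (x : Fin N → ∀ i, α i)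
    (t : ∀ i : S, β i) :
    centeredSumField F S x t - sumField F S x t
      = productField F S (Sum.elim (fun _ : Fin N => 1) fun _ : Fin N => -1)
          (Sum.elim (fun l j => (if l = j then 1 else 0) - 1 / N) fun l j => if l = j then 1 else 0)
          x t := by
  rw [centeredSumField_eq_productField, sumField_eq_productField]
  simp [productField, Fintype.sum_sum_type, sub_eq_add_neg]

/-- The weights are the rows of the symmetric projection `1 - avgMatrix N`. -/
lemma sum_centered_indicator {N : ℕ} (hN : N ≠ 0) (l m : Fin N) :
    ∑ j, ((if l = j then (1 : ℝ) else 0) - 1 / N) * ((if m = j then 1 else 0) - 1 / N)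
      = (if l = m then 1 else 0) - 1 / N := by
  have : (N : ℝ) ≠ 0 := Nat.cast_ne_zero.2 hN
  rcases eq_or_ne l m with rfl | h
  · simp only [sub_mul, mul_sub, Finset.sum_sub_distrib, ite_mul, one_mul, zero_mul, mul_ite,
      mul_one, mul_zero, Finset.sum_ite_eq, Finset.mem_univ, if_true, Finset.sum_const,
      Finset.card_univ, Fintype.card_fin, nsmul_eq_mul]
    field_simp
    ring
  · simp only [sub_mul, mul_sub, Finset.sum_sub_distrib, ite_mul, one_mul, zero_mul, mul_ite,
      mul_one, mul_zero, Finset.sum_ite_eq, Finset.mem_univ, if_true, Finset.sum_const,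
      Finset.card_univ, Fintype.card_fin, nsmul_eq_mul, h, if_false]
    field_simp
    ring

/-- By Bernoulli's inequality each of the `N` diagonal terms is at most `s / N`. Each of the at most
`N²` others is at most `1 / N²` because `s ≥ 2`; for `s = 1` they would add up to order `N`. -/
lemma sum_pow_indicator_sub_le {N s : ℕ} (hN : N ≠ 0) (hs : 2 ≤ s) :
    ∑ l : Fin N, ∑ m : Fin N, ((if l = m then (1 : ℝ) else 0)
      - ((if l = m then (1 : ℝ) else 0) - 1 / N) ^ s) ≤ s + 1 := by
  have hN0 : (0 : ℝ) < N := by positivity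
  have hN1 : (1 : ℝ) ≤ N := by exact_mod_cast Nat.one_le_iff_ne_zero.2 hN
  have hle : 1 / (N : ℝ) ≤ 1 := by rw [div_le_one hN0]; exact hN1
  have h1 : ∀ l m : Fin N, ((if l = m then (1 : ℝ) else 0)
      - ((if l = m then (1 : ℝ) else 0) - 1 / N) ^ s) ≤ (if l = m then s / (N : ℝ) else 0) + 1 / N ^ 2 := by
    intro l m
    split_ifs with h
    · have := one_add_mul_le_pow (a := -(1 / (N : ℝ))) (by linarith) s
      have h2 : (0 : ℝ) ≤ 1 / N ^ 2 := by positivity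
      rw [← sub_eq_add_neg] at this
      have h3 : (s : ℝ) / N = s * (1 / N) := by ring
      rw [h3]
      linarith
    · have h2 : |(0 - 1 / (N : ℝ)) ^ s| ≤ 1 / N ^ 2 := by
        rw [abs_pow, zero_sub, abs_neg, abs_of_nonneg (by positivity), ← one_div_pow]
        exact pow_le_pow_of_le_one (by positivity) hle hs
      linarith [neg_abs_le ((0 - 1 / (N : ℝ)) ^ s)]
  refine (Finset.sum_le_sum fun l _ => Finset.sum_le_sum fun m _ => h1 l m).trans_eq ?_
  simp only [Finset.sum_add_distrib, Finset.sum_ite_eq, Finset.mem_univ, if_true, Finset.sum_const,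
    Finset.card_univ, Fintype.card_fin, nsmul_eq_mul]
  field_simp

/-- The cross term `2‖a - b‖‖b‖` is split by the weighted inequality of arithmetic and geometric
means. -/
lemma abs_norm_sq_sub_norm_sq_le {E : Type*} [SeminormedAddCommGroup E] (a b : E) {η : ℝ}
    (hη : 0 < η) : |‖a‖ ^ 2 - ‖b‖ ^ 2| ≤ (1 + η⁻¹) * ‖a - b‖ ^ 2 + η * ‖b‖ ^ 2 := by
  have h1 := abs_norm_sub_norm_le a b
  have h2 : ‖a‖ + ‖b‖ ≤ ‖a - b‖ + 2 * ‖b‖ := by linarith [le_abs_self (‖a‖ - ‖b‖)]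
  have h3 : |‖a‖ ^ 2 - ‖b‖ ^ 2| ≤ ‖a - b‖ * (‖a - b‖ + 2 * ‖b‖) := by
    rw [sq_sub_sq, abs_mul, mul_comm, abs_of_nonneg (add_nonneg (norm_nonneg a) (norm_nonneg b))]
    exact mul_le_mul h1 h2 (by positivity) (norm_nonneg _)
  refine h3.trans ?_
  have h4 : 0 ≤ η⁻¹ * (‖a - b‖ - η * ‖b‖) ^ 2 := by positivity
  have h5 : η⁻¹ * (‖a - b‖ - η * ‖b‖) ^ 2
      = η⁻¹ * ‖a - b‖ ^ 2 - 2 * ‖a - b‖ * ‖b‖ + η * ‖b‖ ^ 2 := by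
    field_simp
    ring
  linarith

variable [∀ i, MeasurableSpace (α i)] [∀ i, MeasurableSpace (β i)]
  {μ : ∀ i, Measure (α i)} {ρ : ∀ i, Measure (β i)}
  [∀ i, IsProbabilityMeasure (μ i)] [∀ i, SigmaFinite (ρ i)]

lemma integrable_integral_norm_sq_centeredSumField
    (hF : ∀ i, IsCenteredKernel (μ i) (ρ i) (F i)) (S : Finset (Fin n)) (N : ℕ) :
    Integrable (fun x : Fin N → ∀ i, α i =>
      ∫ t, ‖centeredSumField F S x t‖ ^ 2 ∂(Measure.pi fun i : S => ρ i))
      (Measure.pi fun _ : Fin N => Measure.pi μ) := by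
  rw [centeredSumField_eq_productField]
  exact (integrable_norm_sq_productField hF S _ _).integral_prod_left

lemma integrable_integral_norm_sq_sumField
    (hF : ∀ i, IsCenteredKernel (μ i) (ρ i) (F i)) (S : Finset (Fin n)) (N : ℕ) :
    Integrable (fun x : Fin N → ∀ i, α i =>
      ∫ t, ‖sumField F S x t‖ ^ 2 ∂(Measure.pi fun i : S => ρ i))
      (Measure.pi fun _ : Fin N => Measure.pi μ) := by
  rw [sumField_eq_productField]
  exact (integrable_norm_sq_productField hF S _ _).integral_prod_left

/-- Replacing the means by the sample means changes the squared norm of the summed field by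
`O(√N)` in mean. -/
lemma integral_abs_norm_sq_centeredSumField_sub_le
    (hF : ∀ i, IsCenteredKernel (μ i) (ρ i) (F i)) {S : Finset (Fin n)} (hS : 2 ≤ S.card) {N : ℕ}
    (hN : N ≠ 0) :
    ∫ x : Fin N → ∀ i, α i, |∫ t, ‖centeredSumField F S x t‖ ^ 2 ∂(Measure.pi fun i : S => ρ i)
        - ∫ t, ‖sumField F S x t‖ ^ 2 ∂(Measure.pi fun i : S => ρ i)|
        ∂(Measure.pi fun _ : Fin N => Measure.pi μ)
      ≤ (2 * S.card + 3) * (∫ t : ∀ i : S, β i, ∏ i : S, ∫ y, ‖F i y (t i)‖ ^ 2 ∂(μ i)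
          ∂(Measure.pi fun i : S => ρ i)) * √N := by
  set C := ∫ t : ∀ i : S, β i, ∏ i : S, ∫ y, ‖F i y (t i)‖ ^ 2 ∂(μ i)
          ∂(Measure.pi fun i : S => ρ i)
  have hC0 : 0 ≤ C := integral_nonneg fun t => Finset.prod_nonneg fun i _ =>
    integral_nonneg fun y => sq_nonneg _
  have hN1 : (1 : ℝ) ≤ N := by exact_mod_cast Nat.one_le_iff_ne_zero.2 hN
  have hsq : 1 ≤ √(N : ℝ) := Real.one_le_sqrt.2 hN1
  have hsq0 : 0 < √(N : ℝ) := by linarith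
  -- This choice balances the errors: `(1 + √N)(|S| + 1) C` from the difference and `η N C = √N C`
  -- from the sum. With `1 + √N ≤ 2√N` they add up to `(2|S| + 3) C √N`.
  set η := (√(N : ℝ))⁻¹
  have hη : 0 < η := inv_pos.2 hsq0
  have hD : ∀ x : Fin N → ∀ i, α i, MemLp
      (fun t => centeredSumField F S x t - sumField F S x t) 2 (Measure.pi fun i : S => ρ i) := by
    intro x
    simp_rw [centeredSumField_sub_sumField]
    exact memLp_productField hF S _ _ x
  have hsum : ∀ x : Fin N → ∀ i, α i, MemLp (sumField F S x) 2 (Measure.pi fun i : S => ρ i) :=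
    fun x => by rw [sumField_eq_productField]; exact memLp_productField hF S _ _ x
  have hcen : ∀ x : Fin N → ∀ i, α i,
      MemLp (centeredSumField F S x) 2 (Measure.pi fun i : S => ρ i) :=
    fun x => by rw [centeredSumField_eq_productField]; exact memLp_productField hF S _ _ x
  have hI : ∀ {f : (∀ i : S, β i) → ℂ}, MemLp f 2 (Measure.pi fun i : S => ρ i) →
      Integrable (fun t => ‖f t‖ ^ 2) (Measure.pi fun i : S => ρ i) :=
    fun h => (memLp_two_iff_integrable_sq_norm h.1).1 h
  have hpt : ∀ x : Fin N → ∀ i, α i,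
      |∫ t, ‖centeredSumField F S x t‖ ^ 2 ∂(Measure.pi fun i : S => ρ i)
        - ∫ t, ‖sumField F S x t‖ ^ 2 ∂(Measure.pi fun i : S => ρ i)|
      ≤ (1 + η⁻¹) * (∫ t, ‖centeredSumField F S x t - sumField F S x t‖ ^ 2
          ∂(Measure.pi fun i : S => ρ i))
        + η * ∫ t, ‖sumField F S x t‖ ^ 2 ∂(Measure.pi fun i : S => ρ i) := fun x => by
    rw [← integral_sub (hI (hcen x)) (hI (hsum x)), ← integral_const_mul, ← integral_const_mul,
      ← integral_add ((hI (hD x)).const_mul _) ((hI (hsum x)).const_mul _)]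
    refine abs_integral_le_integral_abs.trans (integral_mono ((hI (hcen x)).sub (hI (hsum x))).abs
      (((hI (hD x)).const_mul _).add ((hI (hsum x)).const_mul _)) fun t => ?_)
    exact abs_norm_sq_sub_norm_sq_le _ _ hη
  have hiD : Integrable (fun x : Fin N → ∀ i, α i =>
      ∫ t, ‖centeredSumField F S x t - sumField F S x t‖ ^ 2 ∂(Measure.pi fun i : S => ρ i))
      (Measure.pi fun _ : Fin N => Measure.pi μ) := by
    simp_rw [centeredSumField_sub_sumField]
    exact (integrable_norm_sq_productField hF S _ _).integral_prod_left
  have hi1 := integrable_integral_norm_sq_centeredSumField hF S N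
  have hi2 := integrable_integral_norm_sq_sumField hF S N
  refine (integral_mono (hi1.sub hi2).abs ((hiD.const_mul _).add (hi2.const_mul _)) hpt).trans ?_
  simp only [Pi.add_apply]
  rw [integral_add (hiD.const_mul _) (hi2.const_mul _), integral_const_mul, integral_const_mul]
  have hs0 : S.card ≠ 0 := by omega
  have e2 : ∫ x : Fin N → ∀ i, α i, ∫ t, ‖sumField F S x t‖ ^ 2 ∂(Measure.pi fun i : S => ρ i)
      ∂(Measure.pi fun _ : Fin N => Measure.pi μ) = N * C := by
    rw [sumField_eq_productField, integral_integral_norm_sq_productField hF]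
    congr 1
    simp [ite_pow, hs0]
  have e1 : ∫ x : Fin N → ∀ i, α i, ∫ t, ‖centeredSumField F S x t - sumField F S x t‖ ^ 2
      ∂(Measure.pi fun i : S => ρ i) ∂(Measure.pi fun _ : Fin N => Measure.pi μ)
      ≤ (S.card + 1) * C := by
    simp_rw [centeredSumField_sub_sumField]
    rw [integral_integral_norm_sq_productField hF]
    refine mul_le_mul_of_nonneg_right (le_trans (le_of_eq ?_) (sum_pow_indicator_sub_le hN hS)) hC0
    -- With `δ` the indicator of `l = m`, the centered block and the two mixed blocks contribute `(1
    -- - 2)(δ - 1/N)^|S|` and the plain block `δ`.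
    simp only [Fintype.sum_sum_type, Sum.elim_inl, Sum.elim_inr, sum_centered_indicator hN,
      ← Finset.sum_add_distrib]
    refine Finset.sum_congr rfl fun l _ => Finset.sum_congr rfl fun m _ => ?_
    have h1 : ∀ l m : Fin N, ∑ j, ((if l = j then (1 : ℝ) else 0) - 1 / N) * (if m = j then 1 else 0)
        = (if l = m then 1 else 0) - 1 / N := fun l m => by simp
    have h2 : ∀ l m : Fin N, ∑ j, (if l = j then (1 : ℝ) else 0) * ((if m = j then 1 else 0) - 1 / N)
        = (if l = m then 1 else 0) - 1 / N := fun l m => by simp [eq_comm]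
    have h3 : ∀ l m : Fin N, ∑ j, (if l = j then (1 : ℝ) else 0) * (if m = j then 1 else 0)
        = (if l = m then 1 else 0) := fun l m => by simp
    rw [h1, h2, h3, ite_pow, one_pow, zero_pow hs0]
    ring
  rw [e2]
  have h6 : η * (N * C) = √N * C := by
    rw [← mul_assoc]
    congr 1
    rw [inv_mul_eq_iff_eq_mul₀ hsq0.ne']
    exact (Real.mul_self_sqrt (by positivity)).symm
  rw [h6, inv_inv]
  have h7 : (1 + √(N : ℝ)) * (∫ x : Fin N → ∀ i, α i, ∫ t,
      ‖centeredSumField F S x t - sumField F S x t‖ ^ 2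
      ∂(Measure.pi fun i : S => ρ i) ∂(Measure.pi fun _ : Fin N => Measure.pi μ))
      ≤ (2 * √N) * ((S.card + 1) * C) := by
    refine mul_le_mul (by linarith) e1 (integral_nonneg fun x => integral_nonneg fun t => sq_nonneg _)
      (by positivity)
  linarith

end SampleCentering

/-! ### Transport along measure preserving maps. -/

section ChangeOfVariables

variable {Ω Ω' : Type*} [MeasurableSpace Ω] [MeasurableSpace Ω'] {P : Measure Ω} {P' : Measure Ω'}

lemma integral_comp_measurePreserving {E : Type*} [NormedAddCommGroup E] [NormedSpace ℝ E]
    {φ : Ω → Ω'} (hφ : MeasurePreserving φ P P') {g : Ω' → E} (hg : AEStronglyMeasurable g P') :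
    ∫ ω, g (φ ω) ∂P = ∫ x, g x ∂P' := by
  rw [← hφ.map_eq, integral_map hφ.measurable.aemeasurable (by rwa [hφ.map_eq])]

variable {H : Type*} [NormedAddCommGroup H] [InnerProductSpace ℝ H]

lemma covOp_comp_measurePreserving {φ : Ω → Ω'} (hφ : MeasurePreserving φ P P') {V : Ω' → H}
    (hV : AEStronglyMeasurable V P') : covOp P (fun ω => V (φ ω)) = covOp P' V :=
  integral_comp_measurePreserving hφ (continuous_rankOne_self.comp_aestronglyMeasurable hV)

lemma integral_inner_covOp_pow_comp_measurePreserving {φ : Ω → Ω'} (hφ : MeasurePreserving φ P P')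
    {V : Ω' → H} (hV : AEStronglyMeasurable V P') (k : ℕ) :
    ∫ ω, inner ℝ (V (φ ω)) ((covOp P (fun ω => V (φ ω)) ^ k) (V (φ ω))) ∂P
      = ∫ x, inner ℝ (V x) ((covOp P' V ^ k) (V x)) ∂P' := by
  rw [covOp_comp_measurePreserving hφ hV]
  exact integral_comp_measurePreserving hφ
    (g := fun x => inner ℝ (V x) ((covOp P' V ^ k) (V x)))
    (hV.inner ((covOp P' V ^ k).continuous.comp_aestronglyMeasurable hV))

/-- The first `N` coordinates of a sequence of independent elements. -/
lemma measurePreserving_fin_infinitePi (P : Measure Ω) [IsProbabilityMeasure P] (N : ℕ) :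
    MeasurePreserving (fun (ω : ℕ → Ω) (l : Fin N) => ω l) (Measure.infinitePi fun _ => P)
      (Measure.pi fun _ => P) where
  measurable := by fun_prop
  map_eq := by
    have h := (iIndepFun_infinitePi (P := fun _ : ℕ => P) (X := fun _ => id)
      fun _ => measurable_id).precomp (g := fun l : Fin N => (l : ℕ)) Fin.val_injective
    rw [iIndepFun_iff_map_fun_eq_pi_map fun l => Measurable.aemeasurable (by fun_prop)] at h
    simp only [id] at h
    rw [h]
    congr with l : 1
    exact Measure.infinitePi_map_eval (fun _ : ℕ => P) l

end ChangeOfVariables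

/-! ### Limit law of the sample-centered field. -/

section LimitLaw

variable {n : ℕ} {α β : Fin n → Type*} {F : ∀ i, α i → β i → ℂ}
  [∀ i, MeasurableSpace (α i)] [∀ i, MeasurableSpace (β i)]
  {μ : ∀ i, Measure (α i)} {ρ : ∀ i, Measure (β i)}
  [∀ i, IsProbabilityMeasure (μ i)] [∀ i, SigmaFinite (ρ i)]

lemma IsCenteredKernel.norm_sq_normalized_sum_toL2
    (hF : ∀ i, IsCenteredKernel (μ i) (ρ i) (F i)) {S : Finset (Fin n)} (hS : S.Nonempty)
    {N : ℕ} (x : Fin N → ∀ i, α i) :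
    ‖(√(N : ℝ))⁻¹ • ∑ l, (prod hF hS).toL2 (x l)‖ ^ 2
      = (N : ℝ)⁻¹ * ∫ t, ‖sumField F S x t‖ ^ 2 ∂(Measure.pi fun i : S => ρ i) := by
  have hsum : MemLp (sumField F S x) 2 (Measure.pi fun i : S => ρ i) := by
    rw [sumField_eq_productField]
    exact memLp_productField hF S _ _ x
  have h1 : ∑ l, (prod hF hS).toL2 (x l) = hsum.toLp (sumField F S x) := by
    refine Lp.ext ?_
    filter_upwards [Lp.coeFn_fun_finsetSum Finset.univ fun l => (prod hF hS).toL2 (x l),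
      hsum.coeFn_toLp, ae_all_iff.2 fun l => ((prod hF hS).memLp (x l)).coeFn_toLp] with t h2 h3 h4
    rw [h2, h3]
    exact Finset.sum_congr rfl fun l _ => h4 l
  rw [h1, norm_smul, mul_pow, norm_sq_toLp, norm_inv, Real.norm_of_nonneg (Real.sqrt_nonneg _),
    inv_pow, Real.sq_sqrt (by positivity)]

/-- The Hilbert space limit theorem applies to the product kernel, whose power traces are the
products `τ k`; sample centering changes the statistic by `O(N^(-1/2))` in `L¹` and leaves the limit
unchanged. -/
theorem exists_limit_law_centeredSumField
    [∀ i, SecondCountableTopology (Lp ℂ 2 (ρ i))]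
    (hF : ∀ i, IsCenteredKernel (μ i) (ρ i) (F i)) {S : Finset (Fin n)} (hS : 2 ≤ S.card)
    [SecondCountableTopology (Lp ℂ 2 (Measure.pi fun i : S => ρ i))] {τ : ℕ → ℝ}
    (hτ : ∀ k, τ k = ∏ i : S, ∫ x, inner ℝ ((hF i).toL2 x)
      ((covOp (μ i) (hF i).toL2 ^ k) ((hF i).toL2 x)) ∂(μ i)) :
    ∃ ν : Measure ℝ, IsProbabilityMeasure ν ∧
      (∀ f : ℝ →ᵇ ℝ, Tendsto (fun N : ℕ => ∫ x : Fin N → ∀ i, α i,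
        f ((N : ℝ)⁻¹ * ∫ t, ‖centeredSumField F S x t‖ ^ 2 ∂(Measure.pi fun i : S => ρ i))
        ∂(Measure.pi fun _ => Measure.pi μ)) atTop (𝓝 (∫ y, f y ∂ν))) ∧
      MemLp (fun y : ℝ => y) 4 ν ∧ ∫ y, y ∂ν = τ 0 ∧ variance (fun y : ℝ => y) ν = 2 * τ 1 ∧
      ∫ y, (y - ∫ z, z ∂ν) ^ 3 ∂ν = 8 * τ 2 ∧
      ∫ y, (y - ∫ z, z ∂ν) ^ 4 ∂ν = 48 * τ 3 + 12 * τ 1 ^ 2 := by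
  have hS' : S.Nonempty := Finset.card_pos.1 (by omega)
  let _ : MeasurableSpace (Lp ℂ 2 (Measure.pi fun i : S => ρ i)) := borel _
  have : BorelSpace (Lp ℂ 2 (Measure.pi fun i : S => ρ i)) := ⟨rfl⟩
  set hV := IsCenteredKernel.prod hF hS'
  -- All sample sizes are realised on one sequence space; `measurePreserving_fin_infinitePi` returns
  -- to `N` coordinates.
  set Q : Measure (ℕ → ∀ i, α i) := Measure.infinitePi fun _ => Measure.pi μ
  have hmp : ∀ l : ℕ, MeasurePreserving (fun ω : ℕ → ∀ i, α i => ω l) Q (Measure.pi μ) :=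
    fun l => measurePreserving_eval_infinitePi (fun _ : ℕ => Measure.pi μ) l
  have hVm : Measurable hV.toL2 := hV.stronglyMeasurable_toL2.measurable
  have hmap : ∀ l : ℕ, Q.map (fun ω => hV.toL2 (ω l)) = (Measure.pi μ).map hV.toL2 := fun l =>
    (Measure.map_map hVm (hmp l).measurable).symm.trans (congrArg (Measure.map _) (hmp l).map_eq)
  have hmean : ∀ h, ∫ ω, inner ℝ (hV.toL2 (ω 0)) h ∂Q = 0 := fun h => by
    rw [integral_comp_measurePreserving (hmp 0) (g := fun x => inner ℝ (hV.toL2 x) h)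
      (hV.memLp_toL2.1.inner aestronglyMeasurable_const), hV.integral_inner_toL2]
  obtain ⟨ν, hν, hlim, hrest⟩ := exists_limit_law_norm_sq (P := Q) (V := fun l ω => hV.toL2 (ω l))
    (iIndepFun_infinitePi (P := fun _ : ℕ => Measure.pi μ) (X := fun _ => hV.toL2) fun _ => hVm)
    (fun l => ⟨(hVm.comp (hmp l).measurable).aemeasurable, (hVm.comp (hmp 0).measurable).aemeasurable,
      (hmap l).trans (hmap 0).symm⟩)
    (hV.memLp_toL2.comp_measurePreserving (hmp 0)) hmean (τ := τ) (fun k => by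
      rw [hτ, ← IsCenteredKernel.integral_inner_covOp_pow_prod hF hS' k]
      exact (integral_inner_covOp_pow_comp_measurePreserving (hmp 0) hV.memLp_toL2.1 k).symm)
  refine ⟨ν, hν, ?_, hrest⟩
  -- replace the summed field by its centered version
  let A : ℕ → (ℕ → ∀ i, α i) → ℝ := fun N ω => (N : ℝ)⁻¹ *
    ∫ t, ‖centeredSumField F S (fun l : Fin N => ω l) t‖ ^ 2 ∂(Measure.pi fun i : S => ρ i)
  let B : ℕ → (ℕ → ∀ i, α i) → ℝ := fun N ω => (N : ℝ)⁻¹ *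
    ∫ t, ‖sumField F S (fun l : Fin N => ω l) t‖ ^ 2 ∂(Measure.pi fun i : S => ρ i)
  have hB : ∀ N ω, B N ω = ‖(√(N : ℝ))⁻¹ • ∑ l ∈ Finset.range N, hV.toL2 (ω l)‖ ^ 2 := fun N ω => by
    rw [Finset.sum_range fun l => hV.toL2 (ω l)]
    exact (IsCenteredKernel.norm_sq_normalized_sum_toL2 hF hS' fun l : Fin N => ω l).symm
  have hfin := fun N => measurePreserving_fin_infinitePi (Measure.pi μ) N
  have hAi : ∀ N, Integrable (A N) Q := fun N => ((hfin N).integrable_comp_of_integrable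
    (integrable_integral_norm_sq_centeredSumField hF S N)).const_mul _
  have hBi : ∀ N, Integrable (B N) Q := fun N => ((hfin N).integrable_comp_of_integrable
    (integrable_integral_norm_sq_sumField hF S N)).const_mul _
  set C := ∫ t : ∀ i : S, β i, ∏ i : S, ∫ y, ‖F i y (t i)‖ ^ 2 ∂(μ i)
    ∂(Measure.pi fun i : S => ρ i)
  have hAB : ∀ N, N ≠ 0 → ∫ ω, |A N ω - B N ω| ∂Q ≤ (2 * S.card + 3) * C * (√(N : ℝ))⁻¹ := by
    intro N hN
    have h1 : ∀ ω, |A N ω - B N ω| = (N : ℝ)⁻¹ *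
        |∫ t, ‖centeredSumField F S (fun l : Fin N => ω l) t‖ ^ 2 ∂(Measure.pi fun i : S => ρ i)
        - ∫ t, ‖sumField F S (fun l : Fin N => ω l) t‖ ^ 2 ∂(Measure.pi fun i : S => ρ i)| :=
      fun ω => by simp only [A, B]; rw [← mul_sub, abs_mul, abs_of_nonneg (by positivity)]
    simp_rw [h1]
    rw [integral_const_mul, integral_comp_measurePreserving (hfin N)
      (g := fun x : Fin N → ∀ i, α i =>
        |∫ t, ‖centeredSumField F S x t‖ ^ 2 ∂(Measure.pi fun i : S => ρ i)
        - ∫ t, ‖sumField F S x t‖ ^ 2 ∂(Measure.pi fun i : S => ρ i)|)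
      ((integrable_integral_norm_sq_centeredSumField hF S N).sub
        (integrable_integral_norm_sq_sumField hF S N)).abs.aestronglyMeasurable]
    refine (mul_le_mul_of_nonneg_left
      (integral_abs_norm_sq_centeredSumField_sub_le hF hS hN) (by positivity)).trans_eq ?_
    have h2 : (N : ℝ)⁻¹ * √N = (√N)⁻¹ := by
      rw [inv_mul_eq_div, Real.sqrt_div_self', one_div]
    rw [mul_left_comm, h2]
  have hA : TendstoInDistribution A atTop (fun y : ℝ => y) (fun _ => Q) ν := by
    refine tendstoInDistribution_of_lipschitz (fun N => (hAi N).1.aemeasurable) aemeasurable_id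
      fun f L hL => ?_
    have h0 : Tendsto (fun N => ∫ ω, f (A N ω) ∂Q - ∫ ω, f (B N ω) ∂Q) atTop (𝓝 0) := by
      have hb : Tendsto (fun N : ℕ => L * ((2 * S.card + 3) * C * (√(N : ℝ))⁻¹)) atTop (𝓝 0) := by
        have := ((tendsto_inv_atTop_zero.comp (Real.tendsto_sqrt_atTop.comp
          tendsto_natCast_atTop_atTop)).const_mul ((2 * S.card + 3) * C)).const_mul (L : ℝ)
        simpa using this
      refine squeeze_zero_norm' ?_ hb
      filter_upwards [eventually_ne_atTop 0] with N hN
      refine (abs_integral_comp_sub_le_of_lipschitz f hL (hAi N).1.aemeasurable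
        (hBi N).1.aemeasurable ((hAi N).sub (hBi N))).trans ?_
      exact mul_le_mul_of_nonneg_left (hAB N hN) L.2
    have := h0.add (hlim f)
    simp only [← hB, sub_add_cancel, zero_add] at this
    exact this
  intro f
  refine (tendsto_integral_of_tendstoInDistribution hA f).congr fun N => ?_
  exact integral_comp_measurePreserving (hfin N) (g := fun x : Fin N → ∀ i, α i =>
    f ((N : ℝ)⁻¹ * ∫ t, ‖centeredSumField F S x t‖ ^ 2 ∂(Measure.pi fun i : S => ρ i)))
    (f.continuous.comp_aestronglyMeasurable
      ((integrable_integral_norm_sq_centeredSumField hF S N).const_mul _).1)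

end LimitLaw

/-! ### Characters, the function `psi` and the kernel conditions. -/

section Characters

variable {k : ℕ}

/-- The character `t ↦ exp (𝐢 x · t)`. -/
noncomputable def character (x t : Euc k) : ℂ := Complex.exp (Complex.I * (inner ℝ x t : ℝ))

lemma continuous_character : Continuous fun p : Euc k × Euc k => character p.1 p.2 := by
  unfold character
  fun_prop

lemma norm_character (x t : Euc k) : ‖character x t‖ = 1 := by
  rw [character, mul_comm, Complex.norm_exp_ofReal_mul_I]

lemma conj_character (x t : Euc k) : (starRingEnd ℂ) (character x t) = character x (-t) := by
  rw [character, character, ← Complex.exp_conj]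
  simp

lemma norm_sq_character_sub (x y t : Euc k) :
    ‖character x t - character y t‖ ^ 2 = 2 * (1 - Real.cos (inner ℝ (x - y) t)) := by
  have h : ∀ z : Euc k, character z t
      = ⟨Real.cos (inner ℝ z t), Real.sin (inner ℝ z t)⟩ := fun z => by
    rw [character, mul_comm]
    refine Complex.ext ?_ ?_
    · rw [Complex.exp_ofReal_mul_I_re]
    · rw [Complex.exp_ofReal_mul_I_im]
  rw [h, h, ← Complex.normSq_eq_norm_sq, Complex.normSq_apply, inner_sub_left, Real.cos_sub]
  simp only [Complex.sub_re, Complex.sub_im]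
  nlinarith [Real.sin_sq_add_cos_sq (inner ℝ x t), Real.sin_sq_add_cos_sq (inner ℝ y t)]

/-- The triangle inequality for characters through `character 0`, with `(a + b)² ≤ 2a² + 2b²`. -/
lemma one_sub_cos_inner_sub_le (x y t : Euc k) :
    1 - Real.cos (inner ℝ (x - y) t)
      ≤ 2 * (1 - Real.cos (inner ℝ x t)) + 2 * (1 - Real.cos (inner ℝ y t)) := by
  have h1 := norm_sq_character_sub x y t
  have h2 := norm_sq_character_sub x 0 t
  have h3 := norm_sq_character_sub y 0 t
  have h4 := norm_sub_le_norm_sub_add_norm_sub (character x t) (character 0 t) (character y t)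
  rw [norm_sub_rev (character 0 t)] at h4
  rw [sub_zero] at h2 h3
  nlinarith [norm_nonneg (character x t - character y t),
    sq_nonneg (‖character x t - character 0 t‖ - ‖character y t - character 0 t‖)]

variable {ρ : Measure (Euc k)}

lemma integrable_one_sub_cos_inner (hρ : ∫⁻ t, ENNReal.ofReal (min 1 (‖t‖ ^ 2)) ∂ρ < ⊤)
    (x : Euc k) : Integrable (fun t => 1 - Real.cos (inner ℝ x t)) ρ := by
  have hm : Integrable (fun t : Euc k => min 1 (‖t‖ ^ 2)) ρ := by
    refine ⟨Continuous.aestronglyMeasurable (by fun_prop), ?_⟩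
    rw [hasFiniteIntegral_iff_ofReal (ae_of_all _ fun t => by positivity)]
    exact hρ
  -- The integrand is at most 2 where `‖t‖ ≥ 1` and at most `‖x‖²‖t‖² / 2` where `‖t‖ ≤ 1`.
  refine (hm.const_mul (2 + ‖x‖ ^ 2)).mono' (Continuous.aestronglyMeasurable (by fun_prop))
    (ae_of_all _ fun t => ?_)
  rw [Real.norm_of_nonneg (sub_nonneg.2 (Real.cos_le_one _))]
  rcases le_total 1 (‖t‖ ^ 2) with h | h
  · rw [min_eq_left h]
    nlinarith [Real.neg_one_le_cos (inner ℝ x t), sq_nonneg ‖x‖]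
  · rw [min_eq_right h]
    have h1 := Real.one_sub_sq_div_two_le_cos (x := inner ℝ x t)
    have h2 : (inner ℝ x t) ^ 2 ≤ (‖x‖ * ‖t‖) ^ 2 := by
      rw [← sq_abs (inner ℝ x t)]
      exact pow_le_pow_left₀ (abs_nonneg _) (abs_real_inner_le_norm x t) 2
    nlinarith [sq_nonneg ‖t‖, sq_nonneg (‖x‖ * ‖t‖)]

lemma measurable_psi [SFinite ρ] : Measurable (psi ρ) := by
  refine StronglyMeasurable.measurable (StronglyMeasurable.integral_prod_right
    (f := fun x (t : Euc k) => 1 - Real.cos (inner ℝ x t)) ?_)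
  exact Continuous.stronglyMeasurable (by unfold Function.uncurry; fun_prop)

lemma psi_nonneg (x : Euc k) : 0 ≤ psi ρ x :=
  integral_nonneg fun _ => sub_nonneg.2 (Real.cos_le_one _)

lemma psi_sub_le (hρ : ∫⁻ t, ENNReal.ofReal (min 1 (‖t‖ ^ 2)) ∂ρ < ⊤) (x y : Euc k) :
    psi ρ (x - y) ≤ 2 * psi ρ x + 2 * psi ρ y := by
  have h := integrable_one_sub_cos_inner hρ
  simp only [psi]
  rw [← integral_const_mul, ← integral_const_mul,
    ← integral_add ((h x).const_mul _) ((h y).const_mul _)]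
  exact integral_mono (h _) (((h x).const_mul _).add ((h y).const_mul _))
    fun t => one_sub_cos_inner_sub_le x y t

variable {μ : Measure (Euc k)}

/-- The character centered at its mean. -/
noncomputable def centeredCharacter (μ : Measure (Euc k)) (x t : Euc k) : ℂ :=
  character x t - ∫ y, character y t ∂μ

/-- The mean cancels in differences. Hence the distance matrix is a matrix of half squared Hilbert
distances. -/
lemma half_norm_sq_toL2_centeredCharacter_sub
    (h : IsCenteredKernel μ ρ (centeredCharacter μ)) (x y : Euc k) :
    1 / 2 * ‖h.toL2 x - h.toL2 y‖ ^ 2 = psi ρ (x - y) := by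
  rw [IsCenteredKernel.toL2, IsCenteredKernel.toL2, ← MemLp.toLp_sub, norm_sq_toLp, psi,
    ← integral_const_mul]
  congr with t
  have : (centeredCharacter μ x - centeredCharacter μ y) t = character x t - character y t := by
    simp [centeredCharacter]
  rw [this, norm_sq_character_sub]
  ring

variable [IsProbabilityMeasure μ]

lemma memLp_character_left (t : Euc k) (p : ENNReal) : MemLp (fun x => character x t) p μ :=
  MemLp.of_bound (continuous_character.comp (by fun_prop : Continuous fun x : Euc k =>
    (x, t))).aestronglyMeasurable 1 (ae_of_all _ fun x => (norm_character x t).le)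

lemma measurable_centeredCharacter :
    Measurable (Function.uncurry (centeredCharacter μ)) := by
  refine continuous_character.measurable.sub (Measurable.comp (g := fun t : Euc k =>
    ∫ y, character y t ∂μ) ?_ measurable_snd)
  exact (StronglyMeasurable.integral_prod_left (f := fun y t : Euc k => character y t)
    continuous_character.stronglyMeasurable).measurable

lemma integral_centeredCharacter (t : Euc k) : ∫ x, centeredCharacter μ x t ∂μ = 0 := by
  simp only [centeredCharacter]
  rw [integral_sub ((memLp_character_left t 1).integrable le_rfl) (integrable_const _)]
  simp

lemma norm_centeredCharacter_le (x t : Euc k) : ‖centeredCharacter μ x t‖ ≤ 2 := by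
  refine (norm_sub_le _ _).trans ?_
  have h : ‖∫ y, character y t ∂μ‖ ≤ 1 :=
    (norm_integral_le_of_norm_le_const (ae_of_all _ fun y => (norm_character y t).le)).trans
      (by simp)
  linarith [norm_character x t]

/-- Decomposition of the mean squared distance to a fixed character. -/
lemma integral_norm_sq_character_sub (x t : Euc k) :
    ∫ y, ‖character x t - character y t‖ ^ 2 ∂μ
      = ‖centeredCharacter μ x t‖ ^ 2 + ∫ y, ‖centeredCharacter μ y t‖ ^ 2 ∂μ := by
  have hc : MemLp (fun y => centeredCharacter μ y t) 2 μ :=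
    (memLp_character_left t 2).sub (memLp_const _)
  have h1 : ∀ y, ‖character x t - character y t‖ ^ 2 = ‖centeredCharacter μ x t‖ ^ 2
      - 2 * inner ℝ (centeredCharacter μ x t) (centeredCharacter μ y t)
      + ‖centeredCharacter μ y t‖ ^ 2 := fun y => by
    rw [← norm_sub_sq_real]
    simp [centeredCharacter]
  have hi : Integrable (fun y => centeredCharacter μ y t) μ := hc.integrable (by norm_num)
  have hs : Integrable (fun y => ‖centeredCharacter μ x t‖ ^ 2
      - 2 * inner ℝ (centeredCharacter μ x t) (centeredCharacter μ y t)) μ :=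
    (integrable_const _).sub ((hi.const_inner _).const_mul _)
  simp_rw [h1]
  rw [integral_add hs
      ((memLp_two_iff_integrable_sq_norm hc.1).1 hc),
    integral_sub (integrable_const _) ((hi.const_inner _).const_mul _), integral_const_mul,
    integral_inner hi, integral_centeredCharacter]
  simp

lemma integrable_one_sub_cos_prod [SFinite ρ]
    (hρ : ∫⁻ t, ENNReal.ofReal (min 1 (‖t‖ ^ 2)) ∂ρ < ⊤) (hψ : Integrable (psi ρ) μ) (x : Euc k) :
    Integrable (fun p : Euc k × Euc k => 1 - Real.cos (inner ℝ (x - p.1) p.2)) (μ.prod ρ) := by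
  rw [integrable_prod_iff (Continuous.aestronglyMeasurable (by fun_prop))]
  refine ⟨ae_of_all _ fun y => integrable_one_sub_cos_inner hρ (x - y), ?_⟩
  have h : ∀ y, ∫ t, ‖1 - Real.cos (inner ℝ (x - y) t)‖ ∂ρ = psi ρ (x - y) := fun y =>
    integral_congr_ae (ae_of_all _ fun t =>
      Real.norm_of_nonneg (sub_nonneg.2 (Real.cos_le_one _)))
  simp_rw [h]
  refine ((integrable_const (2 * psi ρ x)).add (hψ.const_mul 2)).mono'
    (measurable_psi.comp (by fun_prop : Measurable fun y => x - y)).aestronglyMeasurable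
    (ae_of_all _ fun y => ?_)
  rw [Real.norm_of_nonneg (psi_nonneg _)]
  exact psi_sub_le hρ x y

lemma integrable_integral_norm_sq_character_sub [SFinite ρ]
    (hρ : ∫⁻ t, ENNReal.ofReal (min 1 (‖t‖ ^ 2)) ∂ρ < ⊤) (hψ : Integrable (psi ρ) μ) (x : Euc k) :
    Integrable (fun t => ∫ y, ‖character x t - character y t‖ ^ 2 ∂μ) ρ := by
  simp_rw [norm_sq_character_sub]
  exact ((integrable_one_sub_cos_prod hρ hψ x).const_mul 2).integral_prod_right

/-- For infinite `ρ` a character is not in `L²(ρ)`, but differences of characters are. Both terms of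
`integral_norm_sq_character_sub` are nonnegative, so each is dominated by the mean squared
difference, integrable because `psi` has finite mean. -/
lemma isCenteredKernel_centeredCharacter [SigmaFinite ρ] [ρ.IsNegInvariant]
    (hρ : ∫⁻ t, ENNReal.ofReal (min 1 (‖t‖ ^ 2)) ∂ρ < ⊤) (hψ : Integrable (psi ρ) μ) :
    IsCenteredKernel μ ρ (centeredCharacter μ) where
  measurable := measurable_centeredCharacter
  bounded := ⟨2, norm_centeredCharacter_le⟩
  memLp := fun x => by
    have hm : AEStronglyMeasurable (centeredCharacter μ x) ρ :=
      (measurable_centeredCharacter.comp (measurable_const.prodMk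
        measurable_id)).aestronglyMeasurable
    rw [memLp_two_iff_integrable_sq_norm hm]
    refine (integrable_integral_norm_sq_character_sub hρ hψ x).mono' (hm.norm.pow 2)
      (ae_of_all _ fun t => ?_)
    rw [norm_pow, norm_norm, integral_norm_sq_character_sub]
    exact le_add_of_nonneg_right (integral_nonneg fun y => sq_nonneg _)
  integrable_norm_sq := by
    have hm : Measurable fun p : Euc k × Euc k => ‖centeredCharacter μ p.1 p.2‖ ^ 2 :=
      measurable_centeredCharacter.norm.pow_const 2
    rw [integrable_prod_iff' hm.aestronglyMeasurable]
    refine ⟨ae_of_all _ fun t => ?_, ?_⟩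
    · have hc : MemLp (fun y => centeredCharacter μ y t) 2 μ :=
        (memLp_character_left t 2).sub (memLp_const _)
      exact (memLp_two_iff_integrable_sq_norm hc.1).1 hc
    · simp_rw [norm_pow, norm_norm]
      refine (integrable_integral_norm_sq_character_sub hρ hψ 0).mono'
        hm.stronglyMeasurable.integral_prod_left'.aestronglyMeasurable (ae_of_all _ fun t => ?_)
      rw [Real.norm_of_nonneg (integral_nonneg fun y => sq_nonneg _),
        integral_norm_sq_character_sub]
      exact le_add_of_nonneg_left (sq_nonneg _)
  integral_eq_zero := integral_centeredCharacter
  gram_im := fun x y => by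
    -- Conjugation amounts to `t ↦ -t`, so the symmetric `ρ` gives a Gram integral equal to its
    -- conjugate.
    have hconj : ∀ z t, (starRingEnd ℂ) (centeredCharacter μ z t) = centeredCharacter μ z (-t) := by
      intro z t
      simp only [centeredCharacter, map_sub, conj_character, ← integral_conj]
    rw [← Complex.conj_eq_iff_im, ← integral_conj]
    simp_rw [map_mul, Complex.conj_conj, hconj]
    rw [← integral_neg_eq_self]
    simp_rw [neg_neg]

end Characters

/-! ### The test statistic as a norm of the centered field. -/

section SampleMultivariance

variable {n N : ℕ} {d : Fin n → ℕ}

/-- Sample centering removes any term common to all sample points, so the true mean may be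
subtracted beforehand. -/
lemma sampleZ_eq_centeredSumField (hN : N ≠ 0) (μ : ∀ i, Measure (Euc (d i))) (S : Finset (Fin n))
    (x : Fin N → ∀ i, Euc (d i)) (t : ∀ i : S, Euc (d i)) :
    sampleZ S x t
      = (N : ℂ)⁻¹ * centeredSumField (fun i => centeredCharacter (μ i)) S x t := by
  have : (N : ℂ) ≠ 0 := Nat.cast_ne_zero.2 hN
  rw [sampleZ, centeredSumField, one_div]
  congr 1
  refine Finset.sum_congr rfl fun l _ => Finset.prod_congr rfl fun i _ => ?_
  simp only [centeredCharacter, character, Finset.sum_sub_distrib, Finset.sum_const,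
    Finset.card_univ, Fintype.card_fin, nsmul_eq_mul]
  field_simp
  ring

lemma mul_sampleM_sq (ρ μ : ∀ i, Measure (Euc (d i))) (S : Finset (Fin n))
    (x : Fin N → ∀ i, Euc (d i)) :
    N * sampleM ρ S x ^ 2 = (N : ℝ)⁻¹ * ∫ t, ‖centeredSumField (fun i => centeredCharacter (μ i))
      S x t‖ ^ 2 ∂(Measure.pi fun i : S => ρ i) := by
  rcases eq_or_ne N 0 with rfl | hN
  · simp
  have : (N : ℝ) ≠ 0 := Nat.cast_ne_zero.2 hN
  rw [sampleM, Real.sq_sqrt (integral_nonneg fun t => sq_nonneg _)]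
  simp_rw [sampleZ_eq_centeredSumField hN μ, norm_mul, mul_pow]
  rw [integral_const_mul, norm_inv, Complex.norm_natCast]
  field_simp

end SampleMultivariance

/-! ### Strong consistency in one coordinate. -/

section Consistency

variable {k : ℕ} {ρ μ : Measure (Euc k)} [SigmaFinite ρ] [IsProbabilityMeasure μ]
  [SecondCountableTopology (Lp ℂ 2 ρ)] {Ω : Type*} [MeasurableSpace Ω] {P : Measure Ω}
  [IsProbabilityMeasure P]

/-- Strong consistency of the estimators of one coordinate. -/
lemma ae_tendsto_est (h : IsCenteredKernel μ ρ (centeredCharacter μ)) {Y : ℕ → Ω → Euc k}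
    (hind : iIndepFun Y P) (hY : ∀ l, MeasurePreserving (Y l) P μ) {τ : ℕ → ℝ}
    (hτ : ∀ k, τ k = ∫ x, inner ℝ (h.toL2 x) ((covOp μ h.toL2 ^ k) (h.toL2 x)) ∂μ) :
    ∀ᵐ ω ∂P,
      Tendsto (fun N : ℕ => est1 (distMatrix ρ fun l : Fin N => Y l ω)) atTop (𝓝 (τ 0)) ∧
      Tendsto (fun N : ℕ => est2 (distMatrix ρ fun l : Fin N => Y l ω)) atTop (𝓝 (τ 1)) ∧
      Tendsto (fun N : ℕ => est3 (distMatrix ρ fun l : Fin N => Y l ω)) atTop (𝓝 (τ 2)) ∧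
      Tendsto (fun N : ℕ => est4 (distMatrix ρ fun l : Fin N => Y l ω)) atTop (𝓝 (τ 3)) := by
  let _ : MeasurableSpace (Lp ℂ 2 ρ) := borel _
  have : BorelSpace (Lp ℂ 2 ρ) := ⟨rfl⟩
  have hVm : Measurable h.toL2 := h.stronglyMeasurable_toL2.measurable
  have hmap : ∀ l : ℕ, P.map (fun ω => h.toL2 (Y l ω)) = μ.map h.toL2 := fun l =>
    (Measure.map_map hVm (hY l).measurable).symm.trans (congrArg (Measure.map _) (hY l).map_eq)
  have key := ae_all_iff.2 fun k => ae_tendsto_empirical_power_trace (P := P)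
    (U := fun l ω => h.toL2 (Y l ω))
    (hind.comp (fun _ => h.toL2) fun _ => hVm)
    (fun l => ⟨(hVm.comp (hY l).measurable).aemeasurable, (hVm.comp (hY 0).measurable).aemeasurable,
      (hmap l).trans (hmap 0).symm⟩)
    (h.memLp_toL2.comp_measurePreserving (hY 0))
    ((integral_comp_measurePreserving (hY 0) h.memLp_toL2.1).trans h.integral_toL2) k
  filter_upwards [key] with ω hω
  have hlim : ∀ k, Tendsto (fun N : ℕ => (N : ℝ)⁻¹ ^ (k + 1) * ((Matrix.of fun l m : Fin N =>
      inner ℝ (h.toL2 (Y l ω) - (N : ℝ)⁻¹ • ∑ j : Fin N, h.toL2 (Y j ω))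
        (h.toL2 (Y m ω) - (N : ℝ)⁻¹ • ∑ j : Fin N, h.toL2 (Y j ω)) :
        Matrix (Fin N) (Fin N) ℝ) ^ (k + 1)).trace) atTop (𝓝 (τ k)) := fun k => by
    rw [hτ, ← integral_inner_covOp_pow_comp_measurePreserving (hY 0) h.memLp_toL2.1 k]
    refine (hω k).congr fun N => ?_
    rw [← inner_empirical_pow fun l : Fin N =>
      h.toL2 (Y l ω) - (N : ℝ)⁻¹ • ∑ j : Fin N, h.toL2 (Y j ω)]
    simp only [Finset.sum_range]
  have hest := fun (N : ℕ) (hN : N ≠ 0) =>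
    est_eq_trace_gram hN fun l : Fin N => h.toL2 (Y l ω)
  -- This identifies the half squared distances in `est_eq_trace_gram` with the entries of
  -- `distMatrix`.
  simp only [half_norm_sq_toL2_centeredCharacter_sub] at hest
  refine ⟨(hlim 0).congr' ?_, (hlim 1).congr' ?_, (hlim 2).congr' ?_, (hlim 3).congr' ?_⟩ <;>
    filter_upwards [eventually_ne_atTop 0] with N hN
  · rw [zero_add, pow_one, pow_one]
    exact (hest N hN).1.symm
  · exact (hest N hN).2.1.symm
  · exact (hest N hN).2.2.1.symm
  · exact (hest N hN).2.2.2.symm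

end Consistency

/-! ### The theorem: both sides agree through the traces. -/

theorem corollary3p12 {n : ℕ} {d : Fin n → ℕ}
    (ρ : ∀ i, Measure (Euc (d i)))
    [∀ i, SigmaFinite (ρ i)] [∀ i, (ρ i).IsNegInvariant] [∀ i, (ρ i).IsOpenPosMeasure]
    (hρ : ∀ i, ∫⁻ t, ENNReal.ofReal (min 1 (‖t‖ ^ 2)) ∂(ρ i) < ⊤)
    {Ω Ω' : Type*} [MeasurableSpace Ω] [MeasurableSpace Ω']
    (P : Measure Ω) [IsProbabilityMeasure P] (P' : Measure Ω') [IsProbabilityMeasure P']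
    (X : Ω → ∀ i, Euc (d i)) (hX : Measurable X)
    (hψ : ∀ i, Integrable (fun ω => psi (ρ i) (X ω i)) P)
    -- the sample: independent copies of `X`, whose components may be dependent
    (Y : ℕ → Ω' → ∀ i, Euc (d i)) (hYindep : iIndepFun Y P')
    (hYident : ∀ l, IdentDistrib (Y l) X P' P)
    (S : Finset (Fin n)) (hS : 2 ≤ S.card) :
    -- the limit law under independence exists, and it has the asserted properties
    (∃ ν : Measure ℝ, IsProbabilityMeasure ν ∧
      IsLimitLawUnderIndependence ρ S (fun i => P.map fun ω => X ω i) ν) ∧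
    ∀ ν : Measure ℝ, IsProbabilityMeasure ν →
      IsLimitLawUnderIndependence ρ S (fun i => P.map fun ω => X ω i) ν →
      MemLp (fun y : ℝ => y) 4 ν ∧
      ∀ᵐ ω ∂P',
        Tendsto (fun N : ℕ => estS est1 ρ S fun l : Fin N => Y l ω)
          atTop (𝓝 (∫ y, y ∂ν)) ∧
        Tendsto (fun N : ℕ => 2 * estS est2 ρ S fun l : Fin N => Y l ω)
          atTop (𝓝 (variance (fun y : ℝ => y) ν)) ∧
        Tendsto (fun N : ℕ => 8 * estS est3 ρ S fun l : Fin N => Y l ω)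
          atTop (𝓝 (∫ y, (y - ∫ z, z ∂ν) ^ 3 ∂ν)) ∧
        Tendsto (fun N : ℕ => 48 * (estS est4 ρ S fun l : Fin N => Y l ω)
            + 12 * (estS est2 ρ S fun l : Fin N => Y l ω) ^ 2)
          atTop (𝓝 (∫ y, (y - ∫ z, z ∂ν) ^ 4 ∂ν)) := by
  set μ : ∀ i, Measure (Euc (d i)) := fun i => P.map fun ω => X ω i
  have hXi : ∀ i, Measurable fun ω => X ω i := fun i => (measurable_pi_apply i).comp hX
  have hprob : ∀ i, IsProbabilityMeasure (μ i) := fun i =>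
    Measure.isProbabilityMeasure_map (hXi i).aemeasurable
  have hF : ∀ i, IsCenteredKernel (μ i) (ρ i) (centeredCharacter (μ i)) := fun i =>
    isCenteredKernel_centeredCharacter (hρ i)
      ((integrable_map_measure measurable_psi.aestronglyMeasurable (hXi i).aemeasurable).2 (hψ i))
  have hsc : ∀ i, SecondCountableTopology (Lp ℂ 2 (ρ i)) := fun i => secondCountableTopology_Lp_two _
  have hscS : SecondCountableTopology (Lp ℂ 2 (Measure.pi fun i : S => ρ i)) :=
    secondCountableTopology_Lp_two _
  let τ : ∀ i : Fin n, ℕ → ℝ := fun i k =>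
    ∫ x, inner ℝ ((hF i).toL2 x) ((covOp (μ i) (hF i).toL2 ^ k) ((hF i).toL2 x)) ∂(μ i)
  obtain ⟨ν₀, hν₀, hlim, hL4, h1, h2, h3, h4⟩ := exists_limit_law_centeredSumField hF hS
    (τ := fun k => ∏ i : S, τ i k) fun k => rfl
  have hlaw : IsLimitLawUnderIndependence ρ S μ ν₀ := fun f => by
    simp_rw [mul_sampleM_sq ρ μ]
    exact hlim f
  refine ⟨⟨ν₀, hν₀, hlaw⟩, fun ν hν hνlaw => ?_⟩
  -- Weak limits are unique, so the moments computed for `ν₀` hold for any limit law.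
  obtain rfl : ν = ν₀ := ext_of_forall_integral_eq_of_IsFiniteMeasure fun f =>
    tendsto_nhds_unique (hνlaw f) (hlaw f)
  refine ⟨hL4, ?_⟩
  rw [h4, h3, h2, h1]
  -- The sample is only almost everywhere measurable; measurable modifications agree with it for all
  -- `l` at once, almost surely.
  have hae : ∀ᵐ ω ∂P', ∀ l, Y l ω = (hYident l).aemeasurable_fst.mk (Y l) ω :=
    ae_all_iff.2 fun l => (hYident l).aemeasurable_fst.ae_eq_mk
  set Y' : ℕ → Ω' → ∀ i, Euc (d i) := fun l => (hYident l).aemeasurable_fst.mk (Y l)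
  have hYm : ∀ l, Measurable (Y' l) := fun l => (hYident l).aemeasurable_fst.measurable_mk
  have hY'ind : iIndepFun Y' P' := hYindep.congr fun l => (hYident l).aemeasurable_fst.ae_eq_mk
  -- Only the marginal laws of the sample enter, whatever the dependence between its components.
  have hmp : ∀ i l, MeasurePreserving (fun ω => Y' l ω i) P' (μ i) := fun i l =>
    ⟨(measurable_pi_apply i).comp (hYm l), by
      have e1 : P'.map (Y' l) = P.map X := by
        rw [← (hYident l).map_eq]
        exact Measure.map_congr (hYident l).aemeasurable_fst.ae_eq_mk.symm
      have e2 := congrArg (Measure.map fun y : ∀ i, Euc (d i) => y i) e1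
      rwa [Measure.map_map (measurable_pi_apply i) (hYm l),
        Measure.map_map (measurable_pi_apply i) hX] at e2⟩
  have hall := ae_all_iff.2 fun i => ae_tendsto_est (hF i) (Y := fun l ω => Y' l ω i)
    (hY'ind.comp (fun _ y => y i) fun _ => measurable_pi_apply i) (hmp i) (τ := τ i) fun k => rfl
  filter_upwards [hae, hall] with ω hω hest
  have hprod : ∀ (est : ∀ N : ℕ, Matrix (Fin N) (Fin N) ℝ → ℝ) (k : ℕ),
      (∀ i, Tendsto (fun N : ℕ => est N (distMatrix (ρ i) fun l : Fin N => Y' l ω i))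
        atTop (𝓝 (τ i k))) →
      Tendsto (fun N : ℕ => estS (est N) ρ S fun l : Fin N => Y l ω) atTop
        (𝓝 (∏ i : S, τ i k)) := fun est k h => by
    simp only [estS, hω]
    rw [Finset.prod_coe_sort S fun i => τ i k]
    exact tendsto_finsetProd S fun i _ => h i
  have t1 := hprod (fun _ => est1) 0 fun i => (hest i).1
  have t2 := hprod (fun _ => est2) 1 fun i => (hest i).2.1
  have t3 := hprod (fun _ => est3) 2 fun i => (hest i).2.2.1
  have t4 := hprod (fun _ => est4) 3 fun i => (hest i).2.2.2
  exact ⟨t1, t2.const_mul 2, t3.const_mul 8, (t4.const_mul 48).add ((t2.pow 2).const_mul 12)⟩
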